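/- \textbf{Theorem (unweighted dynamic $p$-Matching).} A \emph{dynamic graph stream} on the vertex set $\{0,\dots,n-1\}$ is a finite sequence $\mathcal S$ of edge insertions and edge deletions, starting from the empty edge set, in which only absent edges are inserted and only present edges are deleted; it describes the simple graph $G$ whose edges are those inserted and not deleted. A \emph{matching} of $G$ is a set of edges of $G$ no two of which share an endpoint, and a \emph{$k$-matching} is a matching with exactly $k$ edges. The computational model is a randomized word RAM with words of $O(\log n)$ bits, in which each basic operation on words (including the drawing of a uniformly random word) takes one step. A one-pass streaming algorithm consists of three fixed programs: one run before the stream (on input $n$ and $k$), one run after each element of the stream is read, and one run when a solution is queried, here at the end of the stream. Its \emph{update time} is the largest number of steps taken to process a single stream element; its \emph{space} is the total number of bits of the registers and memory cells used by the three programs. There are such a randomized algorithm and constants $C>0$ and $a\in\mathbb N$ such that for all integers $n,k$ with $1\le k\le n/2$ and every dynamic graph stream $\mathcal S$ of a graph $G$ on $n$ vertices, the algorithm on input $(\mathcal S,k)$ always halts, outputs a matching $M'$ of $G$, and satisfies: (1) if $G$ contains a $k$-matching, then with probability at least $1-\dfrac{11}{20k^3\ln(2k)}$ the output $M'$ is a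 $k$-matching of $G$; (2) if $G$ does not contain a $k$-matching, then $M'=\emptyset$ (with certainty); (3) for every outcome of the random choices, the space is at most $C\,k^2(\ln n)^a$ bits, that is, $\tilde O(k^2)$, and the update time is at most $C(\ln n)^a$ steps, that is, $\tilde O(1)$. -/

import Mathlib

/-! ## Graph streams and matchings -/

/-- One element of a dynamic stream of an unweighted graph on the vertices `0, …, n - 1`: an edge
`uv`, written with `u < v`, together with the operation, an insertion or a deletion. -/
structure EdgeUpdate (n : ℕ) where
  u : Fin n
  v : Fin n
  lt : u < v
  isInsert : Bool

namespace EdgeUpdate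

variable {n : ℕ}

/-- The edge that is updated. -/
def edge (e : EdgeUpdate n) : Sym2 (Fin n) := s(e.u, e.v)

/-- The effect of the update on the current edge set. -/
def apply (e : EdgeUpdate n) (E : Finset (Sym2 (Fin n))) : Finset (Sym2 (Fin n)) :=
  if e.isInsert then insert e.edge E else E.erase e.edge

/-- An edge can be inserted only when it is absent, and deleted only when it is present. -/
def Admissible (e : EdgeUpdate n) (E : Finset (Sym2 (Fin n))) : Prop :=
  if e.isInsert then e.edge ∉ E else e.edge ∈ E

end EdgeUpdate

/-- `S` is a legal sequence of updates when it starts at the edge set `E`. -/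
def LegalFrom {n : ℕ} : Finset (Sym2 (Fin n)) → List (EdgeUpdate n) → Prop
  | _, [] => True
  | E, e :: S => e.Admissible E ∧ LegalFrom (e.apply E) S

/-- A dynamic graph stream: a legal sequence of updates starting at the empty edge set. -/
def IsGraphStream {n : ℕ} (S : List (EdgeUpdate n)) : Prop := LegalFrom ∅ S

/-- The graph that is described by the stream: its edges are those inserted and not deleted. -/
def streamGraph {n : ℕ} (S : List (EdgeUpdate n)) : SimpleGraph (Fin n) :=
  SimpleGraph.fromEdgeSet (S.foldl (fun E e => e.apply E) ∅ : Finset (Sym2 (Fin n)))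

/-- A matching of `G`, as a set of edges: no two distinct edges of `M` share an endpoint. -/
def IsEdgeMatching {V : Type*} (G : SimpleGraph V) (M : Finset (Sym2 V)) : Prop :=
  (∀ e ∈ M, e ∈ G.edgeSet) ∧
    ∀ e ∈ M, ∀ f ∈ M, e ≠ f → ∀ x : V, ¬ (x ∈ e ∧ x ∈ f)

/-- A matching with exactly `k` edges. -/
def IsKMatching {V : Type*} (G : SimpleGraph V) (k : ℕ) (M : Finset (Sym2 V)) : Prop :=
  IsEdgeMatching G M ∧ M.card = k

/-! ## A randomized word RAM -/

namespace WordRAM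

/-- The binary operations on words. -/
inductive Op
  | add | sub | mul | div | mod | lt | eq | and | or | xor | shl | shr

/-- The value of an operation on words of `w` bits (numbers below `2 ^ w`); arithmetic is modulo
`2 ^ w`, and a comparison returns `1` for true and `0` for false. -/
def Op.eval (w : ℕ) : Op → ℕ → ℕ → ℕ
  | .add, a, b => (a + b) % 2 ^ w
  | .sub, a, b => (a + 2 ^ w - b) % 2 ^ w
  | .mul, a, b => (a * b) % 2 ^ w
  | .div, a, b => (a / b) % 2 ^ w
  | .mod, a, b => (a % b) % 2 ^ w
  | .lt, a, b => (if a < b then 1 else 0) % 2 ^ w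
  | .eq, a, b => (if a = b then 1 else 0) % 2 ^ w
  | .and, a, b => (a &&& b) % 2 ^ w
  | .or, a, b => (a ||| b) % 2 ^ w
  | .xor, a, b => (a ^^^ b) % 2 ^ w
  | .shl, a, b => (a <<< b) % 2 ^ w
  | .shr, a, b => (a >>> b) % 2 ^ w

/-- Programs. Registers are numbered by natural numbers; a program names finitely many of them. -/
inductive Cmd
  /-- Do nothing. -/
  | skip
  /-- `const x c`: register `x` gets the constant `c`. -/
  | const (x c : ℕ)
  /-- `op o x y z`: register `x` gets the result of `o` on the registers `y` and `z`. -/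
  | op (o : Op) (x y z : ℕ)
  /-- `load x y`: register `x` gets the memory cell whose address is in register `y`. -/
  | load (x y : ℕ)
  /-- `store x y`: the memory cell whose address is in register `x` gets register `y`. -/
  | store (x y : ℕ)
  /-- `rand x`: register `x` gets a fresh uniformly random word. -/
  | rand (x : ℕ)
  /-- `emit x y`: append the pair of the registers `x`, `y` to the write-only output. -/
  | emit (x y : ℕ)
  /-- Sequential composition. -/
  | seq (c d : Cmd)
  /-- `ite x c d`: execute `c` if register `x` is nonzero, and `d` otherwise. -/
  | ite (x : ℕ) (c d : Cmd)
  /-- `loop x c`: while register `x` is nonzero, execute `c`. -/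
  | loop (x : ℕ) (c : Cmd)

/-- The number of registers of a program (one more than the largest number of a register that is
named in it). -/
def Cmd.numRegs : Cmd → ℕ
  | .skip => 0
  | .const x _ => x + 1
  | .op _ x y z => max (x + 1) (max (y + 1) (z + 1))
  | .load x y => max (x + 1) (y + 1)
  | .store x y => max (x + 1) (y + 1)
  | .rand x => x + 1
  | .emit x y => max (x + 1) (y + 1)
  | .seq c d => max c.numRegs d.numRegs
  | .ite x c d => max (x + 1) (max c.numRegs d.numRegs)
  | .loop x c => max (x + 1) c.numRegs

/-- A state of the machine: the registers, the memory, the number of memory cells in use (one more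
than the largest address that has been read or written so far), the number of random words that
have been drawn, and the output. -/
structure State where
  reg : ℕ → ℕ
  mem : ℕ → ℕ
  used : ℕ
  drawn : ℕ
  out : List (ℕ × ℕ)

/-- Set register `x` to `a`. -/
def State.setReg (s : State) (x a : ℕ) : State :=
  { s with reg := Function.update s.reg x a }

/-- The memory cell `i` is accessed. -/
def State.touch (s : State) (i : ℕ) : State :=
  { s with used := max s.used (i + 1) }

/-- Set the memory cell `i` to `a`. -/
def State.setMem (s : State) (i a : ℕ) : State :=
  { s with mem := Function.update s.mem i a }

/-- `Exec w ω c s t s'`: with words of `w` bits, and with `ω` as the sequence of the random words,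
the program `c` started in the state `s` halts in the state `s'` after `t` steps. Each elementary
instruction and each test of a condition is one step. The random words are read once and in
order. -/
inductive Exec (w : ℕ) (ω : ℕ → Fin (2 ^ w)) : Cmd → State → ℕ → State → Prop
  | skip (s : State) : Exec w ω .skip s 1 s
  | const (x c : ℕ) (s : State) : Exec w ω (.const x c) s 1 (s.setReg x (c % 2 ^ w))
  | op (o : Op) (x y z : ℕ) (s : State) :
      Exec w ω (.op o x y z) s 1 (s.setReg x (o.eval w (s.reg y) (s.reg z)))
  | load (x y : ℕ) (s : State) :
      Exec w ω (.load x y) s 1 ((s.touch (s.reg y)).setReg x (s.mem (s.reg y)))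
  | store (x y : ℕ) (s : State) :
      Exec w ω (.store x y) s 1 ((s.touch (s.reg x)).setMem (s.reg x) (s.reg y))
  | rand (x : ℕ) (s : State) :
      Exec w ω (.rand x) s 1
        { s.setReg x (ω s.drawn : ℕ) with drawn := s.drawn + 1 }
  | emit (x y : ℕ) (s : State) :
      Exec w ω (.emit x y) s 1 { s with out := s.out ++ [(s.reg x, s.reg y)] }
  | seq {c d : Cmd} {s s' s'' : State} {t t' : ℕ} :
      Exec w ω c s t s' → Exec w ω d s' t' s'' → Exec w ω (.seq c d) s (t + t') s''
  | ite_true {x : ℕ} {c d : Cmd} {s s' : State} {t : ℕ} :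
      s.reg x ≠ 0 → Exec w ω c s t s' → Exec w ω (.ite x c d) s (1 + t) s'
  | ite_false {x : ℕ} {c d : Cmd} {s s' : State} {t : ℕ} :
      s.reg x = 0 → Exec w ω d s t s' → Exec w ω (.ite x c d) s (1 + t) s'
  | loop_true {x : ℕ} {c : Cmd} {s s' s'' : State} {t t' : ℕ} :
      s.reg x ≠ 0 → Exec w ω c s t s' → Exec w ω (.loop x c) s' t' s'' →
        Exec w ω (.loop x c) s (1 + t + t') s''
  | loop_false {x : ℕ} {c : Cmd} {s : State} :
      s.reg x = 0 → Exec w ω (.loop x c) s 1 s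

/-- The machine is deterministic once the random words are fixed. -/
theorem Exec.unique {w : ℕ} {ω : ℕ → Fin (2 ^ w)} {c : Cmd} {s s₁ s₂ : State} {t₁ t₂ : ℕ}
    (h₁ : Exec w ω c s t₁ s₁) (h₂ : Exec w ω c s t₂ s₂) : t₁ = t₂ ∧ s₁ = s₂ := by
  induction h₁ generalizing t₂ s₂ with
  | skip | const | op | load | store | rand | emit => cases h₂; exact ⟨rfl, rfl⟩
  | seq _ _ ih₁ ih₂ =>
    cases h₂ with
    | seq k₁ k₂ =>
      obtain ⟨rfl, rfl⟩ := ih₁ k₁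
      obtain ⟨rfl, rfl⟩ := ih₂ k₂
      exact ⟨rfl, rfl⟩
  | ite_true hx _ ih =>
    cases h₂ with
    | ite_true _ k => obtain ⟨rfl, rfl⟩ := ih k; exact ⟨rfl, rfl⟩
    | ite_false hy _ => exact absurd hy hx
  | ite_false hx _ ih =>
    cases h₂ with
    | ite_true hy _ => exact absurd hx hy
    | ite_false _ k => obtain ⟨rfl, rfl⟩ := ih k; exact ⟨rfl, rfl⟩
  | loop_true hx _ _ ih₁ ih₂ =>
    cases h₂ with
    | loop_true _ k₁ k₂ =>
      obtain ⟨rfl, rfl⟩ := ih₁ k₁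
      obtain ⟨rfl, rfl⟩ := ih₂ k₂
      exact ⟨rfl, rfl⟩
    | loop_false hy => exact absurd hy hx
  | loop_false hx =>
    cases h₂ with
    | loop_true hy _ _ => exact absurd hx hy
    | loop_false _ => exact ⟨rfl, rfl⟩

/-- The law of a sequence of independent uniformly random words of `w` bits. -/
noncomputable def randomWords (w : ℕ) : MeasureTheory.Measure (ℕ → Fin (2 ^ w)) :=
  MeasureTheory.Measure.infinitePi
    (fun _ : ℕ => (PMF.uniformOfFintype (Fin (2 ^ w))).toMeasure)

end WordRAM

/-! ## One-pass streaming algorithms -/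

open WordRAM in
/-- A (randomized, one-pass) parameterized streaming algorithm: a program that is run before the
stream, a program that is run after each element of the stream is read, and a program that is run
when the algorithm is queried. The same programs serve all inputs. The words have
`wordFactor * (⌊log₂ n⌋ + 1)` bits on graphs with `n` vertices. -/
structure StreamingAlgorithm where
  preprocess : Cmd
  update : Cmd
  query : Cmd
  wordFactor : ℕ
  wordFactor_pos : 0 < wordFactor

namespace StreamingAlgorithm

open WordRAM

/-- The word length, in bits, on graphs with `n` vertices. -/
def wordLength (A : StreamingAlgorithm) (n : ℕ) : ℕ := A.wordFactor * (Nat.log 2 n + 1)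

/-- The number of registers of the machine; the input is passed in the first three. -/
def numRegs (A : StreamingAlgorithm) : ℕ :=
  max 3 (max A.preprocess.numRegs (max A.update.numRegs A.query.numRegs))

/-- The state at the start: `n` and `k` are in the first two registers, all else is zero. -/
def start (n k : ℕ) : State where
  reg := Function.update (Function.update (fun _ => 0) 0 n) 1 k
  mem := fun _ => 0
  used := 0
  drawn := 0
  out := []

/-- The element `(uv, op)` of the stream is read: `u`, `v`, and `1` for an insertion, `0` for a
deletion, are put into the first three registers. -/
def feed {n : ℕ} (s : State) (e : EdgeUpdate n) : State :=
  ((s.setReg 0 e.u).setReg 1 e.v).setReg 2 (if e.isInsert then 1 else 0)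

/-- `A.Reads k ω S T s`: on the parameter `k` and the random words `ω`, after the preprocessing and
the reading of the stream `S` the algorithm is in the state `s`, and each single update on the way
has taken at most `T` steps (`T` is the largest number of steps of an update). -/
inductive Reads (A : StreamingAlgorithm) {n : ℕ} (k : ℕ) (ω : ℕ → Fin (2 ^ A.wordLength n)) :
    List (EdgeUpdate n) → ℕ → State → Prop
  | nil {t : ℕ} {s : State} :
      Exec (A.wordLength n) ω A.preprocess (start n k) t s → Reads A k ω [] 0 s
  | snoc {S : List (EdgeUpdate n)} {e : EdgeUpdate n} {T t : ℕ} {s s' : State} :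
      Reads A k ω S T s → Exec (A.wordLength n) ω A.update (feed s e) t s' →
        Reads A k ω (S ++ [e]) (max T t) s'

/-- The list `l` of pairs of numbers lists the edges in `M`. -/
def ListsEdges {n : ℕ} (l : List (ℕ × ℕ)) (M : Finset (Sym2 (Fin n))) : Prop :=
  (l.map (fun p => s(p.1, p.2))).toFinset = M.image (Sym2.map Fin.val)

/-- `A.Outputs k S ω T B M`: on the input `(S, k)` and the random words `ω`, the algorithm, queried
at the end of the stream `S`, halts with the output `M`; its update time is `T` steps, and the
preprocessing, the updates and the query together have used a space of `B` bits, which are the bits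
of all the registers and of all the memory cells in use. -/
def Outputs (A : StreamingAlgorithm) {n : ℕ} (k : ℕ) (S : List (EdgeUpdate n))
    (ω : ℕ → Fin (2 ^ A.wordLength n)) (T B : ℕ) (M : Finset (Sym2 (Fin n))) : Prop :=
  ∃ (s s' : State) (t : ℕ), A.Reads k ω S T s ∧
    Exec (A.wordLength n) ω A.query { s with out := [] } t s' ∧
    ListsEdges s'.out M ∧
    B = (A.numRegs + s'.used) * A.wordLength n

end StreamingAlgorithm

/-! The algorithm keeps a linear sketch of the edge set. Write D for `dd n`, a constant multiple of
log n. A vertex is hashed to one of 8k blocks through a random table (D tables q) and to one of 20D²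
positions inside its block by a linear hash function (D functions a); block and position together
are its cell. An edge is kept or dropped by a linear sampling hash function (D functions c) at a
rate of about 2^(-l) (D levels l). A sampler is a tuple (q, a, b, c, l), with a used for the smaller
endpoint and b for the larger one. It splits the edges into classes according to the sampling bit
and the cells of the two endpoints. For each class the number of its edges and the sum of their
numbers are maintained modulo 2^w. An update touches D^5 classes, and there are O(k² D^9) classes in
all.

Soundness is deterministic. True counts never reach 2^w, so a counter equal to 1 means that the
class holds exactly one edge, whose number is then the stored sum. The query, whose time is not
restricted, tries all k-tuples of classes for one with counters 1 and pairwise disjoint edges. So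
the output is a k-matching or empty, for all random choices (`exists_matching`, `run`).

For completeness, fix a k-matching μ with set V of at most 2k endpoints. Outside a small failure
probability, some table q puts at most D elements of V into each block
(`cnt_forall_not_goodTable_le`), and each block β then has a position hash α(β) that is injective on
the elements of V in it (`cnt_forall_not_injOn_sub_le`). For the edge μ i take the hashes α of the
blocks of its two ends. The edges with the same pair of cells as μ i form a nonempty set, and at the
level fitted to the size of this set some sampling hash isolates one of its members f i
(`card_isolating`, `cnt_forall_not_isolates_le`). The edge f i need not be μ i. But a vertex common
to f i and f j, in block β say, would share block and position under α(β) with an end of μ i and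
with an end of μ j, which forces these ends to coincide (`good_of_isolates`). A union bound leaves a
failure probability of at most (1 + 8kD + kD³)(31/32)^D, and the factor 1024 in D makes this small
enough (`failure_bound`).

Probabilities are handled as counts of finite tapes of words, and independence is replaced by
resampling one part of a tape (`card_resample_le`). The programs are verified with a
total-correctness logic (`Hoare`), in which only the update program needs an explicit time bound. -/

namespace WordRAM

/-! ### Expressions and a program logic for the word RAM -/

/-- Registers below `tmp` are program variables, the others hold intermediate values. -/
abbrev tmp : ℕ := 64

/-- Arithmetic expressions over registers and memory. -/
inductive Ex
  | var (x : ℕ)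
  | lit (c : ℕ)
  | bin (o : Op) (a b : Ex)
  | ld (a : Ex)

namespace Ex

instance : Add Ex := ⟨bin .add⟩
instance : Sub Ex := ⟨bin .sub⟩
instance : Mul Ex := ⟨bin .mul⟩
instance : Div Ex := ⟨bin .div⟩
instance : Mod Ex := ⟨bin .mod⟩

/-- The code that computes an expression into register `d`, using registers from `d` on. -/
def comp : Ex → ℕ → Cmd
  | var x, d => .op .or d x x
  | lit c, d => .const d c
  | bin o a b, d => .seq (a.comp d) (.seq (b.comp (d + 1)) (.op o d d (d + 1)))
  | ld a, d => .seq (a.comp d) (.load d d)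

/-- The value of an expression. -/
def eval (w : ℕ) (s : State) : Ex → ℕ
  | var x => s.reg x
  | lit c => c % 2 ^ w
  | bin o a b => o.eval w (a.eval w s) (b.eval w s)
  | ld a => s.mem (a.eval w s)

/-- The expression uses variables only and reads memory below `U`. -/
def Ok (w U : ℕ) (s : State) : Ex → Prop
  | var x => x < tmp
  | lit _ => True
  | bin _ a b => a.Ok w U s ∧ b.Ok w U s
  | ld a => a.Ok w U s ∧ a.eval w s < U

end Ex

/-- All values are words. -/
structure Valid (w : ℕ) (s : State) : Prop where
  reg : ∀ x < tmp, s.reg x < 2 ^ w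
  mem : ∀ i, s.mem i < 2 ^ w

/-- The state `s` of the machine agrees with `σ` up to intermediate registers, and has used at
most `U` memory cells. -/
structure Matches (w U : ℕ) (s σ : State) : Prop where
  reg : ∀ x < tmp, s.reg x = σ.reg x
  mem : s.mem = σ.mem
  drawn : s.drawn = σ.drawn
  out : s.out = σ.out
  used : s.used ≤ U
  regLt : ∀ x, s.reg x < 2 ^ w
  memLt : ∀ i, s.mem i < 2 ^ w

theorem Matches.valid {w U : ℕ} {s σ : State} (h : Matches w U s σ) : Valid w σ :=
  ⟨fun x hx => h.reg x hx ▸ h.regLt x, fun i => h.mem ▸ h.memLt i⟩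

@[simp] theorem State.setReg_reg (s : State) (x a y : ℕ) :
    (s.setReg x a).reg y = if y = x then a else s.reg y := by
  simp [State.setReg, Function.update_apply]
@[simp] theorem State.setReg_mem (s : State) (x a : ℕ) : (s.setReg x a).mem = s.mem := rfl
@[simp] theorem State.setReg_drawn (s : State) (x a : ℕ) : (s.setReg x a).drawn = s.drawn := rfl
@[simp] theorem State.setReg_out (s : State) (x a : ℕ) : (s.setReg x a).out = s.out := rfl
@[simp] theorem State.setMem_reg (s : State) (i a : ℕ) : (s.setMem i a).reg = s.reg := rfl
@[simp] theorem State.setMem_mem (s : State) (i a j : ℕ) :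
    (s.setMem i a).mem j = if j = i then a else s.mem j := by
  simp [State.setMem, Function.update_apply]
@[simp] theorem State.setMem_drawn (s : State) (i a : ℕ) : (s.setMem i a).drawn = s.drawn := rfl
@[simp] theorem State.setMem_out (s : State) (i a : ℕ) : (s.setMem i a).out = s.out := rfl
@[simp] theorem State.touch_reg (s : State) (i : ℕ) : (s.touch i).reg = s.reg := rfl

theorem Op.eval_lt (w : ℕ) (o : Op) (a b : ℕ) : o.eval w a b < 2 ^ w := by
  have : 0 < 2 ^ w := by positivity
  cases o <;> exact Nat.mod_lt _ this

theorem Matches.setTmp {w U : ℕ} {s σ : State} (h : Matches w U s σ) {d v : ℕ} (hd : tmp ≤ d)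
    (hv : v < 2 ^ w) : Matches w U (s.setReg d v) σ where
  reg x hx := by rw [State.setReg_reg, if_neg (by omega), h.reg x hx]
  mem := h.mem
  drawn := h.drawn
  out := h.out
  used := h.used
  regLt x := by rw [State.setReg_reg]; split_ifs; exacts [hv, h.regLt x]
  memLt := h.memLt

theorem Matches.setReg {w U : ℕ} {s σ : State} (h : Matches w U s σ) {x v : ℕ}
    (hv : v < 2 ^ w) : Matches w U (s.setReg x v) (σ.setReg x v) where
  reg y hy := by simp only [State.setReg_reg]; split_ifs; exacts [rfl, h.reg y hy]
  mem := h.mem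
  drawn := h.drawn
  out := h.out
  used := h.used
  regLt y := by rw [State.setReg_reg]; split_ifs; exacts [hv, h.regLt y]
  memLt := h.memLt

theorem Matches.touch {w U : ℕ} {s σ : State} (h : Matches w U s σ) {i : ℕ} (hi : i < U) :
    Matches w U (s.touch i) σ :=
  ⟨h.reg, h.mem, h.drawn, h.out, max_le h.used hi, h.regLt, h.memLt⟩

theorem Matches.setMem {w U : ℕ} {s σ : State} (h : Matches w U s σ) {i v : ℕ}
    (hv : v < 2 ^ w) : Matches w U (s.setMem i v) (σ.setMem i v) where
  reg := h.reg
  mem := by simp only [State.setMem, h.mem]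
  drawn := h.drawn
  out := h.out
  used := h.used
  regLt := h.regLt
  memLt j := by rw [State.setMem_mem]; split_ifs; exacts [hv, h.memLt j]

variable {w U : ℕ} {ω : ℕ → Fin (2 ^ w)}

/-- The code for target `d` leaves the registers below `d` alone. This last clause carries the
induction: the left operand waits in `d` while the right one is computed in `d + 1`. -/
theorem Ex.comp_spec {σ : State} (e : Ex) :
    ∀ (d : ℕ) (s : State), Matches w U s σ → e.Ok w U σ → tmp ≤ d →
      ∃ t s', Exec w ω (e.comp d) s t s' ∧ Matches w U s' σ ∧ s'.reg d = e.eval w σ ∧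
        ∀ y < d, s'.reg y = s.reg y := by
  have hw : 0 < 2 ^ w := by positivity
  induction e with
  | var x =>
    intro d s h hx hd
    refine ⟨_, _, .op _ _ _ _ _, h.setTmp hd (Op.eval_lt _ _ _ _), ?_, ?_⟩
    · simp [Op.eval, Ex.eval, h.reg x hx, Nat.mod_eq_of_lt (h.valid.reg x hx)]
    · intro y hy; rw [State.setReg_reg, if_neg (by omega)]
  | lit c =>
    intro d s h _ hd
    refine ⟨_, _, .const _ _ _, h.setTmp hd (Nat.mod_lt _ hw), ?_, ?_⟩
    · simp [Ex.eval]
    · intro y hy; rw [State.setReg_reg, if_neg (by omega)]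
  | bin o a b iha ihb =>
    intro d s h hok hd
    obtain ⟨t₁, s₁, e₁, h₁, v₁, k₁⟩ := iha d s h hok.1 hd
    obtain ⟨t₂, s₂, e₂, h₂, v₂, k₂⟩ := ihb (d + 1) s₁ h₁ hok.2 (by omega)
    refine ⟨_, _, .seq e₁ (.seq e₂ (.op _ _ _ _ _)), h₂.setTmp hd (Op.eval_lt _ _ _ _), ?_, ?_⟩
    · rw [State.setReg_reg, if_pos rfl, v₂, k₂ d (by omega), v₁]; rfl
    · intro y hy
      rw [State.setReg_reg, if_neg (by omega), k₂ y (by omega), k₁ y hy]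
  | ld a iha =>
    intro d s h hok hd
    obtain ⟨t₁, s₁, e₁, h₁, v₁, k₁⟩ := iha d s h hok.1 hd
    refine ⟨_, _, .seq e₁ (.load _ _ _), (h₁.touch (v₁ ▸ hok.2)).setTmp hd (h₁.memLt _), ?_, ?_⟩
    · rw [State.setReg_reg, if_pos rfl, v₁, h₁.mem]; rfl
    · intro y hy
      rw [State.setReg_reg, if_neg (by omega), State.touch_reg, k₁ y hy]

/-- The number of instructions of a program without loops bounds its running time. -/
def Cmd.len : Cmd → ℕ
  | .seq c d => c.len + d.len
  | .ite _ c d => 1 + (c.len + d.len)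
  | _ => 1

/-- The program has no loops. -/
def Cmd.loopFree : Cmd → Bool
  | .seq c d => c.loopFree && d.loopFree
  | .ite _ c d => c.loopFree && d.loopFree
  | .loop _ _ => false
  | _ => true

theorem Exec.le_len {c : Cmd} {s s' : State} {t : ℕ} (h : Exec w ω c s t s')
    (hc : c.loopFree = true) : t ≤ c.len := by
  induction h with
  | skip | const | op | load | store | rand | emit => exact le_rfl
  | seq _ _ ih₁ ih₂ =>
    simp only [Cmd.loopFree, Bool.and_eq_true] at hc
    exact add_le_add (ih₁ hc.1) (ih₂ hc.2)
  | ite_true _ _ ih =>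
    simp only [Cmd.loopFree, Bool.and_eq_true] at hc
    have := ih hc.1
    simp only [Cmd.len]; omega
  | ite_false _ _ ih =>
    simp only [Cmd.loopFree, Bool.and_eq_true] at hc
    have := ih hc.2
    simp only [Cmd.len]; omega
  | loop_true => simp [Cmd.loopFree] at hc
  | loop_false => simp [Cmd.loopFree] at hc

theorem Ex.comp_loopFree (e : Ex) : ∀ d, (e.comp d).loopFree = true := by
  induction e with
  | var | lit => intro d; rfl
  | bin o a b iha ihb => intro d; simp [Ex.comp, Cmd.loopFree, iha, ihb]
  | ld a iha => intro d; simp [Ex.comp, Cmd.loopFree, iha]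

/-- Total correctness with a bound on the running time: started in a state that agrees with `σ`,
the program halts within `T` steps in a state that agrees with a state with the property `Q`. -/
def Hoare (w U : ℕ) (ω : ℕ → Fin (2 ^ w)) (c : Cmd) (T : ℕ∞) (σ : State) (Q : State → Prop) :
    Prop :=
  ∀ s, Matches w U s σ → ∃ (t : ℕ) (s' σ' : State), (t : ℕ∞) ≤ T ∧ Exec w ω c s t s' ∧
    Matches w U s' σ' ∧ Q σ'

/-- Assign the value of `e` to the variable `x`. -/
def Cmd.set (x : ℕ) (e : Ex) : Cmd := .seq (e.comp tmp) (.op .or x tmp tmp)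

/-- Store the value of `e` at the address `a`. -/
def Cmd.put (a e : Ex) : Cmd :=
  .seq (a.comp tmp) (.seq (e.comp (tmp + 1)) (.store tmp (tmp + 1)))

/-- Emit a pair of values. -/
def Cmd.print (a b : Ex) : Cmd :=
  .seq (a.comp tmp) (.seq (b.comp (tmp + 1)) (.emit tmp (tmp + 1)))

/-- A conditional on the value of an expression. -/
def Cmd.cond (e : Ex) (c d : Cmd) : Cmd := .seq (e.comp tmp) (.ite tmp c d)

/-- A loop on the value of an expression. -/
def Cmd.whil (e : Ex) (c : Cmd) : Cmd := .seq (e.comp tmp) (.loop tmp (.seq c (e.comp tmp)))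

/-- The variable `i` runs from zero up to the value of the variable `b`. -/
def Cmd.forTo (i b : ℕ) (c : Cmd) : Cmd :=
  .seq (.set i (.lit 0))
    (.whil (.bin .lt (.var i) (.var b)) (.seq c (.set i (.var i + .lit 1))))

/-- A sequence of programs. -/
def Cmd.block (l : List Cmd) : Cmd := l.foldr .seq .skip

/-! ### Proof rules of the program logic -/

section Hoare

variable {c d : Cmd} {T T₁ T₂ : ℕ∞} {σ : State} {Q Q' : State → Prop}

theorem Hoare.of_valid (h : Valid w σ → Hoare w U ω c T σ Q) : Hoare w U ω c T σ Q :=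
  fun s hs => h hs.valid s hs

theorem Hoare.mono (h : Hoare w U ω c T₁ σ Q) (hT : T₁ ≤ T) (hQ : ∀ σ', Valid w σ' → Q σ' → Q' σ') :
    Hoare w U ω c T σ Q' := by
  intro s hs
  obtain ⟨t, s', σ', ht, e, hm, hq⟩ := h s hs
  exact ⟨t, s', σ', ht.trans hT, e, hm, hQ _ hm.valid hq⟩

/-- Separates time from correctness: loop-free code is verified with the bound `⊤`, and the finite
bound is read off from its text afterwards. -/
theorem Hoare.of_loopFree (h : Hoare w U ω c ⊤ σ Q) (hc : c.loopFree = true) :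
    Hoare w U ω c c.len σ Q := by
  intro s hs
  obtain ⟨t, s', σ', _, e, hm, hq⟩ := h s hs
  exact ⟨t, s', σ', by exact_mod_cast e.le_len hc, e, hm, hq⟩

theorem Hoare.seq (h : Hoare w U ω c T₁ σ fun σ' => Hoare w U ω d T₂ σ' Q) :
    Hoare w U ω (.seq c d) (T₁ + T₂) σ Q := by
  intro s hs
  obtain ⟨t, s', σ', ht, e, hm, hq⟩ := h s hs
  obtain ⟨t', s'', σ'', ht', e', hm', hq'⟩ := hq s' hm
  exact ⟨t + t', s'', σ'', by push_cast; exact add_le_add ht ht', .seq e e', hm', hq'⟩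

theorem Hoare.seq_top (h : Hoare w U ω c ⊤ σ fun σ' => Hoare w U ω d ⊤ σ' Q) :
    Hoare w U ω (.seq c d) ⊤ σ Q := by
  simpa using Hoare.seq h

theorem Cmd.set_loopFree (x : ℕ) (e : Ex) : (Cmd.set x e).loopFree = true := by
  simp [Cmd.set, Cmd.loopFree, Ex.comp_loopFree]

theorem Cmd.put_loopFree (a e : Ex) : (Cmd.put a e).loopFree = true := by
  simp [Cmd.put, Cmd.loopFree, Ex.comp_loopFree]

theorem Hoare.set {x v : ℕ} {e : Ex} (hok : e.Ok w U σ) (hv : e.eval w σ = v)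
    (h : Valid w (σ.setReg x v) → Q (σ.setReg x v)) :
    Hoare w U ω (.set x e) (Cmd.set x e).len σ Q := by
  refine Hoare.of_loopFree ?_ (Cmd.set_loopFree x e)
  intro s hs
  obtain ⟨t, s', he, hm, hr, -⟩ := e.comp_spec (ω := ω) tmp s hs hok le_rfl
  have hlt : s'.reg tmp < 2 ^ w := hm.regLt _
  have : Op.or.eval w (s'.reg tmp) (s'.reg tmp) = v := by
    rw [← hv, ← hr]
    simp [Op.eval, Nat.mod_eq_of_lt hlt]
  have hm' : Matches w U (s'.setReg x (Op.or.eval w (s'.reg tmp) (s'.reg tmp))) (σ.setReg x v) := by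
    rw [this]; exact hm.setReg (hv ▸ hr ▸ hlt)
  exact ⟨_, _, _, le_top, .seq he (.op _ _ _ _ _), hm', h hm'.valid⟩

/-- The expression `e` can be evaluated, with the value `v`. -/
structure Ev (w U : ℕ) (σ : State) (e : Ex) (v : ℕ) : Prop where
  ok : e.Ok w U σ
  eval : e.eval w σ = v
  lt : v < 2 ^ w

namespace Ev

variable {a b : Ex} {x y v : ℕ}

theorem var (hV : Valid w σ) (hx : x < tmp) (h : σ.reg x = v) : Ev w U σ (.var x) v :=
  ⟨hx, h, h ▸ hV.reg x hx⟩

theorem lit (h : x < 2 ^ w) : Ev w U σ (.lit x) x :=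
  ⟨trivial, Nat.mod_eq_of_lt h, h⟩

theorem add (ha : Ev w U σ a x) (hb : Ev w U σ b y) (h : x + y < 2 ^ w) :
    Ev w U σ (a + b) (x + y) :=
  ⟨⟨ha.ok, hb.ok⟩, by
    change (a.eval w σ + b.eval w σ) % 2 ^ w = _
    rw [ha.eval, hb.eval, Nat.mod_eq_of_lt h], h⟩

theorem addMod (ha : Ev w U σ a x) (hb : Ev w U σ b y) :
    Ev w U σ (a + b) ((x + y) % 2 ^ w) :=
  ⟨⟨ha.ok, hb.ok⟩, by
    change (a.eval w σ + b.eval w σ) % 2 ^ w = _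
    rw [ha.eval, hb.eval], Nat.mod_lt _ (by positivity)⟩

theorem sub (ha : Ev w U σ a x) (hb : Ev w U σ b y) (h : y ≤ x) :
    Ev w U σ (a - b) (x - y) :=
  ⟨⟨ha.ok, hb.ok⟩, by
    change (a.eval w σ + 2 ^ w - b.eval w σ) % 2 ^ w = _
    rw [ha.eval, hb.eval, Nat.sub_add_comm h, Nat.add_mod_right,
      Nat.mod_eq_of_lt ((Nat.sub_le _ _).trans_lt ha.lt)],
    (Nat.sub_le _ _).trans_lt ha.lt⟩

theorem subMod (ha : Ev w U σ a x) (hb : Ev w U σ b y) :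
    Ev w U σ (a - b) ((x + 2 ^ w - y) % 2 ^ w) :=
  ⟨⟨ha.ok, hb.ok⟩, by
    change (a.eval w σ + 2 ^ w - b.eval w σ) % 2 ^ w = _
    rw [ha.eval, hb.eval], Nat.mod_lt _ (by positivity)⟩

theorem mul (ha : Ev w U σ a x) (hb : Ev w U σ b y) (h : x * y < 2 ^ w) :
    Ev w U σ (a * b) (x * y) :=
  ⟨⟨ha.ok, hb.ok⟩, by
    change (a.eval w σ * b.eval w σ) % 2 ^ w = _
    rw [ha.eval, hb.eval, Nat.mod_eq_of_lt h], h⟩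

theorem mulMod (ha : Ev w U σ a x) (hb : Ev w U σ b y) :
    Ev w U σ (a * b) (x * y % 2 ^ w) :=
  ⟨⟨ha.ok, hb.ok⟩, by
    change (a.eval w σ * b.eval w σ) % 2 ^ w = _
    rw [ha.eval, hb.eval], Nat.mod_lt _ (by positivity)⟩

theorem div (ha : Ev w U σ a x) (hb : Ev w U σ b y) : Ev w U σ (a / b) (x / y) :=
  have h : x / y < 2 ^ w := (Nat.div_le_self _ _).trans_lt ha.lt
  ⟨⟨ha.ok, hb.ok⟩, by
    change (a.eval w σ / b.eval w σ) % 2 ^ w = _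
    rw [ha.eval, hb.eval, Nat.mod_eq_of_lt h], h⟩

theorem mod (ha : Ev w U σ a x) (hb : Ev w U σ b y) : Ev w U σ (a % b) (x % y) :=
  have h : x % y < 2 ^ w := (Nat.mod_le _ _).trans_lt ha.lt
  ⟨⟨ha.ok, hb.ok⟩, by
    change (a.eval w σ % b.eval w σ) % 2 ^ w = _
    rw [ha.eval, hb.eval, Nat.mod_eq_of_lt h], h⟩

theorem shr (ha : Ev w U σ a x) (hb : Ev w U σ b y) : Ev w U σ (.bin .shr a b) (x >>> y) :=
  have h : x >>> y < 2 ^ w := (Nat.shiftRight_le _ _).trans_lt ha.lt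
  ⟨⟨ha.ok, hb.ok⟩, by
    change (a.eval w σ >>> b.eval w σ) % 2 ^ w = _
    rw [ha.eval, hb.eval, Nat.mod_eq_of_lt h], h⟩

theorem ltOp (hw : 1 < 2 ^ w) (ha : Ev w U σ a x) (hb : Ev w U σ b y) :
    Ev w U σ (.bin .lt a b) (if x < y then 1 else 0) :=
  have h : (if x < y then 1 else 0) < 2 ^ w := by split_ifs <;> omega
  ⟨⟨ha.ok, hb.ok⟩, by
    change (if a.eval w σ < b.eval w σ then 1 else 0) % 2 ^ w = _
    rw [ha.eval, hb.eval, Nat.mod_eq_of_lt h], h⟩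

theorem eqOp (hw : 1 < 2 ^ w) (ha : Ev w U σ a x) (hb : Ev w U σ b y) :
    Ev w U σ (.bin .eq a b) (if x = y then 1 else 0) :=
  have h : (if x = y then 1 else 0) < 2 ^ w := by split_ifs <;> omega
  ⟨⟨ha.ok, hb.ok⟩, by
    change (if a.eval w σ = b.eval w σ then 1 else 0) % 2 ^ w = _
    rw [ha.eval, hb.eval, Nat.mod_eq_of_lt h], h⟩

theorem ld (hV : Valid w σ) (ha : Ev w U σ a x) (hU : x < U) (h : σ.mem x = v) :
    Ev w U σ (.ld a) v :=
  ⟨⟨ha.ok, ha.eval ▸ hU⟩, by rw [← h, ← ha.eval]; rfl, h ▸ hV.mem x⟩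

end Ev

theorem Hoare.assign {x v : ℕ} {e : Ex} (he : Ev w U σ e v)
    (h : Valid w (σ.setReg x v) → Q (σ.setReg x v)) : Hoare w U ω (.set x e) ⊤ σ Q :=
  (Hoare.set he.ok he.eval h).mono le_top fun _ _ h => h

theorem Hoare.put {i v : ℕ} {a e : Ex} (ha : a.Ok w U σ) (hi : a.eval w σ = i) (hU : i < U)
    (hok : e.Ok w U σ) (hv : e.eval w σ = v)
    (h : Valid w (σ.setMem i v) → Q (σ.setMem i v)) :
    Hoare w U ω (.put a e) (Cmd.put a e).len σ Q := by
  refine Hoare.of_loopFree ?_ (Cmd.put_loopFree a e)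
  intro s hs
  obtain ⟨t, s', he, hm, hr, -⟩ := a.comp_spec (ω := ω) tmp s hs ha le_rfl
  obtain ⟨t', s'', he', hm', hr', hk'⟩ := e.comp_spec (ω := ω) (tmp + 1) s' hm hok (by omega)
  have e₁ : s''.reg tmp = i := by rw [hk' _ (by omega), hr, hi]
  have e₂ : s''.reg (tmp + 1) = v := by rw [hr', hv]
  have hm₂ : Matches w U ((s''.touch (s''.reg tmp)).setMem (s''.reg tmp) (s''.reg (tmp + 1)))
      (σ.setMem i v) := by
    rw [e₁, e₂]; exact (hm'.touch hU).setMem (e₂ ▸ hm'.regLt _)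
  exact ⟨_, _, _, le_top, .seq he (.seq he' (.store _ _ _)), hm₂, h hm₂.valid⟩

theorem Hoare.write {i v : ℕ} {a e : Ex} (ha : Ev w U σ a i) (hU : i < U) (he : Ev w U σ e v)
    (h : Valid w (σ.setMem i v) → Q (σ.setMem i v)) : Hoare w U ω (.put a e) ⊤ σ Q :=
  (Hoare.put ha.ok ha.eval hU he.ok he.eval h).mono le_top fun _ _ h => h

theorem Hoare.print {u v : ℕ} {a e : Ex} (ha : a.Ok w U σ) (hi : a.eval w σ = u)
    (hok : e.Ok w U σ) (hv : e.eval w σ = v)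
    (h : Valid w σ → Q { σ with out := σ.out ++ [(u, v)] }) :
    Hoare w U ω (.print a e) ⊤ σ Q := by
  intro s hs
  obtain ⟨t, s', he, hm, hr, -⟩ := a.comp_spec (ω := ω) tmp s hs ha le_rfl
  obtain ⟨t', s'', he', hm', hr', hk'⟩ := e.comp_spec (ω := ω) (tmp + 1) s' hm hok (by omega)
  have e₁ : s''.reg tmp = u := by rw [hk' _ (by omega), hr, hi]
  have e₂ : s''.reg (tmp + 1) = v := by rw [hr', hv]
  refine ⟨_, _, _, le_top, .seq he (.seq he' (.emit _ _ _)), ?_, h hs.valid⟩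
  exact ⟨hm'.reg, hm'.mem, hm'.drawn, by simp only [e₁, e₂, hm'.out], hm'.used, hm'.regLt,
    hm'.memLt⟩

theorem Hoare.rand {x : ℕ}
    (h : Q { σ.setReg x (ω σ.drawn : ℕ) with drawn := σ.drawn + 1 }) :
    Hoare w U ω (.rand x) ⊤ σ Q := by
  intro s hs
  refine ⟨_, _, _, le_top, .rand _ _, ?_, h⟩
  have := hs.setReg (x := x) (ω σ.drawn).isLt
  rw [hs.drawn]
  exact ⟨this.reg, this.mem, by rw [← hs.drawn], this.out, this.used, this.regLt, this.memLt⟩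

theorem Hoare.skip (h : Q σ) : Hoare w U ω .skip ⊤ σ Q :=
  fun s hs => ⟨_, s, σ, le_top, .skip s, hs, h⟩

theorem Hoare.block_nil (h : Q σ) : Hoare w U ω (.block []) ⊤ σ Q := Hoare.skip h

theorem Hoare.block_cons {l : List Cmd}
    (h : Hoare w U ω c ⊤ σ fun σ' => Hoare w U ω (.block l) ⊤ σ' Q) :
    Hoare w U ω (.block (c :: l)) ⊤ σ Q := Hoare.seq_top h

theorem Hoare.cond {e : Ex} (hok : e.Ok w U σ) (h₁ : e.eval w σ ≠ 0 → Hoare w U ω c ⊤ σ Q)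
    (h₂ : e.eval w σ = 0 → Hoare w U ω d ⊤ σ Q) : Hoare w U ω (.cond e c d) ⊤ σ Q := by
  intro s hs
  obtain ⟨t, s', he, hm, hr, -⟩ := e.comp_spec (ω := ω) tmp s hs hok le_rfl
  by_cases hz : e.eval w σ = 0
  · obtain ⟨t', s'', σ', -, he', hm', hq⟩ := h₂ hz s' hm
    exact ⟨_, _, _, le_top, .seq he (.ite_false (hr.trans hz) he'), hm', hq⟩
  · obtain ⟨t', s'', σ', -, he', hm', hq⟩ := h₁ hz s' hm
    exact ⟨_, _, _, le_top, .seq he (.ite_true (hr ▸ hz) he'), hm', hq⟩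

/-- Partial form of the rule for loops: the time of `m` rounds is counted. -/
theorem Hoare.loop {e : Ex} {I : ℕ → State → Prop} {T : ℕ∞}
    (hok : ∀ m σ, I m σ → e.Ok w U σ)
    (h0 : ∀ σ, I 0 σ → e.eval w σ = 0)
    (hstep : ∀ m σ, I (m + 1) σ → e.eval w σ ≠ 0 →
      Hoare w U ω c T σ fun σ' => ∃ m' ≤ m, I m' σ') :
    ∀ (m : ℕ) (σ s : State), I m σ → Matches w U s σ → s.reg tmp = e.eval w σ →
      ∃ (t : ℕ) (s' σ' : State), (t : ℕ∞) ≤ 1 + m * (1 + T + (e.comp tmp).len) ∧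
        Exec w ω (.loop tmp (.seq c (e.comp tmp))) s t s' ∧ Matches w U s' σ' ∧
        (∃ m', I m' σ') ∧ e.eval w σ' = 0 := by
  intro m
  induction m using Nat.strong_induction_on with
  | _ m ih =>
  intro σ s hI hs hr
  by_cases hz : e.eval w σ = 0
  · exact ⟨1, s, σ, by push_cast; exact le_self_add, .loop_false (hr.trans hz), hs, ⟨m, hI⟩, hz⟩
  · obtain _ | m := m
    · exact absurd (h0 σ hI) hz
    obtain ⟨t, s', σ', ht, he, hm, m', hm'le, hI'⟩ := hstep m σ hI hz s hs
    obtain ⟨t', s'', he', hm', hr', -⟩ := e.comp_spec (ω := ω) tmp s' hm (hok _ _ hI') le_rfl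
    obtain ⟨t₂, s₃, σ₃, ht₂, he₂, hm₂, hQ⟩ := ih m' (by omega) σ' s'' hI' hm' hr'
    refine ⟨_, _, _, ?_, .loop_true (hr ▸ hz) (.seq he he') he₂, hm₂, hQ⟩
    have hl : (t' : ℕ∞) ≤ (e.comp tmp).len := by exact_mod_cast he'.le_len (e.comp_loopFree _)
    have : (m' : ℕ∞) ≤ m := by exact_mod_cast hm'le
    push_cast
    calc (1 + (t + t') + t₂ : ℕ∞)
        ≤ 1 + (T + (e.comp tmp).len) + (1 + m * (1 + T + (e.comp tmp).len)) := by
          gcongr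
          exact ht₂.trans (by gcongr)
      _ = 1 + (m + 1) * (1 + T + (e.comp tmp).len) := by ring

/-- The index of the invariant is a variant: every round lowers it, possibly by more than one, and
at 0 the condition must fail. -/
theorem Hoare.whil {e : Ex} {I : ℕ → State → Prop} {m : ℕ}
    (hok : ∀ m σ, I m σ → e.Ok w U σ)
    (h0 : ∀ σ, I 0 σ → e.eval w σ = 0)
    (hstep : ∀ m σ, I (m + 1) σ → e.eval w σ ≠ 0 →
      Hoare w U ω c T σ fun σ' => ∃ m' ≤ m, I m' σ')
    (hI : I m σ) (hQ : ∀ m σ, Valid w σ → I m σ → e.eval w σ = 0 → Q σ) :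
    Hoare w U ω (.whil e c) ((e.comp tmp).len + (1 + m * (1 + T + (e.comp tmp).len))) σ Q := by
  intro s hs
  obtain ⟨t, s', he, hm, hr, -⟩ := e.comp_spec (ω := ω) tmp s hs (hok _ _ hI) le_rfl
  obtain ⟨t₂, s₂, σ₂, ht₂, he₂, hm₂, ⟨m', hI'⟩, hz⟩ := Hoare.loop hok h0 hstep m σ s' hI hm hr
  refine ⟨_, _, _, ?_, .seq he he₂, hm₂, hQ m' σ₂ hm₂.valid hI' hz⟩
  have hl : (t : ℕ∞) ≤ (e.comp tmp).len := by exact_mod_cast he.le_len (e.comp_loopFree _)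
  push_cast
  exact add_le_add hl ht₂

/-- The body only has to establish the next invariant for the state in which the counter has been
advanced. The two constants 20 are slack for an overhead of 6 steps outside the rounds and 8 steps
per round. -/
theorem Hoare.forTo {i b N : ℕ} {I : ℕ → State → Prop} (hi : i < tmp) (hb : b < tmp)
    (hI : ∀ j σ, I j σ → σ.reg i = j ∧ σ.reg b = N)
    (h0 : Valid w (σ.setReg i 0) → I 0 (σ.setReg i 0))
    (hstep : ∀ j < N, ∀ σ, Valid w σ → I j σ →
      Hoare w U ω c T σ fun σ' =>
        σ'.reg i = j ∧ (Valid w (σ'.setReg i (j + 1)) → I (j + 1) (σ'.setReg i (j + 1))))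
    (hQ : ∀ σ, Valid w σ → I N σ → Q σ) :
    Hoare w U ω (.forTo i b c) (20 + N * (20 + T)) σ Q := by
  have hw : 1 ≤ 2 ^ w := Nat.one_le_two_pow
  have key : Hoare w U ω (.forTo i b c) (((Cmd.set i (.lit 0)).len : ℕ∞) + (3 + (1 + N *
      (1 + (T + (Cmd.set i (.var i + .lit 1)).len) + 3)))) σ Q := by
    refine Hoare.seq ?_
    refine Hoare.set trivial (v := 0) (by simp [Ex.eval]) fun hv => ?_
    refine Hoare.whil (e := .bin .lt (.var i) (.var b))
      (I := fun m σ' => ∃ j ≤ N, m = N - j ∧ I j σ' ∧ Valid w σ') (m := N) ?_ ?_ ?_ ?_ ?_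
    · rintro m σ' ⟨j, -, -, -⟩
      exact ⟨hi, hb⟩
    · rintro σ' ⟨j, hj, hm, h, -⟩
      obtain rfl : j = N := by omega
      simp [Ex.eval, Op.eval, (hI _ _ h).1, (hI _ _ h).2]
    · rintro m σ' ⟨j, hj, hm, h, hval⟩ -
      refine Hoare.seq ?_
      refine (hstep j (by omega) σ' hval h).mono le_rfl ?_
      rintro σ₁ - ⟨h₁, h₂⟩
      -- The bound `N` is the content of a register, hence a word, so the counter cannot wrap
      -- around.
      have hlt : j + 1 < 2 ^ w := by
        have := hval.reg b hb
        rw [(hI _ _ h).2] at this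
        omega
      refine Hoare.set ⟨hi, trivial⟩ (v := j + 1) ?_ ?_
      · change (σ₁.reg i + 1 % 2 ^ w) % 2 ^ w = j + 1
        rw [h₁, Nat.add_mod_mod, Nat.mod_eq_of_lt hlt]
      · exact fun hv => ⟨m, le_rfl, j + 1, by omega, by omega, h₂ hv, hv⟩
    · exact ⟨0, by omega, by omega, h0 hv, hv⟩
    · rintro m σ' hv ⟨j, hj, hm, h, -⟩ hz
      have : ¬ j < N := by
        intro hlt
        have h2 : 1 < 2 ^ w := by
          have := hv.reg b hb
          rw [(hI _ _ h).2] at this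
          omega
        simp [Ex.eval, Op.eval, (hI _ _ h).1, (hI _ _ h).2, hlt, Nat.mod_eq_of_lt h2] at hz
      obtain rfl : j = N := by omega
      exact hQ _ hv h
  refine key.mono ?_ fun _ _ h => h
  have e1 : (Cmd.set i (.lit 0)).len = 2 := rfl
  have e2 : (Cmd.set i (.var i + .lit 1)).len = 4 := rfl
  rw [e1, e2]
  have : (1 + (T + (4 : ℕ)) + 3 : ℕ∞) ≤ 20 + T := by
    calc (1 + (T + (4 : ℕ)) + 3 : ℕ∞) = 8 + T := by push_cast; ring
      _ ≤ 20 + T := by gcongr; norm_num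
  calc ((2 : ℕ) : ℕ∞) + (3 + (1 + N * (1 + (T + (4 : ℕ)) + 3))) ≤ 2 + (3 + (1 + N * (20 + T))) := by
        exact add_le_add le_rfl (add_le_add le_rfl (add_le_add le_rfl (mul_le_mul' le_rfl this)))
    _ = 6 + N * (20 + T) := by ring
    _ ≤ _ := by gcongr; norm_num

end Hoare

end WordRAM

open WordRAM

namespace MatchingSketch

/-! ### Parameters -/

/-- The number of bits of `n`. -/
def lg (n : ℕ) : ℕ := Nat.log 2 n + 1
/-- The word length. -/
def wd (n : ℕ) : ℕ := 128 * lg n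
/-- The number of repetitions of each hash function. -/
def dd (n : ℕ) : ℕ := 1024 * lg n
/-- The number of samplers. -/
def jj (n : ℕ) : ℕ := dd n * dd n * dd n * dd n * dd n
/-- The largest word. -/
def wmax (n : ℕ) : ℕ := 2 ^ wd n - 1
/-- The size of the tables. -/
def gRange (k : ℕ) : ℕ := 160 * k * k
/-- The width of the intervals of the hash function into the tables. -/
def gWidth (n k : ℕ) : ℕ := wmax n / (80 * k * k)
/-- The number of blocks. -/
def blocks (k : ℕ) : ℕ := 8 * k
/-- The range of the hash functions inside the blocks. -/
def subRange (n : ℕ) : ℕ := 20 * dd n * dd n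
/-- The width of the intervals of the hash functions inside the blocks. -/
def subWidth (n : ℕ) : ℕ := wmax n / (10 * dd n * dd n)
/-- The number of classes of vertices. -/
def cells (n k : ℕ) : ℕ := blocks k * subRange n
/-- The number of stored random words. -/
def words (n k : ℕ) : ℕ := 4 * dd n + dd n * gRange k
/-- The number of classes of edges. -/
def total (n k : ℕ) : ℕ := jj n * 2 * cells n k * cells n k
/-- The number of memory cells. -/
def space (n k : ℕ) : ℕ := words n k + 2 * total n k + k

/-! ### Size estimates: the parameters fit into a word -/

section Bounds

variable {n k : ℕ}

theorem lt_two_pow_lg (n : ℕ) : n < 2 ^ lg n := Nat.lt_pow_succ_log_self (by norm_num) n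

theorem two_pow_wd (n : ℕ) : 2 ^ wd n = (2 ^ lg n) ^ 128 := by
  rw [← pow_mul, wd, mul_comm]

theorem four_le_two_pow_lg (hn : 2 ≤ n) : 4 ≤ 2 ^ lg n := by
  have : 1 ≤ Nat.log 2 n := Nat.log_pos (by norm_num) hn
  calc 4 = 2 ^ 2 := by norm_num
    _ ≤ 2 ^ lg n := Nat.pow_le_pow_right (by norm_num) (by unfold lg; omega)

theorem dd_pos (n : ℕ) : 0 < dd n := by unfold dd lg; omega

/-- With L = 2 ^ `lg n` ≥ 4 the constant 1024 = 4 ^ 5 is absorbed by L ^ 5, and `lg n` by one more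
factor L. -/
theorem dd_le (hn : 2 ≤ n) : dd n ≤ (2 ^ lg n) ^ 6 := by
  have h4 := four_le_two_pow_lg hn
  have h : lg n ≤ 2 ^ lg n := Nat.lt_two_pow_self.le
  calc dd n = 4 ^ 5 * lg n := rfl
    _ ≤ 4 ^ 5 * 2 ^ lg n := by gcongr
    _ ≤ (2 ^ lg n) ^ 5 * 2 ^ lg n := by gcongr
    _ = _ := by ring

/-- All quantities are compared as powers of L = 2 ^ `lg n` ≥ 4, constants included, while a word
ranges over L ^ 128 values. The spare factor 16 is needed in `ten_dd_le`. -/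
theorem space_mul_le (hk : 1 ≤ k) (hn : 2 * k ≤ n) : space n k * 16 ≤ 2 ^ wd n := by
  have h4 := four_le_two_pow_lg (show 2 ≤ n by omega)
  have hD := dd_le (show 2 ≤ n by omega)
  have hkL : k ≤ 2 ^ lg n := by have := lt_two_pow_lg n; omega
  rw [two_pow_wd]
  unfold space words total cells blocks subRange gRange jj
  generalize dd n = D at *
  generalize 2 ^ lg n = L at *
  have hL : 1 ≤ L := by omega
  have e1 : 4 * D + D * (160 * k * k) ≤ L ^ 13 := by
    calc 4 * D + D * (160 * k * k) ≤ L * L ^ 6 + L ^ 6 * (4 ^ 4 * L * L) := by gcongr; norm_num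
      _ ≤ L ^ 12 + L ^ 6 * (L ^ 4 * L * L) := by
        gcongr ?_ + _ * (?_ * _ * _)
        · rw [← pow_succ']; exact Nat.pow_le_pow_right hL (by norm_num)
        · gcongr
      _ = 2 * L ^ 12 := by ring
      _ ≤ L * L ^ 12 := by gcongr; omega
      _ = L ^ 13 := by ring
  have e2 : 8 * k * (20 * D * D) ≤ L ^ 18 := by
    calc 8 * k * (20 * D * D) ≤ 4 ^ 2 * L * (4 ^ 3 * L ^ 6 * L ^ 6) := by gcongr <;> norm_num
      _ ≤ L ^ 2 * L * (L ^ 3 * L ^ 6 * L ^ 6) := by gcongr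
      _ = _ := by ring
  have e3 : 2 * (D * D * D * D * D * 2 * (8 * k * (20 * D * D)) * (8 * k * (20 * D * D)))
      ≤ L ^ 67 := by
    calc 2 * (D * D * D * D * D * 2 * (8 * k * (20 * D * D)) * (8 * k * (20 * D * D)))
        ≤ 2 * (L ^ 6 * L ^ 6 * L ^ 6 * L ^ 6 * L ^ 6 * 2 * L ^ 18 * L ^ 18) := by gcongr
      _ = 4 * L ^ 66 := by ring
      _ ≤ L * L ^ 66 := by gcongr
      _ = _ := by ring
  calc _ ≤ (L ^ 13 + L ^ 67 + L) * 16 := by gcongr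
    _ ≤ (L ^ 67 + L ^ 67 + L ^ 67) * 16 := by
      gcongr
      · norm_num
      · exact Nat.le_self_pow (by norm_num) L
    _ = 48 * L ^ 67 := by ring
    _ ≤ 4 ^ 6 * L ^ 67 := by gcongr; norm_num
    _ ≤ L ^ 6 * L ^ 67 := by gcongr
    _ = L ^ 73 := by ring
    _ ≤ L ^ 128 := Nat.pow_le_pow_right hL (by norm_num)

theorem cells_pos (hk : 1 ≤ k) : 0 < cells n k := by
  have := dd_pos n
  unfold cells blocks subRange; positivity

theorem jj_pos (n : ℕ) : 0 < jj n := by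
  have := dd_pos n
  unfold jj; positivity

theorem space_lt (hk : 1 ≤ k) (hn : 2 * k ≤ n) : space n k < 2 ^ wd n := by
  have := space_mul_le hk hn
  have h : 0 < 2 ^ wd n := by positivity
  omega

/-- One polynomial bound that serves several purposes: edge numbers are words, the interval widths
are at least `n`, and the sampling thresholds are at least `n * n`. -/
theorem sq_mul_le (hk : 1 ≤ k) (hn : 2 * k ≤ n) :
    (n * n + n + 2) * (4096 * (n * n)) ≤ 2 ^ wd n := by
  have h4 := four_le_two_pow_lg (show 2 ≤ n by omega)
  have hL := (lt_two_pow_lg n).le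
  rw [two_pow_wd]
  generalize 2 ^ lg n = L at *
  have h1 : n * n + n + 2 ≤ L ^ 3 := by nlinarith [Nat.mul_le_mul hL hL]
  calc (n * n + n + 2) * (4096 * (n * n)) ≤ L ^ 3 * (4 ^ 6 * (L * L)) := by gcongr; norm_num
    _ ≤ L ^ 3 * (L ^ 6 * (L * L)) := by gcongr
    _ = L ^ 11 := by ring
    _ ≤ L ^ 128 := Nat.pow_le_pow_right (by omega) (by norm_num)

theorem one_lt_two_pow_wd (n : ℕ) : 2 ^ 64 ≤ 2 ^ wd n :=
  Nat.pow_le_pow_right (by norm_num) (by unfold wd lg; omega)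

end Bounds

attribute [irreducible] lg wd dd jj

/-! ### The classes of edges -/

/-- The block of the vertex `x`. -/
def blk (n k : ℕ) (r : ℕ → ℕ) (q x : ℕ) : ℕ :=
  r (4 * dd n + q * gRange k + r (3 * dd n + q) * x % 2 ^ wd n / gWidth n k) % blocks k

/-- The position of the vertex `x` inside its block. -/
def sub (n : ℕ) (r : ℕ → ℕ) (a x : ℕ) : ℕ := r (2 * dd n + a) * x % 2 ^ wd n / subWidth n

/-- The class of the vertex `x`. -/
def cell (n k : ℕ) (r : ℕ → ℕ) (q a x : ℕ) : ℕ := blk n k r q x * subRange n + sub n r a x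

/-- The indicator that the edge number `e` is sampled. -/
def smp (n : ℕ) (r : ℕ → ℕ) (c l e : ℕ) : ℕ :=
  if (r c * e + r (dd n + c)) % 2 ^ wd n < wmax n >>> l then 1 else 0

/-- The class of the edge `uv` in the sampler `j`. -/
def addr (n k : ℕ) (r : ℕ → ℕ) (j u v : ℕ) : ℕ :=
  ((j * 2 + smp n r (j / dd n / dd n / dd n % dd n) (j / dd n / dd n / dd n / dd n) (u * n + v)) *
    cells n k + cell n k r (j % dd n) (j / dd n % dd n) u) * cells n k +
      cell n k r (j % dd n) (j / dd n / dd n % dd n) v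

/-! ### Ranges of the hash values and of the addresses -/

section Classes

variable {n k : ℕ} (r : ℕ → ℕ)

/-- Rounding the width m / N down loses less than a factor 2, since it is at least 1. This is why
`gRange` and `subRange` are twice the divisors in `gWidth` and `subWidth`. -/
theorem div_width_lt {m N x : ℕ} (hN : 0 < N) (hNm : N ≤ m) (hx : x ≤ m) :
    x / (m / N) < 2 * N := by
  have h1 : 1 ≤ m / N := (Nat.one_le_div_iff hN).2 hNm
  rw [Nat.div_lt_iff_lt_mul h1]
  have h2 : m < N * (m / N + 1) := by
    have := Nat.div_add_mod m N
    have := Nat.mod_lt m hN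
    rw [mul_add]; omega
  nlinarith

theorem gIndex_lt (hk : 1 ≤ k) (hn : 2 * k ≤ n) (z : ℕ) :
    z % 2 ^ wd n / gWidth n k < gRange k := by
  have h := sq_mul_le hk hn
  have h0 : 0 < 2 ^ wd n := by positivity
  have := Nat.mod_lt z h0
  have h2 : gRange k = 2 * (80 * k * k) := by unfold gRange; ring
  rw [h2, gWidth, wmax]
  generalize 2 ^ wd n = M at *
  have h3 : 80 * k * k ≤ 80 * n * n := by gcongr <;> omega
  have h4 : 80 * n * n + 1 ≤ (n * n + n + 2) * (4096 * (n * n)) := by nlinarith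
  exact div_width_lt (by positivity) (by omega) (by omega)

theorem ten_dd_le (hk : 1 ≤ k) (hn : 2 * k ≤ n) : 160 * (10 * dd n * dd n) ≤ wmax n := by
  have h := space_mul_le hk hn
  have h1 : subRange n ≤ cells n k := Nat.le_mul_of_pos_left _ (by unfold blocks; omega)
  have h2 : cells n k ≤ cells n k * cells n k := Nat.le_mul_of_pos_left _ (cells_pos hk)
  have h3 : cells n k * cells n k ≤ total n k := by
    have := jj_pos n
    unfold total
    generalize jj n = J at *
    generalize cells n k = C at *
    nlinarith [Nat.zero_le (C * C)]
  have h4 : 8 * subRange n ≤ cells n k := by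
    unfold cells blocks
    exact Nat.mul_le_mul_right _ (by omega)
  have : subRange n = 2 * (10 * dd n * dd n) := by unfold subRange; ring
  have : 0 < words n k := by have := dd_pos n; unfold words; positivity
  unfold space at h
  unfold wmax
  omega

theorem sub_lt (hk : 1 ≤ k) (hn : 2 * k ≤ n) (a x : ℕ) : sub n r a x < subRange n := by
  have h0 : 0 < 2 ^ wd n := by positivity
  have := Nat.mod_lt (r (2 * dd n + a) * x) h0
  have h2 : subRange n = 2 * (10 * dd n * dd n) := by unfold subRange; ring
  have := dd_pos n
  have := ten_dd_le hk hn
  rw [h2, sub, subWidth]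
  refine div_width_lt (N := 10 * dd n * dd n) (m := wmax n) (by positivity) (by omega) ?_
  unfold wmax
  omega

theorem mul_add_lt {a b A B : ℕ} (ha : a < A) (hb : b < B) : a * B + b < A * B := by
  calc a * B + b < a * B + B := by omega
    _ = (a + 1) * B := by ring
    _ ≤ A * B := Nat.mul_le_mul_right _ ha

theorem blk_lt (hk : 1 ≤ k) (q x : ℕ) : blk n k r q x < blocks k :=
  Nat.mod_lt _ (by unfold blocks; omega)

theorem cell_lt (hk : 1 ≤ k) (hn : 2 * k ≤ n) (q a x : ℕ) : cell n k r q a x < cells n k :=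
  mul_add_lt (blk_lt r hk q x) (sub_lt r hk hn a x)

theorem smp_lt (c l e : ℕ) : smp n r c l e < 2 := by unfold smp; split_ifs <;> omega

theorem addr_lt (hk : 1 ≤ k) (hn : 2 * k ≤ n) {j : ℕ} (hj : j < jj n) (u v : ℕ) :
    addr n k r j u v < total n k :=
  mul_add_lt (mul_add_lt (mul_add_lt hj (smp_lt r _ _ _)) (cell_lt r hk hn _ _ _))
    (cell_lt r hk hn _ _ _)

end Classes

/-! ### The programs -/

/-- A variable. -/
abbrev V (x : ℕ) : Ex := .var x
/-- A literal. -/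
abbrev C (c : ℕ) : Ex := .lit c

/-- The block of the vertex in register `x`. -/
def blkEx (x : ℕ) : Ex := .ld (C 4 * V 5 + V 21 * V 9 + (.ld (C 3 * V 5 + V 21) * V x) / V 8) % V 10
/-- The position inside its block of the vertex in register `x`. -/
def subEx (a x : ℕ) : Ex := (.ld (C 2 * V 5 + V a) * V x) / V 11

/-- Process the current edge in the sampler in register 17. -/
def updateBody : Cmd := .block [
  .set 21 (V 17 % V 5),
  .set 22 (V 17 / V 5),
  .set 23 (V 22 % V 5),
  .set 22 (V 22 / V 5),
  .set 24 (V 22 % V 5),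
  .set 22 (V 22 / V 5),
  .set 25 (V 22 % V 5),
  .set 26 (V 22 / V 5),
  .set 27 (blkEx 0),
  .set 28 (blkEx 1),
  .set 27 (V 27 * V 12 + subEx 23 0),
  .set 28 (V 28 * V 12 + subEx 24 1),
  .set 29 (.bin .lt (.ld (V 25) * V 19 + .ld (V 5 + V 25)) (.bin .shr (V 7) (V 26))),
  .set 30 (V 14 + C 2 * (((V 17 * C 2 + V 29) * V 13 + V 27) * V 13 + V 28)),
  .put (V 30) (.ld (V 30) + V 20),
  .put (V 30 + C 1) (.ld (V 30 + C 1) + V 20 * V 19)]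

/-- The program that is run after each element of the stream. -/
def updateCmd : Cmd := .block [
  .set 19 (V 0 * V 3 + V 1),
  .set 20 (V 2 * C 2 - C 1),
  .forTo 17 6 updateBody]

/-- Draw the random words. -/
def drawBody : Cmd := .block [.rand 18, .put (V 17) (V 18)]

/-- The program that is run before the stream. -/
def preprocessCmd : Cmd := .block [
  .set 3 (V 0),
  .set 4 (V 1),
  .set 17 (C 0),
  .whil (V 0) (.block [.set 0 (V 0 / C 2), .set 17 (V 17 + C 1)]),
  .set 5 (C 1024 * V 17),
  .set 6 (V 5 * V 5 * V 5 * V 5 * V 5),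
  .set 7 (C 0 - C 1),
  .set 8 (V 7 / (C 80 * V 4 * V 4)),
  .set 9 (C 160 * V 4 * V 4),
  .set 10 (C 8 * V 4),
  .set 11 (V 7 / (C 10 * V 5 * V 5)),
  .set 12 (C 20 * V 5 * V 5),
  .set 13 (V 10 * V 12),
  .set 14 (C 4 * V 5 + V 5 * V 9),
  .set 16 (V 6 * C 2 * V 13 * V 13),
  .set 15 (V 14 + C 2 * V 16),
  .forTo 17 14 drawBody]

/-! ### Correctness of the updates -/

/-- The registers that hold the parameters. -/
structure Params (n k : ℕ) (s : State) : Prop where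
  r3 : s.reg 3 = n
  r4 : s.reg 4 = k
  r5 : s.reg 5 = dd n
  r6 : s.reg 6 = jj n
  r7 : s.reg 7 = wmax n
  r8 : s.reg 8 = gWidth n k
  r9 : s.reg 9 = gRange k
  r10 : s.reg 10 = blocks k
  r11 : s.reg 11 = subWidth n
  r12 : s.reg 12 = subRange n
  r13 : s.reg 13 = cells n k
  r14 : s.reg 14 = words n k
  r15 : s.reg 15 = words n k + 2 * total n k
  r16 : s.reg 16 = total n k

theorem Params.congr {n k : ℕ} {s s' : State} (h : Params n k s)
    (hs : ∀ x, 3 ≤ x → x ≤ 16 → s'.reg x = s.reg x) : Params n k s' := by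
  constructor <;> rw [hs _ (by norm_num) (by norm_num)]
  exacts [h.r3, h.r4, h.r5, h.r6, h.r7, h.r8, h.r9, h.r10, h.r11, h.r12, h.r13, h.r14, h.r15, h.r16]

theorem Params.setReg {n k : ℕ} {s : State} (h : Params n k s) {x a : ℕ} (hx : x < 3 ∨ 16 < x) :
    Params n k (s.setReg x a) :=
  h.congr fun y h3 h16 => by rw [State.setReg_reg, if_neg (by omega)]

/-- The intermediate results of the Horner evaluation of an address are at most the address itself,
so none of them overflows. -/
theorem le_address {j b C cu cv : ℕ} (hC : 0 < C) :
    j * 2 ≤ ((j * 2 + b) * C + cu) * C + cv ∧ j * 2 + b ≤ ((j * 2 + b) * C + cu) * C + cv ∧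
      (j * 2 + b) * C ≤ ((j * 2 + b) * C + cu) * C + cv ∧
      (j * 2 + b) * C + cu ≤ ((j * 2 + b) * C + cu) * C + cv ∧
      ((j * 2 + b) * C + cu) * C ≤ ((j * 2 + b) * C + cu) * C + cv := by
  have h1 := Nat.le_mul_of_pos_right (j * 2 + b) hC
  have h2 := Nat.le_mul_of_pos_right ((j * 2 + b) * C + cu) hC
  omega

/-- Word arithmetic modulo 2 ^ w becomes ordinary ring arithmetic in any ring where 2 ^ w vanishes.
-/
theorem natCast_mod_of_eq_zero {R : Type*} [CommRing R] {m : ℕ} (hm : (m : R) = 0) (a : ℕ) :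
    ((a % m : ℕ) : R) = a := by
  conv_rhs => rw [← Nat.mod_add_div a m]
  rw [Nat.cast_add, Nat.cast_mul, hm, zero_mul, add_zero]

/-- The memory holds the random words `r` and a sketch with the counters `f` and the sums `g`. -/
structure Sketch {R : Type} [CommRing R] (n k : ℕ) (r : ℕ → ℕ) (f g : ℕ → R) (mem : ℕ → ℕ) :
    Prop where
  rand : ∀ i < words n k, mem i = r i
  cnt : ∀ c < total n k, (mem (words n k + 2 * c) : R) = f c
  sum : ∀ c < total n k, (mem (words n k + 2 * c + 1) : R) = g c
  zero : ∀ i, words n k + 2 * total n k ≤ i → mem i = 0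

section

variable {R : Type} [CommRing R] {n k : ℕ} {r : ℕ → ℕ} {f g : ℕ → R}
  {ω : ℕ → Fin (2 ^ wd n)} {σ : State}

/-- The sketch is linear: one class changes by s in the counter and by s * e in the sum. Since
wraparound is invisible in `R`, deletions are covered by a word s that represents -1. -/
theorem Sketch.step {a s e : ℕ} (hR : ((2 ^ wd n : ℕ) : R) = 0) (h : Sketch n k r f g σ.mem)
    (ha : a < total n k) :
    Sketch n k r (fun c => f c + if a = c then (s : R) else 0)
      (fun c => g c + if a = c then (s * e : R) else 0)
      ((σ.setMem (words n k + 2 * a) ((σ.mem (words n k + 2 * a) + s) % 2 ^ wd n)).setMem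
        (words n k + 2 * a + 1)
        ((σ.mem (words n k + 2 * a + 1) + s * e % 2 ^ wd n) % 2 ^ wd n)).mem where
  rand i hi := by
    rw [State.setMem_mem, State.setMem_mem, if_neg (by omega), if_neg (by omega), h.rand i hi]
  cnt c hc := by
    rw [State.setMem_mem, State.setMem_mem, if_neg (by omega)]
    by_cases hac : a = c
    · subst hac
      rw [if_pos rfl, if_pos rfl, ← h.cnt a hc]
      simp only [Nat.cast_add, natCast_mod_of_eq_zero hR]
    · rw [if_neg (by omega), if_neg hac, h.cnt c hc, add_zero]
  sum c hc := by
    rw [State.setMem_mem, State.setMem_mem]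
    by_cases hac : a = c
    · subst hac
      rw [if_pos rfl, if_pos rfl, ← h.sum a hc]
      simp only [Nat.cast_add, natCast_mod_of_eq_zero hR, Nat.cast_mul]
    · rw [if_neg (by omega), if_neg (by omega), if_neg hac, h.sum c hc, add_zero]
  zero i hi := by
    rw [State.setMem_mem, State.setMem_mem, if_neg (by omega), if_neg (by omega), h.zero i hi]

/-- The change of the counters that is caused by the first `j` samplers. -/
def incr (n k : ℕ) (r : ℕ → ℕ) (j u v : ℕ) (x : R) (c : ℕ) : R :=
  ∑ i ∈ Finset.range j, if addr n k r i u v = c then x else 0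

theorem words_ge (hk : 1 ≤ k) : 5 * dd n ≤ words n k := by
  have : 1 ≤ gRange k := by unfold gRange; exact Nat.succ_le_of_lt (by positivity)
  have := Nat.le_mul_of_pos_right (dd n) this
  unfold words; omega

theorem table_lt {q z : ℕ} (hq : q < dd n) (hz : z < gRange k) :
    4 * dd n + q * gRange k + z < words n k := by
  have := mul_add_lt hq hz
  unfold words; omega

theorem Ev_blkEx {q z x : ℕ} (hk : 1 ≤ k) (hn : 2 * k ≤ n) (hV : Valid (wd n) σ)
    (hP : Params n k σ) (hr : ∀ i < words n k, σ.mem i = r i) (hq : σ.reg 21 = q) (hqD : q < dd n)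
    (hx : x < tmp) (hz : σ.reg x = z) :
    Ev (wd n) (space n k) σ (blkEx x) (blk n k r q z) := by
  have hS := space_lt hk hn
  have h1 := one_lt_two_pow_wd n
  have h5 := words_ge (n := n) hk
  have hU : words n k ≤ space n k := by unfold space; omega
  have hg := gIndex_lt hk hn (r (3 * dd n + q) * z)
  have ht := table_lt hqD hg
  have ht' := (Nat.le_add_right _ _).trans_lt ht
  refine .mod (.ld hV (.add (.add (.mul (.lit (by omega)) (.var hV (by norm_num) hP.r5) (by omega))
    (.mul (.var hV (by norm_num) hq) (.var hV (by norm_num) hP.r9) ?_) ?_)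
    (.div (.mulMod (.ld hV (.add (.mul (.lit (by omega)) (.var hV (by norm_num) hP.r5) (by omega))
      (.var hV (by norm_num) hq) (by omega)) (by omega) (hr _ (by omega)))
      (.var hV hx hz)) (.var hV (by norm_num) hP.r8)) ?_) ?_ ?_) (.var hV (by norm_num) hP.r10)
  · omega
  · omega
  · exact ht.trans ((by omega : words n k ≤ space n k).trans_lt hS)
  · exact ht.trans_le hU
  · exact hr _ ht

theorem Ev_subEx {a y x z : ℕ} (hk : 1 ≤ k) (hn : 2 * k ≤ n) (hV : Valid (wd n) σ)
    (hP : Params n k σ) (hr : ∀ i < words n k, σ.mem i = r i) (hy : y < tmp) (hyD : a < dd n)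
    (ha : σ.reg y = a) (hx : x < tmp) (hz : σ.reg x = z) :
    Ev (wd n) (space n k) σ (subEx y x) (sub n r a z) := by
  have hS := space_lt hk hn
  have h1 := one_lt_two_pow_wd n
  have h5 := words_ge (n := n) hk
  have hU : words n k ≤ space n k := by unfold space; omega
  exact .div (.mulMod (.ld hV (.add (.mul (.lit (by omega)) (.var hV (by norm_num) hP.r5)
    (by omega)) (.var hV hy ha) (by omega)) (by omega) (hr _ (by omega))) (.var hV hx hz))
    (.var hV (by norm_num) hP.r11)

/-- Registers 21 and 23 to 26 receive the base-`dd n` digits q, a, b, c, l of the sampler number.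
Registers 27 and 28 end up with the two cells, 29 with the sampling bit and 30 with the address of
the counter. -/
theorem updateBody_spec {j u v sg : ℕ} (hR : ((2 ^ wd n : ℕ) : R) = 0) (hk : 1 ≤ k)
    (hn : 2 * k ≤ n) (hV : Valid (wd n) σ)
    (hP : Params n k σ) (hM : Sketch n k r f g σ.mem) (hj : j < jj n)
    (h0 : σ.reg 0 = u) (h1 : σ.reg 1 = v) (h19 : σ.reg 19 = u * n + v) (h20 : σ.reg 20 = sg)
    (h17 : σ.reg 17 = j) :
    Hoare (wd n) (space n k) ω updateBody ⊤ σ fun σ' => Params n k σ' ∧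
      (∀ x < 21, σ'.reg x = σ.reg x) ∧
      Sketch n k r (fun c => f c + if addr n k r j u v = c then (sg : R) else 0)
        (fun c => g c + if addr n k r j u v = c then
          (sg * (u * n + v : ℕ) : R) else 0) σ'.mem := by
  have hD := dd_pos n
  have hS := space_lt hk hn
  have hw := one_lt_two_pow_wd n
  have h5 := words_ge (n := n) hk
  have hU : words n k + 2 * total n k ≤ space n k := by unfold space; omega
  have hm := hM.rand
  have hq := Nat.mod_lt j hD
  have ha := Nat.mod_lt (j / dd n) hD
  have hb := Nat.mod_lt (j / dd n / dd n) hD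
  have hc := Nat.mod_lt (j / dd n / dd n / dd n) hD
  have hC := cells_pos (n := n) hk
  have hcu := cell_lt r hk hn (j % dd n) (j / dd n % dd n) u
  have hcv := cell_lt r hk hn (j % dd n) (j / dd n / dd n % dd n) v
  have hA := addr_lt r hk hn hj u v
  have hA' : addr n k r j u v < 2 ^ wd n := by omega
  have hAd := le_address (j := j) (b := smp n r (j / dd n / dd n / dd n % dd n)
    (j / dd n / dd n / dd n / dd n) (u * n + v)) (cu := cell n k r (j % dd n) (j / dd n % dd n) u)
    (cv := cell n k r (j % dd n) (j / dd n / dd n % dd n) v) hC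
  have hcc : cells n k ≤ total n k := by
    have := jj_pos n
    unfold total
    generalize jj n = J at *
    generalize cells n k = C at *
    nlinarith [Nat.zero_le (C * C), Nat.mul_le_mul_left C hC]
  unfold updateBody
  refine Hoare.block_cons (Hoare.assign (v := j % dd n)
    (.mod (.var hV (by norm_num) h17) (.var hV (by norm_num) hP.r5)) fun hV => ?_)
  replace hP := hP.setReg (x := 21) (a := j % dd n) (by norm_num)
  refine Hoare.block_cons (Hoare.assign (v := j / dd n)
    (.div (.var hV (by norm_num) (by simp [h17])) (.var hV (by norm_num) hP.r5)) fun hV => ?_)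
  replace hP := hP.setReg (x := 22) (a := j / dd n) (by norm_num)
  refine Hoare.block_cons (Hoare.assign (v := j / dd n % dd n)
    (.mod (.var hV (by norm_num) (by simp)) (.var hV (by norm_num) hP.r5)) fun hV => ?_)
  replace hP := hP.setReg (x := 23) (a := j / dd n % dd n) (by norm_num)
  refine Hoare.block_cons (Hoare.assign (v := j / dd n / dd n)
    (.div (.var hV (by norm_num) (by simp)) (.var hV (by norm_num) hP.r5)) fun hV => ?_)
  replace hP := hP.setReg (x := 22) (a := j / dd n / dd n) (by norm_num)
  refine Hoare.block_cons (Hoare.assign (v := j / dd n / dd n % dd n)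
    (.mod (.var hV (by norm_num) (by simp)) (.var hV (by norm_num) hP.r5)) fun hV => ?_)
  replace hP := hP.setReg (x := 24) (a := j / dd n / dd n % dd n) (by norm_num)
  refine Hoare.block_cons (Hoare.assign (v := j / dd n / dd n / dd n)
    (.div (.var hV (by norm_num) (by simp)) (.var hV (by norm_num) hP.r5)) fun hV => ?_)
  replace hP := hP.setReg (x := 22) (a := j / dd n / dd n / dd n) (by norm_num)
  refine Hoare.block_cons (Hoare.assign (v := j / dd n / dd n / dd n % dd n)
    (.mod (.var hV (by norm_num) (by simp)) (.var hV (by norm_num) hP.r5)) fun hV => ?_)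
  replace hP := hP.setReg (x := 25) (a := j / dd n / dd n / dd n % dd n) (by norm_num)
  refine Hoare.block_cons (Hoare.assign (v := j / dd n / dd n / dd n / dd n)
    (.div (.var hV (by norm_num) (by simp)) (.var hV (by norm_num) hP.r5)) fun hV => ?_)
  replace hP := hP.setReg (x := 26) (a := j / dd n / dd n / dd n / dd n) (by norm_num)
  refine Hoare.block_cons (Hoare.assign (v := blk n k r (j % dd n) u)
    (Ev_blkEx hk hn hV hP hm (by simp) hq (by norm_num) (by simp [h0])) fun hV => ?_)
  replace hP := hP.setReg (x := 27) (a := blk n k r (j % dd n) u) (by norm_num)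
  refine Hoare.block_cons (Hoare.assign (v := blk n k r (j % dd n) v)
    (Ev_blkEx hk hn hV hP hm (by simp) hq (by norm_num) (by simp [h1])) fun hV => ?_)
  replace hP := hP.setReg (x := 28) (a := blk n k r (j % dd n) v) (by norm_num)
  refine Hoare.block_cons (Hoare.assign (v := cell n k r (j % dd n) (j / dd n % dd n) u)
    (.add (.mul (.var hV (by norm_num) (by simp)) (.var hV (by norm_num) hP.r12)
      (by unfold cell at hcu; omega))
      (Ev_subEx hk hn hV hP hm (by norm_num) ha (by simp) (by norm_num) (by simp [h0]))
      (by unfold cell at hcu; omega)) fun hV => ?_)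
  replace hP := hP.setReg (x := 27) (a := cell n k r (j % dd n) (j / dd n % dd n) u) (by norm_num)
  refine Hoare.block_cons (Hoare.assign (v := cell n k r (j % dd n) (j / dd n / dd n % dd n) v)
    (.add (.mul (.var hV (by norm_num) (by simp)) (.var hV (by norm_num) hP.r12)
      (by unfold cell at hcv; omega))
      (Ev_subEx hk hn hV hP hm (by norm_num) hb (by simp) (by norm_num) (by simp [h1]))
      (by unfold cell at hcv; omega)) fun hV => ?_)
  replace hP := hP.setReg (x := 28) (a := cell n k r (j % dd n) (j / dd n / dd n % dd n) v)
    (by norm_num)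
  refine Hoare.block_cons (Hoare.assign (v := smp n r (j / dd n / dd n / dd n % dd n)
    (j / dd n / dd n / dd n / dd n) (u * n + v)) ?_ fun hV => ?_)
  · have := Ev.ltOp (U := space n k) (by omega) (.addMod (.mulMod
      (.ld (v := r (j / dd n / dd n / dd n % dd n)) hV
        (.var (x := 25) hV (by norm_num) (by simp)) (by omega)
        (hm _ (by omega)))
      (.var (x := 19) hV (by norm_num) (by simp [h19]; rfl)))
      (.ld (v := r (dd n + j / dd n / dd n / dd n % dd n)) hV (.add (.var hV (by norm_num) hP.r5)
        (.var (x := 25) hV (by norm_num) (by simp)) (by omega)) (by omega) (hm _ (by omega))))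
      (.shr (.var hV (by norm_num) hP.r7) (.var (x := 26) hV (by norm_num) (by simp; rfl)))
    rwa [Nat.mod_add_mod] at this
  replace hP := hP.setReg (x := 29) (a := smp n r (j / dd n / dd n / dd n % dd n)
    (j / dd n / dd n / dd n / dd n) (u * n + v)) (by norm_num)
  refine Hoare.block_cons (Hoare.assign (v := words n k + 2 * addr n k r j u v)
    (.add (.var hV (by norm_num) hP.r14) (.mul (.lit (by omega)) (.add (.mul (.add (.mul (.add
      (.mul (.var hV (by norm_num) (by simp [h17])) (.lit (by omega)) ?_)
      (.var hV (by norm_num) (by simp)) ?_) (.var hV (by norm_num) hP.r13) ?_)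
      (.var hV (by norm_num) (by simp)) ?_) (.var hV (by norm_num) hP.r13) ?_)
      (.var hV (by norm_num) (by simp)) ?_) ?_) ?_) fun hV => ?_)
  · exact hAd.1.trans_lt hA'
  · exact hAd.2.1.trans_lt hA'
  · exact hAd.2.2.1.trans_lt hA'
  · exact hAd.2.2.2.1.trans_lt hA'
  · exact hAd.2.2.2.2.trans_lt hA'
  · exact hA'
  · omega
  · omega
  replace hP := hP.setReg (x := 30) (a := words n k + 2 * addr n k r j u v) (by norm_num)
  refine Hoare.block_cons (Hoare.write (.var hV (by norm_num) (by simp; rfl)) (by omega)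
    (.addMod (.ld hV (.var hV (by norm_num) (by simp; rfl)) (by omega) (by simp; rfl))
      (.var hV (by norm_num) (by simp [h20]; rfl))) fun hV => ?_)
  refine Hoare.block_cons (Hoare.write (.add (.var hV (by norm_num) (by simp; rfl))
    (.lit (by omega)) (by omega)) (by omega)
    (.addMod (.ld hV (.add (.var hV (by norm_num) (by simp; rfl)) (.lit (by omega)) (by omega))
        (by omega) (by simp; rfl))
      (.mulMod (.var hV (by norm_num) (by simp [h20]; rfl))
        (.var hV (by norm_num) (by simp [h19]; rfl)))) fun hV => ?_)
  refine Hoare.block_nil ⟨hP.congr fun x h3 h16 => rfl, fun x hx => ?_, ?_⟩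
  · simp only [State.setMem_reg, State.setReg_reg]
    iterate 14 rw [if_neg (by omega)]
  · exact Sketch.step hR hM hA

end

section

variable {R : Type} [CommRing R] {n k : ℕ} {r : ℕ → ℕ} {f g : ℕ → R}
  {ω : ℕ → Fin (2 ^ wd n)} {σ : State}

theorem updateBody_loopFree : updateBody.loopFree = true := by decide

/-- A bound on the update time. -/
def updateTime (n : ℕ) : ℕ := 100 + jj n * (20 + updateBody.len)

theorem jj_le_total (hk : 1 ≤ k) : jj n ≤ total n k := by
  have hC := cells_pos (n := n) hk
  unfold total
  generalize jj n = J at *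
  generalize cells n k = C at *
  nlinarith [Nat.zero_le J, Nat.mul_le_mul_left J (Nat.mul_le_mul hC hC)]

theorem cells_le_total (hk : 1 ≤ k) : cells n k ≤ total n k := by
  have hC := cells_pos (n := n) hk
  have hJ := jj_pos n
  unfold total
  generalize jj n = J at *
  generalize cells n k = C at *
  nlinarith [Nat.zero_le (C * C), Nat.mul_le_mul_left C hC]

theorem updateCmd_spec {u v : ℕ} {b : Bool} (hR : ((2 ^ wd n : ℕ) : R) = 0) (hk : 1 ≤ k)
    (hn : 2 * k ≤ n) (hP : Params n k σ) (hM : Sketch n k r f g σ.mem)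
    (h0 : σ.reg 0 = u) (h1 : σ.reg 1 = v) (h2 : σ.reg 2 = if b then 1 else 0)
    (hu : u < n) (hv : v < n) :
    Hoare (wd n) (space n k) ω updateCmd (updateTime n) σ fun σ' => Params n k σ' ∧
      Sketch n k r (fun c => f c + incr n k r (jj n) u v (if b then 1 else -1 : R) c)
        (fun c => g c + incr n k r (jj n) u v
          ((if b then 1 else -1 : R) * (u * n + v : ℕ)) c) σ'.mem := by
  refine Hoare.of_valid fun hV => ?_
  have hw := one_lt_two_pow_wd n
  have hsq := sq_mul_le hk hn
  have huv := mul_add_lt hu hv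
  have hnn : n * n ≤ (n * n + n + 2) * (4096 * (n * n)) := by nlinarith
  have hS := space_lt hk hn
  have hU : words n k + 2 * total n k ≤ space n k := by unfold space; omega
  have hJ := jj_le_total (n := n) hk
  set o : ℕ := if b then 1 else 0 with ho
  have ho2 : o ≤ 1 := by rw [ho]; split_ifs <;> omega
  -- The word 2 * o - 1, taken modulo 2 ^ w, represents the sign +1 of an insertion or -1 of a
  -- deletion.
  set sg : ℕ := (o * 2 + 2 ^ wd n - 1) % 2 ^ wd n with hsg
  have hsgR : (sg : R) = if b then 1 else -1 := by
    rw [hsg, natCast_mod_of_eq_zero hR, Nat.cast_sub (by omega), Nat.cast_add, hR, ho]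
    cases b <;> norm_num
  have e19 : Ev (wd n) (space n k) σ (V 0 * V 3 + V 1) (u * n + v) :=
    .add (.mul (.var hV (by norm_num) h0) (.var hV (by norm_num) hP.r3) (by omega))
      (.var hV (by norm_num) h1) (by omega)
  -- Each 6 is the length of one of the two assignments, and the final 1 is the `skip` that closes
  -- the block.
  refine Hoare.mono (T₁ := (6 : ℕ) + ((6 : ℕ) + (20 + jj n * (20 + updateBody.len) + 1)))
    (Hoare.seq (Hoare.set e19.ok e19.eval fun hV => ?_)) ?_ fun _ _ h => h
  · have e20 : Ev (wd n) (space n k) (σ.setReg 19 (u * n + v)) (V 2 * C 2 - C 1) sg :=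
      .subMod (.mul (.var hV (by norm_num) (by simp [h2])) (.lit (by omega)) (by omega))
        (.lit (by omega))
    refine Hoare.seq (Hoare.set e20.ok e20.eval fun hV => ?_)
    · refine Hoare.seq (Hoare.forTo (N := jj n) (by norm_num) (by norm_num)
        (I := fun j s => Params n k s ∧ s.reg 17 = j ∧ s.reg 0 = u ∧ s.reg 1 = v ∧
          s.reg 19 = u * n + v ∧ s.reg 20 = sg ∧
          Sketch n k r (fun c => f c + incr n k r j u v (if b then 1 else -1 : R) c)
            (fun c => g c + incr n k r j u v
              ((if b then 1 else -1 : R) * (u * n + v : ℕ)) c) s.mem) ?_ ?_ ?_ ?_)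
      · rintro j s ⟨hP, h, -⟩
        exact ⟨h, hP.r6⟩
      · intro hV
        refine ⟨((hP.setReg (by norm_num)).setReg (by norm_num)).setReg (by norm_num),
          by simp, by simp [h0], by simp [h1], by simp, by simp, ?_⟩
        simpa [incr] using hM
      · rintro j hj s hV ⟨hP, h17, h0, h1, h19, h20, hM⟩
        refine ((updateBody_spec hR hk hn hV hP hM hj h0 h1 h19 h20 h17).of_loopFree
          updateBody_loopFree).mono le_rfl ?_
        rintro s' - ⟨hP', hreg, hM'⟩
        refine ⟨by rw [hreg 17 (by norm_num), h17], fun hV' => ⟨hP'.setReg (by norm_num),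
          by simp, by simp [hreg, h0], by simp [hreg, h1], by simp [hreg, h19],
          by simp [hreg, h20], ?_⟩⟩
        rw [hsgR] at hM'
        simp only [incr, Finset.sum_range_succ, ← add_assoc]
        exact hM'
      · rintro s - ⟨hP, -, -, -, -, -, hM⟩
        exact Hoare.of_loopFree (c := .skip) (Hoare.skip (And.intro hP hM)) rfl
  · unfold updateTime
    norm_cast
    omega

theorem updateTime_le (n : ℕ) : updateTime n ≤ (120 + updateBody.len) * jj n := by
  have := jj_pos n
  unfold updateTime
  nlinarith [Nat.zero_le updateBody.len]

theorem preprocessCmd_spec (hk : 1 ≤ k) (hn : 2 * k ≤ n) :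
    Hoare (wd n) (space n k) ω preprocessCmd ⊤ (StreamingAlgorithm.start n k) fun σ' =>
      Params n k σ' ∧ Sketch n k (fun i => ω i) (0 : ℕ → R) 0 σ'.mem := by
  refine Hoare.of_valid fun hV => ?_
  have hD := dd_pos n
  have hw := one_lt_two_pow_wd n
  have hS := space_lt hk hn
  have hU : words n k + 2 * total n k ≤ space n k := by unfold space; omega
  have hJ := jj_le_total (n := n) hk
  have hCT := cells_le_total (n := n) hk
  have hC := cells_pos (n := n) hk
  have h0 : (StreamingAlgorithm.start n k).reg 0 = n := by simp [StreamingAlgorithm.start]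
  have h1 : (StreamingAlgorithm.start n k).reg 1 = k := by simp [StreamingAlgorithm.start]
  have hmem : ∀ i, (StreamingAlgorithm.start n k).mem i = 0 := fun _ => rfl
  have hdrawn : (StreamingAlgorithm.start n k).drawn = 0 := rfl
  generalize StreamingAlgorithm.start n k = σ at *
  unfold preprocessCmd
  refine Hoare.block_cons (Hoare.assign (.var hV (by norm_num) h0) fun hV => ?_)
  refine Hoare.block_cons (Hoare.assign (.var (v := k) hV (by norm_num) (by simp [h1]))
    fun hV => ?_)
  refine Hoare.block_cons (Hoare.assign (.lit (by omega)) fun hV => ?_)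
  -- Register 0 is halved until it vanishes. The count in register 17 plus the bit length of what is
  -- left in register 0 stays equal to `lg n`.
  refine Hoare.block_cons (Hoare.mono (Hoare.whil (m := n) (T := ⊤) (e := V 0)
    (I := fun m s => s.reg 0 ≤ m ∧
      s.reg 17 + (if s.reg 0 = 0 then 0 else Nat.log 2 (s.reg 0) + 1) = lg n ∧
      s.reg 3 = n ∧ s.reg 4 = k ∧ (∀ i, s.mem i = 0) ∧ s.drawn = 0)
    (Q := fun s => s.reg 17 = lg n ∧ s.reg 3 = n ∧ s.reg 4 = k ∧ (∀ i, s.mem i = 0) ∧ s.drawn = 0)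
    ?_ ?_ ?_ ?_ ?_) le_top ?_)
  · exact fun m s _ => (by norm_num : 0 < tmp)
  · exact fun s h => Nat.le_zero.1 h.1
  · rintro m s ⟨hle, hlg, h3, h4, hm, hd⟩ hne
    change s.reg 0 ≠ 0 at hne
    refine Hoare.of_valid fun hV => ?_
    have hlgn : lg n < 2 ^ wd n := by
      have : lg n ≤ dd n := by unfold dd; omega
      have := words_ge (n := n) hk
      omega
    rw [if_neg hne] at hlg
    refine Hoare.block_cons (Hoare.assign (.div (.var hV (by norm_num) rfl) (.lit (by omega)))
      fun hV => ?_)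
    refine Hoare.block_cons (Hoare.assign (.add (.var (v := s.reg 17) hV (by norm_num) (by simp))
      (.lit (by omega)) (by omega)) fun hV => ?_)
    refine Hoare.block_nil ⟨m, le_rfl, ?_, ?_, by simp [h3], by simp [h4], hm, hd⟩
    · simp only [State.setReg_reg]
      norm_num
      omega
    · simp only [State.setReg_reg]
      norm_num
      rw [← hlg]
      split_ifs with h
      · rw [Nat.log_of_lt (by omega)]
      · have := Nat.log_div_base 2 (s.reg 0)
        have h2 : 1 ≤ Nat.log 2 (s.reg 0) := Nat.log_pos (by norm_num) (by omega)
        omega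
  · refine ⟨by simp [h0], ?_, by simp, by simp, hmem, hdrawn⟩
    simp only [State.setReg_reg]
    norm_num
    rw [h0, if_neg (by omega)]
    unfold lg; rfl
  · rintro m s - ⟨-, hlg, h3, h4, hm, hd⟩ hz
    change s.reg 0 = 0 at hz
    rw [if_pos hz, add_zero] at hlg
    exact ⟨hlg, h3, h4, hm, hd⟩
  clear! σ
  rintro σ hV ⟨h17, h3, h4, hmem, hdrawn⟩
  have hDlt : dd n ≤ words n k := by unfold words; omega
  refine Hoare.block_cons (Hoare.assign (v := dd n) ?_ fun hV => ?_)
  · have : 1024 * lg n = dd n := by unfold dd; rfl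
    rw [← this]
    exact .mul (.lit (by omega)) (.var hV (by norm_num) h17) (by omega)
  have p2 : dd n * dd n ≤ jj n := by
    unfold jj
    exact ((Nat.le_mul_of_pos_right _ hD).trans (Nat.le_mul_of_pos_right _ hD)).trans
      (Nat.le_mul_of_pos_right _ hD)
  have p3 : dd n * dd n * dd n ≤ jj n := by
    unfold jj
    exact (Nat.le_mul_of_pos_right _ hD).trans (Nat.le_mul_of_pos_right _ hD)
  have p4 : dd n * dd n * dd n * dd n ≤ jj n := by
    unfold jj
    exact Nat.le_mul_of_pos_right _ hD
  have p5 : dd n * dd n * dd n * dd n * dd n ≤ jj n := by unfold jj; rfl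
  have s5 : (σ.setReg 5 (dd n)).reg 5 = dd n := by simp
  refine Hoare.block_cons (Hoare.assign (v := jj n) ?_ fun hV => ?_)
  · have : dd n * dd n * dd n * dd n * dd n = jj n := by unfold jj; rfl
    rw [← this]
    exact .mul (.mul (.mul (.mul (.var hV (by norm_num) s5) (.var hV (by norm_num) s5) (by omega))
      (.var hV (by norm_num) s5) (by omega)) (.var hV (by norm_num) s5) (by omega))
      (.var hV (by norm_num) s5) (by omega)
  -- The difference 0 - 1 wraps around to the largest word, so the program need not know the word
  -- length.
  refine Hoare.block_cons (Hoare.assign (v := wmax n) ?_ fun hV => ?_)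
  · have := Ev.subMod (U := space n k) (w := wd n)
      (σ := (σ.setReg 5 (dd n)).setReg 6 (jj n)) (Ev.lit (x := 0) (by omega))
      (Ev.lit (x := 1) (by omega))
    rwa [zero_add, Nat.mod_eq_of_lt (by omega)] at this
  have hgw : gRange k ≤ words n k := by
    unfold words
    have := Nat.le_mul_of_pos_left (gRange k) hD
    omega
  have g1 : 160 * k ≤ gRange k := by unfold gRange; exact Nat.le_mul_of_pos_right _ hk
  have g2 : 80 * k * k ≤ gRange k := by
    unfold gRange; exact Nat.mul_le_mul_right _ (by omega)
  have g3 : 160 * k * k = gRange k := rfl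
  refine Hoare.block_cons (Hoare.assign (v := gWidth n k)
    (.div (.var hV (by norm_num) (by simp)) (.mul (.mul (.lit (by omega))
      (.var (v := k) hV (by norm_num) (by simp [h4])) (by omega))
      (.var (v := k) hV (by norm_num) (by simp [h4])) (by omega))) fun hV => ?_)
  refine Hoare.block_cons (Hoare.assign (v := gRange k)
    (.mul (.mul (.lit (by omega))
      (.var (v := k) hV (by norm_num) (by simp [h4])) (by omega))
      (.var (v := k) hV (by norm_num) (by simp [h4])) (by omega)) fun hV => ?_)
  have b1 : 0 < blocks k := by unfold blocks; omega
  have c1 : 0 < subRange n := by unfold subRange; positivity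
  have b2 : blocks k ≤ cells n k := Nat.le_mul_of_pos_right _ c1
  have c2 : subRange n ≤ cells n k := Nat.le_mul_of_pos_left _ b1
  have b3 : 8 * k = blocks k := rfl
  have c3 : 20 * dd n * dd n = subRange n := rfl
  have c4 : 20 * dd n ≤ subRange n := by unfold subRange; exact Nat.le_mul_of_pos_right _ hD
  have c5 : 10 * dd n * dd n ≤ subRange n := by
    unfold subRange; exact Nat.mul_le_mul_right _ (by omega)
  refine Hoare.block_cons (Hoare.assign (v := blocks k)
    (.mul (.lit (by omega)) (.var (v := k) hV (by norm_num) (by simp [h4])) (by omega))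
    fun hV => ?_)
  refine Hoare.block_cons (Hoare.assign (v := subWidth n)
    (.div (.var hV (by norm_num) (by simp)) (.mul (.mul (.lit (by omega))
      (.var (v := dd n) hV (by norm_num) (by simp)) (by omega))
      (.var (v := dd n) hV (by norm_num) (by simp)) (by omega))) fun hV => ?_)
  refine Hoare.block_cons (Hoare.assign (v := subRange n)
    (.mul (.mul (.lit (by omega))
      (.var (v := dd n) hV (by norm_num) (by simp)) (by omega))
      (.var (v := dd n) hV (by norm_num) (by simp)) (by omega)) fun hV => ?_)
  refine Hoare.block_cons (Hoare.assign (v := cells n k)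
    (.mul (.var (v := blocks k) hV (by norm_num) (by simp))
      (.var (v := subRange n) hV (by norm_num) (by simp))
      ((by omega : cells n k < 2 ^ wd n))) fun hV => ?_)
  have w1 : 4 * dd n + dd n * gRange k = words n k := rfl
  refine Hoare.block_cons (Hoare.assign (v := words n k)
    (.add (.mul (.lit (by omega)) (.var (v := dd n) hV (by norm_num) (by simp)) (by omega))
      (.mul (.var (v := dd n) hV (by norm_num) (by simp))
      (.var (v := gRange k) hV (by norm_num) (by simp)) (by omega)) (by omega)) fun hV => ?_)
  have t1 : jj n * 2 * cells n k ≤ total n k := Nat.le_mul_of_pos_right _ hC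
  have t2 : jj n * 2 ≤ jj n * 2 * cells n k := Nat.le_mul_of_pos_right _ hC
  have t3 : jj n * 2 * cells n k * cells n k = total n k := rfl
  refine Hoare.block_cons (Hoare.assign (v := total n k)
    (.mul (.mul (.mul (.var (v := jj n) hV (by norm_num) (by simp)) (.lit (by omega)) (by omega))
      (.var (v := cells n k) hV (by norm_num) (by simp)) (by omega))
      (.var (v := cells n k) hV (by norm_num) (by simp)) (by omega)) fun hV => ?_)
  refine Hoare.block_cons (Hoare.assign (v := words n k + 2 * total n k)
    (.add (.var (v := words n k) hV (by norm_num) (by simp)) (.mul (.lit (by omega))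
      (.var (v := total n k) hV (by norm_num) (by simp)) (by omega)) (by omega)) fun hV => ?_)
  refine Hoare.block_cons (Hoare.mono (Hoare.forTo (N := words n k) (T := ⊤) (by norm_num)
    (by norm_num) (I := fun j s => Params n k s ∧ s.reg 17 = j ∧ s.drawn = j ∧
      (∀ i < j, s.mem i = ω i) ∧ (∀ i, j ≤ i → s.mem i = 0)) (Q := fun s => Params n k s ∧
        Sketch n k (fun i => ω i) (0 : ℕ → R) 0 s.mem) ?_ ?_ ?_ ?_) le_top
    fun s _ h => Hoare.block_nil h)
  · rintro j s ⟨hP, h, -⟩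
    exact ⟨h, hP.r14⟩
  · intro hV
    refine ⟨?_, by simp, hdrawn, by simp, fun i _ => hmem i⟩
    constructor <;> simp [h3, h4]
  · rintro j hj s hV ⟨hP, h17, hd, hm, hz⟩
    refine Hoare.block_cons (Hoare.rand ?_)
    refine Hoare.of_valid fun hV => ?_
    refine Hoare.block_cons (Hoare.write (i := j) (v := (ω j : ℕ))
      (.var hV (by norm_num) (by simp [h17]))
      (by omega) (.var hV (by norm_num) (by simp [hd])) fun hV => ?_)
    refine Hoare.block_nil ⟨by simp [h17], fun _ => ⟨?_, by simp, by simp [hd], ?_, ?_⟩⟩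
    · exact ((hP.setReg (x := 18) (a := ω s.drawn) (by norm_num)).setReg (x := 17) (a := j + 1)
        (by norm_num)).congr fun _ _ _ => rfl
    · intro i hi
      simp only [State.setReg_mem, State.setMem_mem]
      split_ifs with h
      · rw [h]
      · exact hm i (by omega)
    · intro i hi
      simp only [State.setReg_mem, State.setMem_mem]
      rw [if_neg (by omega)]
      exact hz i (by omega)
  · rintro s - ⟨hP, -, -, hm, hz⟩
    refine ⟨hP, ⟨hm, fun c _ => ?_, fun c _ => ?_, fun i hi => hz i (by omega)⟩⟩
    · rw [hz _ (by omega)]; simp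
    · rw [hz _ (by omega)]; simp

end

/-! ### The query -/

/-- Check the pair of positions whose number is in register 19. -/
def checkBody : Cmd := .block [
  .set 23 (.ld (V 15 + V 19 / V 4)),
  .set 24 (.ld (V 15 + V 19 % V 4)),
  .set 25 (.ld (V 14 + C 2 * V 23 + C 1)),
  .set 26 (.ld (V 14 + C 2 * V 24 + C 1)),
  .set 27 (.bin .eq (V 25 / V 3) (V 26 / V 3) + .bin .eq (V 25 / V 3) (V 26 % V 3) +
    .bin .eq (V 25 % V 3) (V 26 / V 3) + .bin .eq (V 25 % V 3) (V 26 % V 3)),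
  .set 18 (V 18 * .bin .eq (.ld (V 14 + C 2 * V 23)) (C 1) *
    .bin .lt (C 0) (.bin .eq (V 19 / V 4) (V 19 % V 4) + .bin .eq (V 27) (C 0)))]

/-- One step of the increment of the number that is written at the end of the memory. -/
def incBody : Cmd := .block [
  .set 32 (.ld (V 15 + V 21) + V 31),
  .set 31 (.bin .eq (V 32) (V 16)),
  .put (V 15 + V 21) (V 32 * (C 1 - V 31))]

/-- Output one edge. -/
def printBody : Cmd := .block [
  .set 25 (.ld (V 14 + C 2 * .ld (V 15 + V 21) + C 1)),
  .print (V 25 / V 3) (V 25 % V 3)]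

/-- The body of the exhaustive search. -/
def searchBody : Cmd := .block [
  .set 18 (C 1),
  .forTo 19 20 checkBody,
  .cond (V 18) (.set 17 (C 0))
    (.block [.set 31 (C 1), .forTo 21 4 incBody, .set 17 (.bin .eq (V 31) (C 0))])]

/-- The program that is run when a solution is queried. -/
def queryCmd : Cmd := .block [
  .set 17 (C 1),
  .set 18 (C 0),
  .set 20 (V 4 * V 4),
  .whil (V 17) searchBody,
  .cond (V 18) (.forTo 21 4 printBody) .skip]

/-- The edges with the numbers `a` and `b` are disjoint. -/
def DisjointEdges (n a b : ℕ) : Prop :=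
  a / n ≠ b / n ∧ a / n ≠ b % n ∧ a % n ≠ b / n ∧ a % n ≠ b % n

instance (n a b : ℕ) : Decidable (DisjointEdges n a b) := by
  unfold DisjointEdges; infer_instance

/-- The classes `d 0, …, d (k - 1)` contain exactly one edge each, and these edges are disjoint. -/
def Solves (n k : ℕ) (m : ℕ → ℕ) (d : ℕ → ℕ) : Prop :=
  ∀ i < k, ∀ j < k, m (words n k + 2 * d i) = 1 ∧
    (i = j ∨ DisjointEdges n (m (words n k + 2 * d i + 1)) (m (words n k + 2 * d j + 1)))

/-- The digits of `x` in base `N`. -/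
def digit (N x i : ℕ) : ℕ := x / N ^ i % N

/-- In the step from x to x + 1 a carry enters digit i exactly when all lower digits roll over to 0,
that is, when N ^ i divides x + 1. The factor 1 - carry resets a digit that has reached N. -/
theorem digit_succ {N x i : ℕ} (hN : 0 < N) :
    let c := if N ^ i ∣ x + 1 then 1 else 0
    (digit N (x + 1) i = (digit N x i + c) * (1 - if digit N x i + c = N then 1 else 0)) ∧
      ((if digit N x i + c = N then 1 else 0) = if N ^ (i + 1) ∣ x + 1 then 1 else 0) := by
  intro c
  have hc : c ≤ 1 := by simp only [c]; split_ifs <;> omega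
  have hs : (x + 1) / N ^ i = x / N ^ i + c := Nat.succ_div
  have hlt : digit N x i < N := Nat.mod_lt _ hN
  have hmod : digit N (x + 1) i = (digit N x i + c) % N := by
    unfold digit; rw [hs, Nat.mod_add_mod]
  constructor
  · rw [hmod]
    split_ifs with h
    · rw [h, Nat.mod_self]; simp
    · rw [Nat.mod_eq_of_lt (by omega)]; simp
  · have : digit N x i + c = N ↔ N ^ (i + 1) ∣ x + 1 := by
      have h0 : N ^ (i + 1) ∣ x + 1 ↔ N ^ i ∣ x + 1 ∧ N ∣ (x + 1) / N ^ i := by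
        constructor
        · intro h
          refine ⟨(pow_dvd_pow N (Nat.le_succ i)).trans h, ?_⟩
          obtain ⟨y, hy⟩ := h
          rw [hy, pow_succ, mul_assoc, Nat.mul_div_cancel_left _ (by positivity)]
          exact dvd_mul_right _ _
        · rintro ⟨⟨y, hy⟩, h2⟩
          rw [hy, Nat.mul_div_cancel_left _ (by positivity)] at h2
          rw [hy, pow_succ]
          exact mul_dvd_mul_left _ h2
      rw [h0, hs, Nat.dvd_iff_mod_eq_zero, Nat.dvd_iff_mod_eq_zero (n := x / N ^ i + c)]
      have h3 : (x / N ^ i + c) % N = (digit N x i + c) % N := by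
        unfold digit; rw [Nat.mod_add_mod]
      rw [h3, ← Nat.dvd_iff_mod_eq_zero]
      constructor
      · intro h
        refine ⟨?_, by rw [h, Nat.mod_self]⟩
        by_contra hd
        simp only [c, if_neg hd] at h
        omega
      · rintro ⟨h, h2⟩
        by_contra hd
        rw [Nat.mod_eq_of_lt (by omega)] at h2
        simp only [c, if_pos h] at h2
        omega
    simp only [this]

/-- Counting through the numbers below N ^ k thus visits every k-tuple of classes. -/
theorem exists_digits {N : ℕ} (hN : 0 < N) (d : ℕ → ℕ) (k : ℕ) (hd : ∀ i < k, d i < N) :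
    ∃ x < N ^ k, ∀ i < k, digit N x i = d i := by
  induction k with
  | zero => exact ⟨0, by simp, by simp⟩
  | succ k ih =>
    obtain ⟨x, hx, h⟩ := ih fun i hi => hd i (by omega)
    refine ⟨d k * N ^ k + x, ?_, fun i hi => ?_⟩
    · rw [pow_succ']; exact mul_add_lt (hd k (by omega)) hx
    · unfold digit
      rcases Nat.lt_succ_iff_lt_or_eq.1 hi with h1 | rfl
      · rw [← h i h1]
        unfold digit
        obtain ⟨e, rfl⟩ : ∃ e, k = i + (e + 1) := ⟨k - i - 1, by omega⟩
        have : d (i + (e + 1)) * N ^ (i + (e + 1)) + x =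
          N ^ i * (N * (d (i + (e + 1)) * N ^ e)) + x := by ring
        rw [this, Nat.mul_add_div (by positivity), Nat.mul_add_mod]
      · have : d i * N ^ i + x = N ^ i * d i + x := by ring
        rw [this, Nat.mul_add_div (by positivity), Nat.div_eq_of_lt hx, add_zero,
          Nat.mod_eq_of_lt (hd i (by omega))]

/-! ### Correctness of the exhaustive search -/

section

variable {n k : ℕ} {ω : ℕ → Fin (2 ^ wd n)} {σ : State} {m : ℕ → ℕ}

theorem total_pos (hk : 1 ≤ k) : 0 < total n k := (jj_pos n).trans_le (jj_le_total hk)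

theorem k_sq_le (hk : 1 ≤ k) : k * k ≤ words n k := by
  have hD := dd_pos n
  have : k * k ≤ gRange k := by
    unfold gRange; exact Nat.mul_le_mul_right k (by omega)
  have := Nat.le_mul_of_pos_left (gRange k) hD
  unfold words; omega

/-- Truth values are combined arithmetically. Four equality tests sum to 0 exactly for disjoint
edges, a product is a conjunction, and a positive sum is a disjunction. The number t encodes the
pair (t / k, t % k). -/
theorem checkBody_spec {t : ℕ} {d : ℕ → ℕ} {b : ℕ} (hk : 1 ≤ k)
    (hn : 2 * k ≤ n) (hV : Valid (wd n) σ) (hP : Params n k σ) (ht : t < k * k)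
    (h19 : σ.reg 19 = t) (h18 : σ.reg 18 = b) (hb : b ≤ 1)
    (hm : ∀ i < words n k + 2 * total n k, σ.mem i = m i)
    (hd : ∀ i < k, σ.mem (words n k + 2 * total n k + i) = d i) (hdN : ∀ i < k, d i < total n k)
    {Q : State → Prop}
    (hQ : ∀ v23 v24 v25 v26 v27 v18, v18 = b * (if m (words n k + 2 * d (t / k)) = 1 ∧
      (t / k = t % k ∨ DisjointEdges n (m (words n k + 2 * d (t / k) + 1))
        (m (words n k + 2 * d (t % k) + 1))) then 1 else 0) →
      Q ((((((σ.setReg 23 v23).setReg 24 v24).setReg 25 v25).setReg 26 v26).setReg 27 v27).setReg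
        18 v18)) :
    Hoare (wd n) (space n k) ω checkBody ⊤ σ Q := by
  have hw := one_lt_two_pow_wd n
  have hS := space_lt hk hn
  have hU : words n k + 2 * total n k + k = space n k := rfl
  have hi : t / k < k := (Nat.div_lt_iff_lt_mul (by omega)).2 ht
  have hj : t % k < k := Nat.mod_lt _ (by omega)
  have hdi := hdN _ hi
  have hdj := hdN _ hj
  unfold checkBody
  refine Hoare.block_cons (Hoare.assign (v := d (t / k)) (.ld hV (.add (.var hV (by norm_num) hP.r15)
    (.div (.var hV (by norm_num) h19) (.var hV (by norm_num) hP.r4)) (by omega)) (by omega)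
    (hd _ hi)) fun hV => ?_)
  replace hP := hP.setReg (x := 23) (a := d (t / k)) (by norm_num)
  refine Hoare.block_cons (Hoare.assign (v := d (t % k)) (.ld hV (.add (.var hV (by norm_num) hP.r15)
    (.mod (.var hV (by norm_num) (by simp [h19])) (.var hV (by norm_num) hP.r4)) (by omega))
    (by omega) (hd _ hj)) fun hV => ?_)
  replace hP := hP.setReg (x := 24) (a := d (t % k)) (by norm_num)
  refine Hoare.block_cons (Hoare.assign (v := m (words n k + 2 * d (t / k) + 1))
    (.ld hV (.add (.add (.var hV (by norm_num) hP.r14) (.mul (.lit (by omega))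
      (.var (v := d (t / k)) hV (by norm_num) (by simp)) (by omega)) (by omega)) (.lit (by omega))
      (by omega)) (by omega) (hm _ (by omega))) fun hV => ?_)
  generalize hea : m (words n k + 2 * d (t / k) + 1) = ea at *
  replace hP := hP.setReg (x := 25) (a := ea) (by norm_num)
  refine Hoare.block_cons (Hoare.assign (v := m (words n k + 2 * d (t % k) + 1))
    (.ld hV (.add (.add (.var hV (by norm_num) hP.r14) (.mul (.lit (by omega))
      (.var (v := d (t % k)) hV (by norm_num) (by simp)) (by omega)) (by omega)) (.lit (by omega))
      (by omega)) (by omega) (hm _ (by omega))) fun hV => ?_)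
  generalize heb : m (words n k + 2 * d (t % k) + 1) = eb at *
  replace hP := hP.setReg (x := 26) (a := eb) (by norm_num)
  generalize hs : (((σ.setReg 23 (d (t / k))).setReg 24 (d (t % k))).setReg 25 ea).setReg 26 eb = s
    at *
  have s25 : s.reg 25 = ea := by rw [← hs]; simp
  have s26 : s.reg 26 = eb := by rw [← hs]; simp
  have s23 : s.reg 23 = d (t / k) := by rw [← hs]; simp
  have s18 : s.reg 18 = b := by rw [← hs]; simp [h18]
  have s19 : s.reg 19 = t := by rw [← hs]; simp [h19]
  have smem : s.mem = σ.mem := by rw [← hs]; rfl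
  have hle : ∀ (p : Prop) [Decidable p], (if p then 1 else 0) ≤ 1 := by
    intro p _; split_ifs <;> omega
  have e25 := Ev.var (U := space n k) hV (by norm_num) s25
  have e26 := Ev.var (U := space n k) hV (by norm_num) s26
  have e3 := Ev.var (U := space n k) hV (by norm_num) hP.r3
  have l1 := hle (ea / n = eb / n)
  have l2 := hle (ea / n = eb % n)
  have l3 := hle (ea % n = eb / n)
  have l4 := hle (ea % n = eb % n)
  refine Hoare.block_cons (Hoare.assign (.add (.add (.add
    (.eqOp (by omega) (.div e25 e3) (.div e26 e3)) (.eqOp (by omega) (.div e25 e3) (.mod e26 e3))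
    (by omega)) (.eqOp (by omega) (.mod e25 e3) (.div e26 e3)) (by omega))
    (.eqOp (by omega) (.mod e25 e3) (.mod e26 e3)) (by omega)) fun hV => ?_)
  generalize hcl : (if ea / n = eb / n then 1 else 0) + (if ea / n = eb % n then 1 else 0) +
    (if ea % n = eb / n then 1 else 0) + (if ea % n = eb % n then 1 else 0) = cl at *
  replace hP := hP.setReg (x := 27) (a := cl) (by norm_num)
  have hcl0 : cl = 0 ↔ DisjointEdges n ea eb := by
    rw [← hcl]
    unfold DisjointEdges
    split_ifs <;> simp_all
  have e19 : Ev (wd n) (space n k) (s.setReg 27 cl) (V 19) t :=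
    .var hV (by norm_num) (by simp [s19])
  have e4 := Ev.var (U := space n k) hV (by norm_num) hP.r4
  have m1 := hle (t / k = t % k)
  have m2 := hle (cl = 0)
  have m3 := hle (m (words n k + 2 * d (t / k)) = 1)
  have m4 := hle (0 < (if t / k = t % k then 1 else 0) + (if cl = 0 then 1 else 0))
  have m5 := Nat.mul_le_mul hb m3
  have m6 := Nat.mul_le_mul m5 m4
  refine Hoare.block_cons (Hoare.assign (.mul (.mul (.var (v := b) hV (by norm_num) (by simp [s18]))
    (.eqOp (x := m (words n k + 2 * d (t / k))) (by omega) (.ld hV (.add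
      (.var hV (by norm_num) hP.r14) (.mul (.lit (by omega))
      (.var (v := d (t / k)) hV (by norm_num) (by simp [s23])) (by omega)) (by omega)) (by omega)
      (by simp only [State.setReg_mem, smem]; exact hm _ (by omega))) (.lit (by omega))) (by omega))
    (.ltOp (by omega) (.lit (by omega)) (.add (.eqOp (by omega) (.div e19 e4) (.mod e19 e4))
    (.eqOp (by omega) (.var (v := cl) hV (by norm_num) (by simp)) (.lit (by omega))) (by omega)))
    (by omega)) fun hV => ?_)
  refine Hoare.block_nil ?_
  rw [← hs]
  refine hQ _ _ _ _ _ _ ?_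
  rw [mul_assoc]
  congr 1
  by_cases c1 : m (words n k + 2 * d (t / k)) = 1 <;> by_cases c2 : t / k = t % k <;>
    by_cases c3 : cl = 0 <;> simp [c1, c2, c3, ← hcl0]

theorem incBody_spec {x i : ℕ} (hk : 1 ≤ k) (hn : 2 * k ≤ n) (hV : Valid (wd n) σ)
    (hP : Params n k σ) (hi : i < k) (h21 : σ.reg 21 = i)
    (h31 : σ.reg 31 = if total n k ^ i ∣ x + 1 then 1 else 0)
    (hd : σ.mem (words n k + 2 * total n k + i) = digit (total n k) x i) {Q : State → Prop}
    (hQ : ∀ v32, Q (((σ.setReg 32 v32).setReg 31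
      (if total n k ^ (i + 1) ∣ x + 1 then 1 else 0)).setMem (words n k + 2 * total n k + i)
        (digit (total n k) (x + 1) i))) :
    Hoare (wd n) (space n k) ω incBody ⊤ σ Q := by
  have hw := one_lt_two_pow_wd n
  have hS := space_lt hk hn
  have hU : words n k + 2 * total n k + k = space n k := rfl
  have hN := total_pos (n := n) hk
  have hdig := digit_succ (N := total n k) (x := x) (i := i) hN
  have hlt : digit (total n k) x i < total n k := Nat.mod_lt _ hN
  have hlt' : digit (total n k) (x + 1) i < total n k := Nat.mod_lt _ hN
  have hc1 : (if total n k ^ i ∣ x + 1 then 1 else 0) ≤ 1 := by split_ifs <;> omega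
  generalize (if total n k ^ i ∣ x + 1 then 1 else 0) = c at *
  simp only at hdig
  obtain ⟨hdig, hdvd⟩ := hdig
  rw [hdvd] at hdig
  unfold incBody
  refine Hoare.block_cons (Hoare.assign (.add (.ld hV (.add (.var hV (by norm_num) hP.r15)
    (.var hV (by norm_num) h21) (by omega)) (by omega) hd) (.var hV (by norm_num) h31) (by omega))
    fun hV => ?_)
  replace hP := hP.setReg (x := 32) (a := digit (total n k) x i + c) (by norm_num)
  refine Hoare.block_cons (Hoare.assign (v := if total n k ^ (i + 1) ∣ x + 1 then 1 else 0)
    ?_ fun hV => ?_)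
  · have := Ev.eqOp (U := space n k) (by omega)
      (.var (x := 32) (v := digit (total n k) x i + c) hV (by norm_num) (by simp))
      (.var hV (by norm_num) hP.r16)
    rwa [hdvd] at this
  have hc2 : (if total n k ^ (i + 1) ∣ x + 1 then 1 else 0) ≤ 1 := by split_ifs <;> omega
  refine Hoare.block_cons (Hoare.write (i := words n k + 2 * total n k + i)
    (v := digit (total n k) (x + 1) i) ?_ (by omega) ?_ fun hV => ?_)
  · have hP' := hP.setReg (x := 31) (a := if total n k ^ (i + 1) ∣ x + 1 then 1 else 0) (by norm_num)
    exact .add (.var hV (by norm_num) hP'.r15) (.var (v := i) hV (by norm_num) (by simp [h21]))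
      (by omega)
  · rw [hdig] at hlt' ⊢
    exact .mul (.var hV (by norm_num) (by simp)) (.sub (.lit (by omega))
      (.var hV (by norm_num) (by simp)) hc2) (by omega)
  · exact Hoare.block_nil (hQ _)

/-- The state of the exhaustive search when the number `x` is written at the end of the memory. -/
structure Searching (n k : ℕ) (m : ℕ → ℕ) (o : List (ℕ × ℕ)) (x : ℕ) (s : State) : Prop where
  params : Params n k s
  r20 : s.reg 20 = k * k
  mem : ∀ i < words n k + 2 * total n k, s.mem i = m i
  dig : ∀ i < k, s.mem (words n k + 2 * total n k + i) = digit (total n k) x i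
  out : s.out = o

theorem Searching.setReg {o : List (ℕ × ℕ)} {x y a : ℕ} (h : Searching n k m o x σ)
    (hy : 16 < y) (hy' : y ≠ 20) : Searching n k m o x (σ.setReg y a) :=
  ⟨h.params.setReg (.inr hy), by simp [h.r20, hy'.symm], h.mem, h.dig, h.out⟩

theorem check_spec {o : List (ℕ × ℕ)} {x : ℕ} (hk : 1 ≤ k) (hn : 2 * k ≤ n)
    (h : Searching n k m o x σ) (h18 : σ.reg 18 = 1) {Q : State → Prop}
    (hQ : ∀ s, Searching n k m o x s →
      (s.reg 18 = 1 ∧ Solves n k m (digit (total n k) x) ∨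
        s.reg 18 = 0 ∧ ¬ Solves n k m (digit (total n k) x)) → Q s) :
    Hoare (wd n) (space n k) ω (.forTo 19 20 checkBody) ⊤ σ Q := by
  set ok : ℕ → Prop := fun t => m (words n k + 2 * digit (total n k) x (t / k)) = 1 ∧
      (t / k = t % k ∨ DisjointEdges n (m (words n k + 2 * digit (total n k) x (t / k) + 1))
        (m (words n k + 2 * digit (total n k) x (t % k) + 1))) with hok
  refine Hoare.mono (Hoare.forTo (N := k * k) (T := ⊤) (by norm_num) (by norm_num)
    (I := fun t s => Searching n k m o x s ∧ s.reg 19 = t ∧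
      s.reg 18 = if ∀ t' < t, ok t' then 1 else 0) (Q := Q) ?_ ?_ ?_ ?_) le_top fun _ _ h => h
  · rintro t s ⟨h, h19, -⟩
    exact ⟨h19, h.r20⟩
  · intro hV
    exact ⟨h.setReg (by norm_num) (by norm_num), by simp, by simp [h18]⟩
  · rintro t ht s hV ⟨h, h19, h18⟩
    refine checkBody_spec hk hn hV h.params ht h19 h18 (by split_ifs <;> omega) h.mem h.dig
      (fun i _ => Nat.mod_lt _ (total_pos hk)) ?_
    intro v23 v24 v25 v26 v27 v18 hv18
    refine ⟨by simp [h19], fun _ => ⟨?_, by simp, ?_⟩⟩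
    · refine ((((((h.setReg ?_ ?_).setReg ?_ ?_).setReg ?_ ?_).setReg ?_ ?_).setReg ?_ ?_).setReg
        ?_ ?_).setReg ?_ ?_ <;> norm_num
    · have h18' : ∀ s : State, ((s.setReg 18 v18).setReg 19 (t + 1)).reg 18 = v18 := by
        intro s; simp
      rw [h18', hv18]
      have : (∀ t' < t + 1, ok t') ↔ (∀ t' < t, ok t') ∧ ok t :=
        ⟨fun h => ⟨fun t' ht' => h t' (by omega), h t (by omega)⟩, fun h t' ht' => by
          rcases Nat.lt_succ_iff_lt_or_eq.1 ht' with h' | rfl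
          exacts [h.1 _ h', h.2]⟩
      have e : ∀ (p q : Prop) [Decidable p] [Decidable q],
          ((if p then 1 else 0) * (if q then 1 else 0) : ℕ) = if p ∧ q then 1 else 0 := by
        intro p q _ _; split_ifs <;> simp_all
      exact (e _ _).trans (if_congr this.symm rfl rfl)
  · rintro s - ⟨h, -, h18⟩
    refine hQ s h ?_
    have : (∀ t' < k * k, ok t') ↔ Solves n k m (digit (total n k) x) := by
      constructor
      · intro h i hi j hj
        have := h (i * k + j) (mul_add_lt hi hj)
        simp only [hok] at this
        have e1 : (i * k + j) / k = i := by
          rw [mul_comm, Nat.mul_add_div (by omega), Nat.div_eq_of_lt hj, add_zero]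
        have e2 : (i * k + j) % k = j := by
          rw [mul_comm, Nat.mul_add_mod, Nat.mod_eq_of_lt hj]
        rwa [e1, e2] at this
      · intro h t ht
        exact h _ ((Nat.div_lt_iff_lt_mul (by omega)).2 ht) _ (Nat.mod_lt _ (by omega))
    split_ifs at h18 with hs
    exacts [.inl ⟨h18, this.1 hs⟩, .inr ⟨h18, fun h => hs (this.2 h)⟩]

theorem increment_spec {o : List (ℕ × ℕ)} {x : ℕ} (hk : 1 ≤ k) (hn : 2 * k ≤ n)
    (h : Searching n k m o x σ) (h31 : σ.reg 31 = 1) (h18 : σ.reg 18 = 0) {Q : State → Prop}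
    (hQ : ∀ s, Searching n k m o (x + 1) s → s.reg 18 = 0 →
      s.reg 31 = (if total n k ^ k ∣ x + 1 then 1 else 0) → Q s) :
    Hoare (wd n) (space n k) ω (.forTo 21 4 incBody) ⊤ σ Q := by
  have hNN := total_pos (n := n) hk
  refine Hoare.mono (Hoare.forTo (N := k) (T := ⊤) (by norm_num) (by norm_num)
    (I := fun i s => Params n k s ∧ s.reg 20 = k * k ∧ s.reg 21 = i ∧ s.reg 18 = 0 ∧ s.out = o ∧
      (∀ i < words n k + 2 * total n k, s.mem i = m i) ∧
      s.reg 31 = (if total n k ^ i ∣ x + 1 then 1 else 0) ∧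
      ∀ j < k, s.mem (words n k + 2 * total n k + j) =
        if j < i then digit (total n k) (x + 1) j else digit (total n k) x j) (Q := Q)
    ?_ ?_ ?_ ?_) le_top fun _ _ h => h
  · rintro i s ⟨h, -, h21, -⟩
    exact ⟨h21, h.r4⟩
  · intro hV
    exact ⟨h.params.setReg (by norm_num), by simp [h.r20], by simp, by simp [h18], h.out, h.mem,
      by simp [h31], fun j hj => by simp [h.dig j hj]⟩
  · rintro i hi s hV ⟨hP, h20, h21, h18, ho, hm, h31, hd⟩
    refine incBody_spec hk hn hV hP hi h21 h31 (by rw [hd i hi, if_neg (lt_irrefl _)]) ?_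
    intro v32
    refine ⟨by simp [h21], fun _ => ⟨?_, by simp [h20], by simp, by simp [h18], ho, ?_, by simp, ?_⟩⟩
    · exact (((hP.setReg (x := 32) (a := v32) (by norm_num)).setReg (x := 31)
        (a := if total n k ^ (i + 1) ∣ x + 1 then 1 else 0) (by norm_num)).setReg
        (x := 21) (a := i + 1) (by norm_num)).congr fun _ _ _ => rfl
    · intro j hj
      simp only [State.setReg_mem, State.setMem_mem]
      rw [if_neg (by omega), hm j hj]
    · intro j hj
      simp only [State.setReg_mem, State.setMem_mem]
      by_cases hji : j = i
      · subst hji; rw [if_pos rfl, if_pos (by omega)]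
      · rw [if_neg (by omega), hd j hj]
        exact if_congr (by omega) rfl rfl
  · rintro s - ⟨hP, h20, h21, h18, ho, hm, h31, hd⟩
    exact hQ s ⟨hP, h20, hm, fun j hj => by rw [hd j hj, if_pos hj], ho⟩ h18 h31

theorem search_spec {o : List (ℕ × ℕ)} (hk : 1 ≤ k) (hn : 2 * k ≤ n)
    (h : Searching n k m o 0 σ) (h17 : σ.reg 17 = 1) {Q : State → Prop}
    (hQ : ∀ x s, Searching n k m o x s → s.reg 18 = 1 → Solves n k m (digit (total n k) x) → Q s)
    (hQ' : ∀ s, s.out = o → s.reg 18 = 0 →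
      (∀ x < total n k ^ k, ¬ Solves n k m (digit (total n k) x)) → Q s) :
    Hoare (wd n) (space n k) ω (.whil (V 17) searchBody) ⊤ σ Q := by
  have hw := one_lt_two_pow_wd n
  have hN : 0 < total n k ^ k := pow_pos (total_pos hk) k
  -- The three alternatives are: still searching at x with no solution before it, stopped with a
  -- solution, and stopped after all tuples have failed. The variant matters only in the first.
  refine Hoare.mono (Hoare.whil (m := total n k ^ k) (T := ⊤) (e := V 17)
    (I := fun f s => (s.reg 17 = 1 ∧ ∃ x < total n k ^ k, f = total n k ^ k - x ∧
        Searching n k m o x s ∧ ∀ y < x, ¬ Solves n k m (digit (total n k) y)) ∨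
      (s.reg 17 = 0 ∧ s.reg 18 = 1 ∧ ∃ x, Searching n k m o x s ∧
        Solves n k m (digit (total n k) x)) ∨
      (s.reg 17 = 0 ∧ s.reg 18 = 0 ∧ s.out = o ∧
        ∀ x < total n k ^ k, ¬ Solves n k m (digit (total n k) x))) (Q := Q)
    ?_ ?_ ?_ ?_ ?_) le_top fun _ _ h => h
  · exact fun f s _ => (by norm_num : 17 < tmp)
  · rintro s (⟨-, x, hx, hf, -⟩ | h | h)
    · omega
    · exact h.1
    · exact h.1
  · rintro f s hI hne
    change s.reg 17 ≠ 0 at hne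
    obtain ⟨h17, x, hx, hf, hs, hno⟩ | h | h := hI
    rotate_left
    · exact absurd h.1 hne
    · exact absurd h.1 hne
    refine Hoare.of_valid fun hV => ?_
    refine Hoare.block_cons (Hoare.assign (.lit (by omega)) fun hV => ?_)
    replace hs := hs.setReg (y := 18) (a := 1) (by norm_num) (by norm_num)
    refine Hoare.block_cons (check_spec hk hn hs (by simp) fun s hs hc => ?_)
    refine Hoare.block_cons (Hoare.cond (by norm_num : 18 < tmp) (fun h => ?_) fun h => ?_)
    · change s.reg 18 ≠ 0 at h
      obtain ⟨h18, hsol⟩ | ⟨h18, -⟩ := hc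
      · refine Hoare.assign (.lit (by omega)) fun hV => Hoare.block_nil ⟨f, le_rfl, .inr (.inl ?_)⟩
        exact ⟨by simp, by simp [h18], x, hs.setReg (by norm_num) (by norm_num), hsol⟩
      · exact absurd h18 h
    · change s.reg 18 = 0 at h
      obtain ⟨h18, -⟩ | ⟨h18, hsol⟩ := hc
      · omega
      have hno' : ∀ y < x + 1, ¬ Solves n k m (digit (total n k) y) := by
        intro y hy
        rcases Nat.lt_succ_iff_lt_or_eq.1 hy with h' | rfl
        exacts [hno _ h', hsol]
      refine Hoare.block_cons (Hoare.assign (.lit (by omega)) fun hV => ?_)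
      refine Hoare.block_cons (increment_spec hk hn
        (hs.setReg (y := 31) (a := 1) (by norm_num) (by norm_num)) (by simp) (by simp [h18])
        fun s hs h18 h31 => ?_)
      refine Hoare.of_valid fun hV => ?_
      refine Hoare.block_cons (Hoare.assign (.eqOp (by omega) (.var hV (by norm_num) h31)
        (.lit (by omega))) fun hV => Hoare.block_nil (Hoare.block_nil ?_))
      -- A carry out of the last digit means that the search is exhausted.
      by_cases hdvd : total n k ^ k ∣ x + 1
      · have := Nat.le_of_dvd (by omega) hdvd
        refine ⟨f, le_rfl, .inr (.inr ⟨by simp [hdvd], by simp [h18], hs.out, ?_⟩)⟩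
        exact fun y hy => hno' y (by omega)
      · have : x + 1 ≠ total n k ^ k := fun h => hdvd (h ▸ dvd_rfl)
        exact ⟨f, le_rfl, .inl ⟨by simp [hdvd], x + 1, by omega, by omega,
          hs.setReg (by norm_num) (by norm_num), hno'⟩⟩
  · exact .inl ⟨h17, 0, hN, by omega, h, by simp⟩
  · rintro f s - hI hz
    change s.reg 17 = 0 at hz
    obtain ⟨h17, -⟩ | ⟨-, h18, x, hs, hsol⟩ | ⟨-, h18, ho, hno⟩ := hI
    · omega
    · exact hQ x s hs h18 hsol
    · exact hQ' s ho h18 hno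

theorem queryCmd_spec (hk : 1 ≤ k) (hn : 2 * k ≤ n) (hP : Params n k σ) (ho : σ.out = [])
    (hm : ∀ i < words n k + 2 * total n k, σ.mem i = m i)
    (hz : ∀ i, words n k + 2 * total n k ≤ i → σ.mem i = 0) :
    Hoare (wd n) (space n k) ω queryCmd ⊤ σ fun s =>
      (∃ d : ℕ → ℕ, (∀ i < k, d i < total n k) ∧ Solves n k m d ∧
        s.out = (List.range k).map fun i => (m (words n k + 2 * d i + 1) / n,
          m (words n k + 2 * d i + 1) % n)) ∨
      ((∀ d : ℕ → ℕ, (∀ i < k, d i < total n k) → ¬ Solves n k m d) ∧ s.out = []) := by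
  refine Hoare.of_valid fun hV => ?_
  have hw := one_lt_two_pow_wd n
  have hS := space_lt hk hn
  have hU : words n k + 2 * total n k + k = space n k := rfl
  have hkk := k_sq_le (n := n) hk
  have hN := total_pos (n := n) hk
  unfold queryCmd
  refine Hoare.block_cons (Hoare.assign (.lit (by omega)) fun hV => ?_)
  refine Hoare.block_cons (Hoare.assign (.lit (by omega)) fun hV => ?_)
  refine Hoare.block_cons (Hoare.assign (.mul (.var (v := k) hV (by norm_num) (by simp [hP.r4]))
    (.var (v := k) hV (by norm_num) (by simp [hP.r4])) (by omega)) fun hV => ?_)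
  refine Hoare.block_cons (search_spec hk hn ⟨((hP.setReg (by norm_num)).setReg
    (by norm_num)).setReg (by norm_num), by simp, hm, fun i hi => ?_, ho⟩ (by simp) ?_ ?_)
  -- The cells behind the sketch have never been written, so they already hold the digits of 0.
  · simp only [State.setReg_mem]
    rw [hz _ (by omega)]
    simp [digit]
  · intro x s hs h18 hsol
    have hdN : ∀ i < k, digit (total n k) x i < total n k := fun i _ => Nat.mod_lt _ hN
    refine Hoare.block_cons (Hoare.cond (by norm_num : 18 < tmp) (fun _ => ?_) fun h => ?_)
    · refine Hoare.mono (Hoare.forTo (N := k) (T := ⊤) (by norm_num) (by norm_num)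
        (I := fun i s => s.reg 21 = i ∧ Searching n k m ((List.range i).map fun i =>
          (m (words n k + 2 * digit (total n k) x i + 1) / n,
            m (words n k + 2 * digit (total n k) x i + 1) % n)) x s) ?_ ?_ ?_ ?_) le_top
        fun _ _ h => Hoare.block_nil h
      · exact fun i s h => ⟨h.1, h.2.params.r4⟩
      · exact fun _ => ⟨by simp, hs.setReg (by norm_num) (by norm_num)⟩
      · rintro i hi s hV ⟨h21, hs⟩
        have hdi := hdN i hi
        refine Hoare.block_cons (Hoare.assign
          (v := m (words n k + 2 * digit (total n k) x i + 1))
          (.ld hV (.add (.add (.var hV (by norm_num) hs.params.r14) (.mul (.lit (by omega))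
            (.ld hV (.add (.var hV (by norm_num) hs.params.r15) (.var hV (by norm_num) h21)
            (by omega)) (by omega) (hs.dig i hi)) (by omega)) (by omega)) (.lit (by omega))
            (by omega)) (by omega) (hs.mem _ (by omega))) fun hV => ?_)
        have hs' := hs.setReg (y := 25) (a := m (words n k + 2 * digit (total n k) x i + 1))
          (by norm_num) (by norm_num)
        have e1 := Ev.div (U := space n k) (.var (x := 25) hV (by norm_num) (by simp; rfl))
          (.var hV (by norm_num) hs'.params.r3)
        have e2 := Ev.mod (U := space n k) (.var (x := 25) hV (by norm_num) (by simp; rfl))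
          (.var hV (by norm_num) hs'.params.r3)
        refine Hoare.block_cons (Hoare.print e1.ok e1.eval e2.ok e2.eval fun _ => ?_)
        refine Hoare.block_nil ⟨by simp [h21], fun _ => ⟨by simp, ?_⟩⟩
        have hs'' := hs'.setReg (y := 21) (a := i + 1) (by norm_num) (by norm_num)
        refine ⟨hs''.params.congr fun _ _ _ => rfl, hs''.r20, hs''.mem, hs''.dig, ?_⟩
        simp [List.range_succ, hs.out]
      · exact fun s _ h => .inl ⟨_, hdN, hsol, h.2.out⟩
    · exact absurd h (by change s.reg 18 ≠ 0; omega)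
  · intro s ho h18 hno
    refine Hoare.block_cons (Hoare.cond (by norm_num : 18 < tmp) (fun h => ?_) fun _ => ?_)
    · exact absurd h18 h
    · refine Hoare.skip (Hoare.block_nil (.inr ⟨fun d hd hsol => ?_, ho⟩))
      obtain ⟨x, hx, hdx⟩ := exists_digits hN d k hd
      refine hno x hx fun i hi j hj => ?_
      rw [hdx i hi, hdx j hj]
      exact hsol i hi j hj

end

/-! ### Runs of the algorithm -/

theorem legalFrom_append {n : ℕ} (E : Finset (Sym2 (Fin n))) (S : List (EdgeUpdate n))
    (e : EdgeUpdate n) : LegalFrom E (S ++ [e]) ↔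
      LegalFrom E S ∧ e.Admissible (S.foldl (fun E e => e.apply E) E) := by
  induction S generalizing E with
  | nil => simp [LegalFrom]
  | cons a S ih => simp [LegalFrom, ih, and_assoc]

/-- The edges of the graph that is described by a stream. -/
def streamEdges {n : ℕ} (S : List (EdgeUpdate n)) : Finset (Sym2 (Fin n)) :=
  S.foldl (fun E e => e.apply E) ∅

theorem streamEdges_append {n : ℕ} (S : List (EdgeUpdate n)) (e : EdgeUpdate n) :
    streamEdges (S ++ [e]) = e.apply (streamEdges S) := by
  simp [streamEdges]

/-- The number of an edge. -/
def edgeNum {n : ℕ} (e : Sym2 (Fin n)) : ℕ := (e.inf : ℕ) * n + e.sup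

theorem edgeNum_div {n : ℕ} (e : Sym2 (Fin n)) : edgeNum e / n = e.inf := by
  have := e.sup.isLt
  unfold edgeNum
  rw [mul_comm, Nat.mul_add_div (by omega), Nat.div_eq_of_lt this, add_zero]

theorem edgeNum_mod {n : ℕ} (e : Sym2 (Fin n)) : edgeNum e % n = e.sup := by
  unfold edgeNum
  rw [mul_comm, Nat.mul_add_mod, Nat.mod_eq_of_lt e.sup.isLt]

theorem edgeNum_lt {n : ℕ} (e : Sym2 (Fin n)) : edgeNum e < n * n :=
  mul_add_lt e.inf.isLt e.sup.isLt

theorem mem_iff_inf_sup {α : Type*} [LinearOrder α] (e : Sym2 α) (x : α) :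
    x ∈ e ↔ x = e.inf ∨ x = e.sup := by
  induction e with
  | h a b =>
    rcases le_total a b with h | h <;> simp [h, or_comm]

theorem eq_mk_inf_sup {α : Type*} [LinearOrder α] (e : Sym2 α) : e = s(e.inf, e.sup) := by
  induction e with
  | h a b =>
    rcases le_total a b with h | h <;> simp [h, Sym2.eq_swap]

theorem disjointEdges_iff {n : ℕ} (e f : Sym2 (Fin n)) :
    DisjointEdges n (edgeNum e) (edgeNum f) ↔ ∀ x, ¬ (x ∈ e ∧ x ∈ f) := by
  simp only [DisjointEdges, edgeNum_div, edgeNum_mod, mem_iff_inf_sup, ne_eq, Fin.val_inj]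
  constructor
  · rintro ⟨h1, h2, h3, h4⟩ x ⟨rfl | rfl, h | h⟩ <;> contradiction
  · intro h
    refine ⟨fun h1 => h _ ⟨.inl rfl, .inl h1⟩, fun h1 => h _ ⟨.inl rfl, .inr h1⟩,
      fun h1 => h _ ⟨.inr rfl, .inl h1⟩, fun h1 => h _ ⟨.inr rfl, .inr h1⟩⟩

section

variable {n k : ℕ} {r : ℕ → ℕ}

/-- The number of pairs of a sampler and an edge in the class `c`. -/
def hits (n k : ℕ) (r : ℕ → ℕ) (e : Sym2 (Fin n)) (c : ℕ) : ℕ :=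
  ((Finset.range (jj n)).filter fun j => addr n k r j e.inf e.sup = c).card

theorem incr_eq {R : Type} [CommRing R] (e : Sym2 (Fin n)) (x : R) (c : ℕ) :
    incr n k r (jj n) e.inf e.sup x c = hits n k r e c * x := by
  unfold incr hits
  rw [Finset.sum_ite, Finset.sum_const_zero, add_zero, Finset.sum_const, nsmul_eq_mul]

/-- The invariant of the processing of a stream. -/
structure Reading (R : Type) [CommRing R] (n k : ℕ) (r : ℕ → ℕ) (E : Finset (Sym2 (Fin n)))
    (s : State) : Prop where
  params : Params n k s
  sketch : Sketch n k r (fun c => ∑ e ∈ E, (hits n k r e c : R))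
    (fun c => ∑ e ∈ E, (hits n k r e c * edgeNum e : R)) s.mem

end

/-- The streaming algorithm. -/
def alg : StreamingAlgorithm where
  preprocess := preprocessCmd
  update := updateCmd
  query := queryCmd
  wordFactor := 128
  wordFactor_pos := by norm_num

theorem alg_wordLength (n : ℕ) : alg.wordLength n = wd n := by
  unfold StreamingAlgorithm.wordLength alg wd lg; rfl

/-- Transport of random words along an equality of word lengths. -/
def castWords {w w' : ℕ} (h : w = w') (ω : ℕ → Fin (2 ^ w)) : ℕ → Fin (2 ^ w') :=
  fun i => Fin.cast (by rw [h]) (ω i)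

/-- The random words that are drawn. -/
def drawnWords {m : ℕ} (ω : ℕ → Fin m) (i : ℕ) : ℕ := ω i

theorem drawnWords_castWords {w w' : ℕ} (h : w = w') (ω : ℕ → Fin (2 ^ w)) :
    (fun i => (castWords h ω i : ℕ)) = drawnWords ω := rfl

theorem exec_castWords {w w' : ℕ} (h : w = w') {ω : ℕ → Fin (2 ^ w)} {c : Cmd} {s s' : State}
    {t : ℕ} (he : Exec w' (castWords h ω) c s t s') : Exec w ω c s t s' := by
  subst h; exact he

/-! ### The invariant along a stream -/

section

variable {n k : ℕ}

theorem apply_lt {n : ℕ} {S : List (EdgeUpdate n)} :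
    ∀ e ∈ streamEdges S, e.inf < e.sup := by
  induction S using List.reverseRecOn with
  | nil => simp [streamEdges]
  | append_singleton S a ih =>
    intro e he
    rw [streamEdges_append, EdgeUpdate.apply] at he
    split_ifs at he
    · rcases Finset.mem_insert.1 he with rfl | h
      · have := a.lt
        simp [EdgeUpdate.edge, this.le, this]
      · exact ih e h
    · exact ih e (Finset.mem_of_mem_erase he)

/-- By linearity the sketch depends only on the random words and the current edge set. Legality of
the stream enters here: inserting an absent edge or erasing a present one changes the sum over the
edge set by exactly one term. -/
theorem reads {R : Type} [CommRing R] (hRz : ((2 ^ wd n : ℕ) : R) = 0) (hk : 1 ≤ k)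
    (hn : 2 * k ≤ n) (ω : ℕ → Fin (2 ^ alg.wordLength n)) (S : List (EdgeUpdate n)) (hS : IsGraphStream S) :
    ∃ T s σ, alg.Reads k ω S T s ∧ T ≤ updateTime n ∧ Matches (wd n) (space n k) s σ ∧
      Reading R n k (drawnWords ω) (streamEdges S) σ := by
  have hkn : k < 2 ^ wd n ∧ n < 2 ^ wd n := by
    have := sq_mul_le hk hn
    constructor <;> nlinarith
  induction S using List.reverseRecOn with
  | nil =>
    have hM : Matches (wd n) (space n k) (StreamingAlgorithm.start n k)
        (StreamingAlgorithm.start n k) := by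
      refine ⟨fun _ _ => rfl, rfl, rfl, rfl, Nat.zero_le _, fun x => ?_, fun i => ?_⟩
      · simp only [StreamingAlgorithm.start, Function.update_apply]
        split_ifs
        exacts [hkn.1, hkn.2, by positivity]
      · simp only [StreamingAlgorithm.start]; positivity
    obtain ⟨t, s', σ', -, he, hm, hP, hs⟩ :=
      preprocessCmd_spec (R := R) (ω := castWords (alg_wordLength n) ω) hk hn _ hM
    refine ⟨0, s', σ', .nil (exec_castWords _ he), Nat.zero_le _, hm, hP, ?_⟩
    have h0 : streamEdges ([] : List (EdgeUpdate n)) = ∅ := rfl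
    rw [drawnWords_castWords] at hs
    rw [h0]
    simp only [Finset.sum_empty]
    exact hs
  | append_singleton S e ih =>
    obtain ⟨hleg, hadm⟩ := (legalFrom_append _ _ _).1 hS
    obtain ⟨T, s, σ, hr, hT, hm, hP, hs⟩ := ih hleg
    have hm' : Matches (wd n) (space n k) (StreamingAlgorithm.feed s e)
        (StreamingAlgorithm.feed σ e) := by
      refine Matches.setReg (Matches.setReg (Matches.setReg hm ?_) ?_) ?_
      · exact e.u.isLt.trans hkn.2
      · exact e.v.isLt.trans hkn.2
      · split_ifs
        exacts [hk.trans_lt hkn.1, (Nat.zero_le k).trans_lt hkn.1]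
    have hP' : Params n k (StreamingAlgorithm.feed σ e) :=
      ((hP.setReg (by norm_num)).setReg (by norm_num)).setReg (by norm_num)
    obtain ⟨t, s', σ', ht, he, hm₂, hP₂, hs₂⟩ :=
      updateCmd_spec (u := e.u) (v := e.v) (b := e.isInsert) (σ := StreamingAlgorithm.feed σ e)
        (ω := castWords (alg_wordLength n) ω) hRz hk hn hP' hs
        (by simp [StreamingAlgorithm.feed]) (by simp [StreamingAlgorithm.feed])
        (by simp [StreamingAlgorithm.feed]) e.u.isLt e.v.isLt _ hm'
    refine ⟨_, s', σ', hr.snoc (exec_castWords _ he), max_le hT (by exact_mod_cast ht), hm₂, hP₂,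
      ?_⟩
    have hi : e.edge.inf = e.u := by simp [EdgeUpdate.edge, e.lt.le]
    have hp : e.edge.sup = e.v := by simp [EdgeUpdate.edge, e.lt.le]
    rw [← hi, ← hp] at hs₂
    simp only [incr_eq] at hs₂
    rw [streamEdges_append]
    unfold EdgeUpdate.Admissible at hadm
    unfold EdgeUpdate.apply
    change if e.isInsert then e.edge ∉ streamEdges S else e.edge ∈ streamEdges S at hadm
    change Sketch n k _ _ _ _ at hs₂
    split_ifs at hadm hs₂ ⊢ with hb
    · convert hs₂ using 2 with c c
      · rw [Finset.sum_insert hadm]; ring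
      · rw [Finset.sum_insert hadm]; unfold edgeNum; ring
    · convert hs₂ using 2 with c c
      · rw [← Finset.sum_erase_add _ _ hadm]; ring
      · rw [← Finset.sum_erase_add _ _ hadm]; unfold edgeNum; ring

end

/-! ### Recovering edges and matchings from the sketch -/

section

variable {n k : ℕ} {r : ℕ → ℕ} {E : Finset (Sym2 (Fin n))} {σ : State}

theorem jj_mul_lt (hn : 2 ≤ n) : n * n * jj n < 2 ^ wd n := by
  have h4 := four_le_two_pow_lg hn
  have hL := (lt_two_pow_lg n).le
  have hD := dd_le hn
  rw [two_pow_wd]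
  unfold jj
  generalize 2 ^ lg n = L at *
  generalize dd n = D at *
  calc n * n * (D * D * D * D * D) ≤ L * L * (L ^ 6 * L ^ 6 * L ^ 6 * L ^ 6 * L ^ 6) := by gcongr
    _ = L ^ 32 := by ring
    _ < L ^ 128 := Nat.pow_lt_pow_right (by omega) (by norm_num)

theorem hits_le (e : Sym2 (Fin n)) (c : ℕ) : hits n k r e c ≤ jj n :=
  (Finset.card_filter_le _ _).trans (by simp)

theorem card_edges_le : E.card ≤ n * n := by
  have h : Function.Surjective (fun p : Fin n × Fin n => s(p.1, p.2)) := by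
    intro e
    induction e with
    | h a b => exact ⟨(a, b), rfl⟩
  calc E.card ≤ Fintype.card (Sym2 (Fin n)) := Finset.card_le_univ E
    _ ≤ Fintype.card (Fin n × Fin n) := Fintype.card_le_of_surjective _ h
    _ = n * n := by simp

theorem sum_hits_lt (hn : 2 ≤ n) (c : ℕ) : ∑ e ∈ E, hits n k r e c < 2 ^ wd n := by
  refine lt_of_le_of_lt ?_ (jj_mul_lt hn)
  calc ∑ e ∈ E, hits n k r e c ≤ ∑ _e ∈ E, jj n := Finset.sum_le_sum fun e _ => hits_le e c
    _ = E.card * jj n := by simp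
    _ ≤ n * n * jj n := Nat.mul_le_mul_right _ card_edges_le

theorem eq_of_cast_eq {R : Type} [CommRing R] {m a b : ℕ} [CharP R m] (ha : a < m) (hb : b < m)
    (h : (a : R) = b) : a = b := by
  rw [CharP.natCast_eq_natCast R m] at h
  exact h.eq_of_lt_of_lt ha hb

/-- Both sides are below 2 ^ w, so their equality modulo 2 ^ w is an equality of numbers. The
counters can therefore be trusted with certainty. -/
theorem Reading.cnt_eq {R : Type} [CommRing R] [CharP R (2 ^ wd n)] (h : Reading R n k r E σ)
    (hn : 2 ≤ n) (hV : Valid (wd n) σ) {c : ℕ} (hc : c < total n k) :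
    σ.mem (words n k + 2 * c) = ∑ e ∈ E, hits n k r e c := by
  refine eq_of_cast_eq (R := R) (hV.mem _) (sum_hits_lt hn c) ?_
  rw [h.sketch.cnt c hc]
  push_cast
  rfl

theorem exists_unique_hit {c : ℕ} (h1 : ∑ e ∈ E, hits n k r e c = 1) :
    ∃ e ∈ E, hits n k r e c = 1 ∧ ∀ f ∈ E, f ≠ e → hits n k r f c = 0 := by
  obtain ⟨e, he, hne⟩ := Finset.exists_ne_zero_of_sum_ne_zero (by rw [h1]; exact one_ne_zero)
  have := Finset.add_sum_erase _ (fun e => hits n k r e c) he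
  simp only [h1] at this
  have hz : ∑ x ∈ E.erase e, hits n k r x c = 0 := by omega
  rw [Finset.sum_eq_zero_iff] at hz
  exact ⟨e, he, by omega, fun f hf hfe => hz f (Finset.mem_erase.2 ⟨hfe, hf⟩)⟩

/-- With only one contribution the stored sum is congruent to the number of that edge, and this
number is below n * n, hence a word. -/
theorem Reading.sum_eq {R : Type} [CommRing R] [CharP R (2 ^ wd n)] (h : Reading R n k r E σ)
    (hk : 1 ≤ k) (hn : 2 * k ≤ n) (hV : Valid (wd n) σ) {c : ℕ} (hc : c < total n k)
    (h1 : ∑ e ∈ E, hits n k r e c = 1) :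
    ∃ e ∈ E, hits n k r e c = 1 ∧ σ.mem (words n k + 2 * c + 1) = edgeNum e := by
  obtain ⟨e, he, h1, h0⟩ := exists_unique_hit h1
  refine ⟨e, he, h1, eq_of_cast_eq (R := R) (hV.mem _) ?_ ?_⟩
  · refine (edgeNum_lt e).trans_le ?_
    have := sq_mul_le hk hn
    nlinarith
  · rw [h.sketch.sum c hc, Finset.sum_eq_single_of_mem e he fun f hf hfe => by rw [h0 f hf hfe]; simp,
      h1]
    simp

/-- The random words `r` are good if some classes contain the edges of a `k`-matching, each class
exactly one edge. -/
def Good (n k : ℕ) (r : ℕ → ℕ) (E : Finset (Sym2 (Fin n))) : Prop :=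
  ∃ (d : ℕ → ℕ) (e : ℕ → Sym2 (Fin n)),
    (∀ i < k, d i < total n k ∧ e i ∈ E ∧ hits n k r (e i) (d i) = 1 ∧
      ∑ f ∈ E, hits n k r f (d i) = 1) ∧
    ∀ i < k, ∀ j < k, i ≠ j → ∀ x, ¬ (x ∈ e i ∧ x ∈ e j)

theorem Reading.solves_of_good {R : Type} [CommRing R] [CharP R (2 ^ wd n)]
    (h : Reading R n k r E σ) (hk : 1 ≤ k) (hn : 2 * k ≤ n) (hV : Valid (wd n) σ)
    (hg : Good n k r E) : ∃ d : ℕ → ℕ, (∀ i < k, d i < total n k) ∧ Solves n k σ.mem d := by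
  obtain ⟨d, e, he, hd⟩ := hg
  have key : ∀ i < k, σ.mem (words n k + 2 * d i + 1) = edgeNum (e i) := by
    intro i hi
    obtain ⟨hlt, hE, h1, hs⟩ := he i hi
    obtain ⟨f, hf, hf1, hfe⟩ := h.sum_eq hk hn hV hlt hs
    obtain ⟨f', hf', -, hu⟩ := exists_unique_hit hs
    have e1 : e i = f' := by
      by_contra hne
      rw [hu _ hE hne] at h1
      omega
    have e2 : f = f' := by
      by_contra hne
      rw [hu _ hf hne] at hf1
      omega
    rw [hfe, e1, e2]
  refine ⟨d, fun i hi => (he i hi).1, fun i hi j hj => ⟨?_, ?_⟩⟩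
  · rw [h.cnt_eq (by omega) hV (he i hi).1, (he i hi).2.2.2]
  · by_cases hij : i = j
    · exact .inl hij
    · right
      rw [key i hi, key j hj, disjointEdges_iff]
      exact hd i hi j hj hij

/-- Nothing is assumed about the random words: whatever the search accepts consists of genuine,
disjoint edges. This makes the error one-sided. -/
theorem exists_matching {R : Type} [CommRing R] [CharP R (2 ^ wd n)] {S : List (EdgeUpdate n)}
    (h : Reading R n k r (streamEdges S) σ) (hk : 1 ≤ k) (hn : 2 * k ≤ n) (hV : Valid (wd n) σ)
    {d : ℕ → ℕ} (hd : ∀ i < k, d i < total n k) (hs : Solves n k σ.mem d) :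
    ∃ M, IsKMatching (streamGraph S) k M ∧ StreamingAlgorithm.ListsEdges
      ((List.range k).map fun i => (σ.mem (words n k + 2 * d i + 1) / n,
        σ.mem (words n k + 2 * d i + 1) % n)) M := by
  have hex : ∀ i, ∃ e : Sym2 (Fin n), i < k → e ∈ streamEdges S ∧
      σ.mem (words n k + 2 * d i + 1) = edgeNum e := by
    intro i
    by_cases hi : i < k
    · have h1 := (hs i hi i hi).1
      rw [h.cnt_eq (by omega) hV (hd i hi)] at h1
      obtain ⟨e, he, -, heq⟩ := h.sum_eq hk hn hV (hd i hi) h1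
      exact ⟨e, fun _ => ⟨he, heq⟩⟩
    · exact ⟨s(⟨0, by omega⟩, ⟨0, by omega⟩), fun h => absurd h hi⟩
  choose e he using hex
  have hdis : ∀ i < k, ∀ j < k, i ≠ j → ∀ x, ¬ (x ∈ e i ∧ x ∈ e j) := by
    intro i hi j hj hij
    have := ((hs i hi j hj).2).resolve_left hij
    rwa [(he i hi).2, (he j hj).2, disjointEdges_iff] at this
  refine ⟨(Finset.range k).image e, ⟨⟨?_, ?_⟩, ?_⟩, ?_⟩
  · intro f hf
    obtain ⟨i, hi, rfl⟩ := Finset.mem_image.1 hf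
    have hmem := (he i (Finset.mem_range.1 hi)).1
    have hlt := apply_lt _ hmem
    rw [streamGraph, SimpleGraph.edgeSet_fromEdgeSet]
    refine ⟨Finset.mem_coe.2 hmem, fun hdiag => ?_⟩
    generalize e i = f at *
    induction f with
    | h a b =>
      have : a = b := hdiag
      simp [this] at hlt
  · intro f hf f' hf' hne
    obtain ⟨i, hi, rfl⟩ := Finset.mem_image.1 hf
    obtain ⟨j, hj, rfl⟩ := Finset.mem_image.1 hf'
    exact hdis i (Finset.mem_range.1 hi) j (Finset.mem_range.1 hj) fun h => hne (by rw [h])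
  · rw [Finset.card_image_of_injOn, Finset.card_range]
    intro i hi j hj hij
    by_contra hne
    refine hdis i (by simpa using hi) j (by simpa using hj) hne (e i).inf ⟨?_, ?_⟩
    · exact (mem_iff_inf_sup _ _).2 (.inl rfl)
    · rw [← hij]; exact (mem_iff_inf_sup _ _).2 (.inl rfl)
  · unfold StreamingAlgorithm.ListsEdges
    ext z
    simp only [List.map_map, List.mem_toFinset, List.mem_map, List.mem_range, Function.comp,
      Finset.mem_image, Finset.mem_range]
    have hval : ∀ i < k, s(σ.mem (words n k + 2 * d i + 1) / n,
        σ.mem (words n k + 2 * d i + 1) % n) = Sym2.map Fin.val (e i) := by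
      intro i hi
      rw [(he i hi).2, edgeNum_div, edgeNum_mod]
      conv_rhs => rw [eq_mk_inf_sup (e i), Sym2.map_mk]
    constructor
    · rintro ⟨i, hi, rfl⟩
      exact ⟨_, ⟨i, hi, rfl⟩, (hval i hi).symm⟩
    · rintro ⟨_, ⟨i, hi, rfl⟩, rfl⟩
      exact ⟨i, hi, hval i hi⟩

/-- The existential hides `ZMod m`, as only the characteristic of the ring matters. -/
theorem exists_charP (m : ℕ) : ∃ (R : Type) (_ : CommRing R), CharP R m :=
  ⟨ZMod m, inferInstance, inferInstance⟩

theorem run (hk : 1 ≤ k) (hn : 2 * k ≤ n) (ω : ℕ → Fin (2 ^ alg.wordLength n))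
    (S : List (EdgeUpdate n)) (hS : IsGraphStream S) :
    ∃ T B M, alg.Outputs k S ω T B M ∧ B ≤ (alg.numRegs + space n k) * wd n ∧
      T ≤ updateTime n ∧ (IsKMatching (streamGraph S) k M ∨
        M = ∅ ∧ ¬ Good n k (drawnWords ω) (streamEdges S)) := by
  obtain ⟨R, _, _⟩ := exists_charP (2 ^ wd n)
  obtain ⟨T, s, σ, hr, hT, hm, hR⟩ := reads (R := R) (CharP.cast_eq_zero R _) hk hn ω S hS
  have hm' : Matches (wd n) (space n k) { s with out := [] } { σ with out := [] } :=
    ⟨hm.reg, hm.mem, hm.drawn, rfl, hm.used, hm.regLt, hm.memLt⟩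
  obtain ⟨t, s', σ', -, he, hm₂, hQ⟩ := queryCmd_spec (ω := castWords (alg_wordLength n) ω)
    (σ := { σ with out := [] }) (m := σ.mem) hk hn (hR.params.congr fun _ _ _ => rfl) rfl
    (fun _ _ => rfl) hR.sketch.zero _ hm'
  have hB : (alg.numRegs + s'.used) * alg.wordLength n ≤ (alg.numRegs + space n k) * wd n := by
    rw [alg_wordLength]
    exact Nat.mul_le_mul_right _ (Nat.add_le_add_left hm₂.used _)
  rcases hQ with ⟨d, hd, hs, ho⟩ | ⟨hno, ho⟩
  · obtain ⟨M, hM, hl⟩ := exists_matching hR hk hn hm.valid hd hs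
    refine ⟨T, _, M, ⟨s, s', t, hr, exec_castWords _ he, ?_, rfl⟩, hB, hT, .inl hM⟩
    rw [hm₂.out, ho]
    exact hl
  · refine ⟨T, _, ∅, ⟨s, s', t, hr, exec_castWords _ he, ?_, rfl⟩, hB, hT, .inr ⟨rfl, fun hg => ?_⟩⟩
    · rw [hm₂.out, ho]
      simp [StreamingAlgorithm.ListsEdges]
    · obtain ⟨d, hd, hs⟩ := hR.solves_of_good hk hn hm.valid hg
      exact hno d hd hs

end

/-! ### Counting lemmas for linear hashing -/

open Finset in
-- As α runs below m, the progression α * z + B meets at most z + 1 consecutive blocks of length m.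
-- In each block the α that land in the initial segment of length θ lie in an interval of θ / z + 1
-- integers. No primality of m is needed.
theorem card_mul_add_mod_lt (m z B θ : ℕ) (hz : 1 ≤ z) :
    #{α ∈ range m | (α * z + B) % m < θ} ≤ 2 * θ + z + 1 := by
  have hfib : ∀ t ∈ Icc (B / m) (B / m + z),
      #{α ∈ {α ∈ range m | (α * z + B) % m < θ} | (α * z + B) / m = t} ≤ θ / z + 1 := by
    intro t _
    set F := {α ∈ {α ∈ range m | (α * z + B) % m < θ} | (α * z + B) / m = t} with hF
    rcases F.eq_empty_or_nonempty with h0 | h0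
    · simp [h0]
    · set a := F.min' h0
      have ha := F.min'_mem h0
      have hsub : F ⊆ Icc a (a + θ / z) := by
        intro b hb
        have hab := F.min'_le b hb
        simp only [hF, mem_filter] at ha hb
        have h1 := Nat.div_add_mod (a * z + B) m
        have h2 := Nat.div_add_mod (b * z + B) m
        rw [show (a * z + B) / m = t from ha.2] at h1
        rw [hb.2] at h2
        refine mem_Icc.2 ⟨hab, ?_⟩
        have h3 : (b - a) * z ≤ θ := by
          rw [Nat.sub_mul]; omega
        have := (Nat.le_div_iff_mul_le hz).2 h3
        omega
      calc #F ≤ #(Icc a (a + θ / z)) := card_le_card hsub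
        _ = θ / z + 1 := by rw [Nat.card_Icc]; generalize θ / z = t; omega
  have hmaps : ∀ α ∈ ({α ∈ range m | (α * z + B) % m < θ} : Finset ℕ),
      (α * z + B) / m ∈ Icc (B / m) (B / m + z) := by
    intro α hα
    simp only [mem_filter, mem_range] at hα
    refine mem_Icc.2 ⟨Nat.div_le_div_right (by omega), ?_⟩
    calc (α * z + B) / m ≤ (B + m * z) / m := by
          apply Nat.div_le_div_right
          have := Nat.mul_le_mul_right z hα.1.le
          omega
      _ = B / m + z := Nat.add_mul_div_left _ _ (by omega)
  have := card_le_mul_card_image_of_maps_to hmaps _ hfib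
  have hc : #(Icc (B / m) (B / m + z)) = z + 1 := by
    rw [Nat.card_Icc]; generalize B / m = t; omega
  rw [hc] at this
  have hdz := Nat.div_mul_le_self θ z
  have hdz' : θ / z ≤ θ := Nat.div_le_self _ _
  nlinarith

/-- Two residues in the same interval differ by less than c, so α * (y - x) + c is below 2 * c
modulo m. The count above then applies with threshold 2 * c. -/
theorem card_collision_le {m c x y : ℕ} (hxy : x < y) (hyc : y < c) :
    ((Finset.range m).filter fun α => α * x % m / c = α * y % m / c).card ≤ 5 * c := by
  have h := card_mul_add_mod_lt m (y - x) c (2 * c) (by omega)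
  refine (Finset.card_le_card fun α hα => ?_).trans (h.trans (by omega))
  simp only [Finset.mem_filter, Finset.mem_range] at hα ⊢
  refine ⟨hα.1, ?_⟩
  have hm : 0 < m := by omega
  have hc : 0 < c := by omega
  set P := α * x % m with hP
  set Q := α * y % m with hQ
  have hPQ := hα.2
  have h1 := Nat.div_add_mod P c
  have h2 := Nat.div_add_mod Q c
  have h3 := Nat.mod_lt P hc
  have h4 := Nat.mod_lt Q hc
  rw [hPQ] at h1
  have hlt : Q + c - P < 2 * c := by omega
  have hmod : (α * (y - x) + c) ≡ Q + c - P [MOD m] := by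
    refine Nat.ModEq.add_right_cancel' P ?_
    have e1 : Q + c - P + P = Q + c := by omega
    rw [e1]
    have e2 : α * (y - x) + c + α * x = α * y + c := by
      have : α * (y - x) + α * x = α * y := by rw [← mul_add]; congr 1; omega
      omega
    calc α * (y - x) + c + P ≡ α * (y - x) + c + α * x [MOD m] :=
          Nat.ModEq.add_left _ (Nat.mod_modEq _ _)
      _ = α * y + c := e2
      _ ≡ Q + c [MOD m] := Nat.ModEq.add_right _ (Nat.mod_modEq _ _).symm
  calc (α * (y - x) + c) % m = (Q + c - P) % m := hmod
    _ ≤ Q + c - P := Nat.mod_le _ _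
    _ < 2 * c := hlt

open Finset in
theorem card_not_injOn_le {m c n : ℕ} (V : Finset ℕ) (hV : ∀ x ∈ V, x < n) (hn : n ≤ c) :
    #{α ∈ range m | ¬ Set.InjOn (fun x => α * x % m / c) V} ≤ #V * #V * (5 * c) := by
  classical
  have hsub : ({α ∈ range m | ¬ Set.InjOn (fun x => α * x % m / c) V} : Finset ℕ) ⊆
      ((V ×ˢ V).filter fun p => p.1 < p.2).biUnion fun p =>
        {α ∈ range m | α * p.1 % m / c = α * p.2 % m / c} := by
    intro α hα
    simp only [mem_filter] at hα
    obtain ⟨hα, hinj⟩ := hα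
    simp only [Set.InjOn, not_forall] at hinj
    obtain ⟨x, hx, y, hy, hxy, hne⟩ := hinj
    simp only [mem_biUnion, mem_filter, mem_product]
    rcases lt_or_gt_of_ne hne with h | h
    · exact ⟨(x, y), ⟨⟨hx, hy⟩, h⟩, hα, hxy⟩
    · exact ⟨(y, x), ⟨⟨hy, hx⟩, h⟩, hα, hxy.symm⟩
  refine (card_le_card hsub).trans ((card_biUnion_le_card_mul _ _ (5 * c) ?_).trans ?_)
  · intro p hp
    simp only [mem_filter, mem_product] at hp
    exact card_collision_le hp.2 ((hV _ hp.1.2).trans_le hn)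
  · refine Nat.mul_le_mul_right _ ((card_filter_le _ _).trans ?_)
    rw [card_product]

open Finset in
-- A residue class has at most m / K + 1 members; the rounding accounts for the factor 2.
theorem card_mod_eq_le {m K v : ℕ} (hKm : K ≤ m) :
    K * #{a ∈ range m | a % K = v} ≤ 2 * m := by
  have h1 : #{a ∈ range m | a % K = v} ≤ m / K + 1 := by
    have hmaps : Set.InjOn (fun a => a / K) ({a ∈ range m | a % K = v} : Finset ℕ) := by
      intro a ha b hb hab
      simp only [coe_filter, Set.mem_ofPred_eq] at ha hb
      have h1 := Nat.div_add_mod a K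
      have h2 := Nat.div_add_mod b K
      simp only at hab
      rw [← h1, ← h2, hab, ha.2, hb.2]
    calc _ ≤ #(range (m / K + 1)) := card_le_card_of_injOn (fun a => a / K) (fun a ha => by
          simp only [coe_filter, Set.mem_ofPred_eq, mem_range] at ha
          simp only [coe_range, Set.mem_Iio]
          exact Nat.lt_succ_of_le (Nat.div_le_div_right ha.1.le)) hmaps
      _ = _ := card_range _
  have := Nat.mul_div_le m K
  nlinarith

open Finset in
theorem card_shift_lt {m : ℕ} (s : ℕ) {θ : ℕ} (hθ : θ ≤ m) :
    #{β ∈ range m | (s + β) % m < θ} = θ := by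
  have h := Nat.filter_Ico_card_eq_of_periodic (n := s) (a := m) (p := fun x => x % m < θ)
    (fun x => by simp)
  rw [Nat.count_eq_card_filter_range] at h
  have h1 : #{x ∈ range m | x % m < θ} = θ := by
    have : ({x ∈ range m | x % m < θ} : Finset ℕ) = range θ := by
      ext x
      simp only [mem_filter, mem_range]
      constructor
      · rintro ⟨hx, h⟩; rwa [Nat.mod_eq_of_lt hx] at h
      · intro h; exact ⟨by omega, by rwa [Nat.mod_eq_of_lt (by omega)]⟩
    rw [this, card_range]
  rw [h1] at h
  refine Eq.trans ?_ h
  refine card_bij (fun β _ => s + β) ?_ ?_ ?_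
  · intro β hβ
    simp only [mem_filter, mem_range, mem_Ico] at hβ ⊢
    exact ⟨by omega, hβ.2⟩
  · intro a _ b _ hab; omega
  · intro b hb
    simp only [mem_filter, mem_Ico] at hb
    exact ⟨b - s, by simp only [mem_filter, mem_range]; exact ⟨by omega, by
      rw [Nat.add_sub_cancel' hb.1.1]; exact hb.2⟩, by omega⟩

open Finset in
-- Approximate pairwise independence. Fix the residue B of the first value, for which there are θ
-- choices. The multiplier then determines the shift, and it must satisfy a condition of the form
-- counted in `card_mul_add_mod_lt` with z = f - e < θ.
theorem card_pair_lt {m e f θ : ℕ} (hef : e < f) (hfθ : f < θ) :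
    #{p ∈ range m ×ˢ range m | (p.1 * e + p.2) % m < θ ∧ (p.1 * f + p.2) % m < θ} ≤
      3 * θ * θ := by
  have hmaps : ∀ p ∈ ({p ∈ range m ×ˢ range m | (p.1 * e + p.2) % m < θ ∧
      (p.1 * f + p.2) % m < θ} : Finset (ℕ × ℕ)), (p.1 * e + p.2) % m ∈ range θ := by
    intro p hp
    simp only [mem_filter] at hp
    exact mem_range.2 hp.2.1
  refine (card_le_mul_card_image_of_maps_to hmaps (3 * θ) ?_).trans (by rw [card_range])
  intro B hB
  have hBθ := mem_range.1 hB
  refine le_trans ?_ ((card_mul_add_mod_lt m (f - e) B θ (by omega)).trans (by omega))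
  refine card_le_card_of_injOn Prod.fst ?_ ?_
  · intro p hp
    simp only [coe_filter, mem_product, mem_range, Set.mem_ofPred_eq, mem_filter] at hp ⊢
    obtain ⟨⟨⟨h1, h2⟩, h3, h4⟩, h5⟩ := hp
    refine ⟨h1, ?_⟩
    have : p.1 * (f - e) + B ≡ p.1 * f + p.2 [MOD m] := by
      rw [← h5]
      calc p.1 * (f - e) + (p.1 * e + p.2) % m ≡ p.1 * (f - e) + (p.1 * e + p.2) [MOD m] :=
            Nat.ModEq.add_left _ (Nat.mod_modEq _ _)
        _ = p.1 * f + p.2 := by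
            rw [← add_assoc, ← mul_add]; congr 2; omega
    rw [show (p.1 * (f - e) + B) % m = _ from this]
    exact h4
  · intro p hp q hq hpq
    simp only [coe_filter, mem_product, mem_range, Set.mem_ofPred_eq, mem_filter] at hp hq
    have h1 : p.1 * e + p.2 ≡ p.1 * e + q.2 [MOD m] := by
      have := hp.2.trans hq.2.symm
      rw [← hpq] at this
      exact this
    have h2 := Nat.ModEq.add_left_cancel' _ h1
    exact Prod.ext hpq (h2.eq_of_lt_of_lt hp.1.1.2 hq.1.1.2)

open Finset in
/-- A linear hash function isolates an element of `A` with constant probability. -/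
theorem card_isolating {m θ : ℕ} (A : Finset ℕ) (hA : ∀ e ∈ A, e < θ)
    (h1 : m ≤ 13 * (#A * θ)) (h2 : 6 * (#A * θ) ≤ m) (hne : A.Nonempty) :
    m * m ≤ 32 * #{p ∈ range m ×ˢ range m | ∃ e ∈ A, (p.1 * e + p.2) % m < θ ∧
      ∀ f ∈ A, f ≠ e → ¬ (p.1 * f + p.2) % m < θ} := by
  classical
  have hApos := hne.card_pos
  have hθm : θ ≤ m := by nlinarith
  set Ω := range m ×ˢ range m
  set single : ℕ → Finset (ℕ × ℕ) := fun e => {p ∈ Ω | (p.1 * e + p.2) % m < θ} with hsingle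
  set both : ℕ → ℕ → Finset (ℕ × ℕ) := fun e f =>
    {p ∈ Ω | (p.1 * e + p.2) % m < θ ∧ (p.1 * f + p.2) % m < θ} with hboth
  set iso : ℕ → Finset (ℕ × ℕ) := fun e =>
    {p ∈ Ω | (p.1 * e + p.2) % m < θ ∧ ∀ f ∈ A, f ≠ e → ¬ (p.1 * f + p.2) % m < θ} with hiso
  have hs : ∀ e, #(single e) = m * θ := by
    intro e
    have : #(single e) = ∑ α ∈ range m, #{β ∈ range m | (α * e + β) % m < θ} := by
      rw [hsingle, card_filter, sum_product]
      refine sum_congr rfl fun α _ => ?_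
      rw [card_filter]
    rw [this, sum_congr rfl fun α _ => card_shift_lt (α * e) hθm]
    simp
  have hb : ∀ e ∈ A, ∀ f ∈ A, f ≠ e → #(both e f) ≤ 3 * θ * θ := by
    intro e he f hf hne
    rcases lt_or_gt_of_ne hne with h | h
    · have : both e f = both f e := by
        simp only [hboth]; exact filter_congr fun p _ => and_comm
      rw [this]
      exact card_pair_lt h (hA e he)
    · exact card_pair_lt h (hA f hf)
  -- From the pairs that sample e, remove for each other f those that sample f too.
  have hi : ∀ e ∈ A, m * θ ≤ #(iso e) + #A * (3 * θ * θ) := by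
    intro e he
    have hsub : single e ⊆ iso e ∪ (A.erase e).biUnion fun f => both e f := by
      intro p hp
      simp only [hsingle, mem_filter] at hp
      by_cases h : ∀ f ∈ A, f ≠ e → ¬ (p.1 * f + p.2) % m < θ
      · exact mem_union_left _ (by simp only [hiso, mem_filter]; exact ⟨hp.1, hp.2, h⟩)
      · push Not at h
        obtain ⟨f, hf, hfe, hlt⟩ := h
        refine mem_union_right _ (mem_biUnion.2 ⟨f, mem_erase.2 ⟨hfe, hf⟩, ?_⟩)
        simp only [hboth, mem_filter]
        exact ⟨hp.1, hp.2, hlt⟩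
    rw [← hs e]
    refine (card_le_card hsub).trans ((card_union_le _ _).trans (Nat.add_le_add_left ?_ _))
    refine (card_biUnion_le_card_mul _ _ (3 * θ * θ) fun f hf => ?_).trans
      (Nat.mul_le_mul_right _ (card_erase_le))
    exact hb e he f (mem_of_mem_erase hf) (ne_of_mem_erase hf)
  have hdisj : (A : Set ℕ).PairwiseDisjoint iso := by
    intro e he f hf hef
    refine Finset.disjoint_left.2 fun p hp hp' => ?_
    simp only [hiso, mem_filter] at hp hp'
    exact hp.2.2 f hf hef.symm hp'.2.1
  have hsum : ∑ e ∈ A, #(iso e) ≤ #{p ∈ Ω | ∃ e ∈ A, (p.1 * e + p.2) % m < θ ∧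
      ∀ f ∈ A, f ≠ e → ¬ (p.1 * f + p.2) % m < θ} := by
    rw [← card_biUnion hdisj]
    refine card_le_card fun p hp => ?_
    obtain ⟨e, he, hp⟩ := mem_biUnion.1 hp
    simp only [hiso, mem_filter] at hp
    exact mem_filter.2 ⟨hp.1, e, he, hp.2⟩
  have htot : #A * (m * θ) ≤ ∑ e ∈ A, #(iso e) + #A * (#A * (3 * θ * θ)) := by
    calc #A * (m * θ) = ∑ _e ∈ A, m * θ := by simp
      _ ≤ ∑ e ∈ A, (#(iso e) + #A * (3 * θ * θ)) := sum_le_sum hi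
      _ = _ := by rw [sum_add_distrib]; simp
  generalize #{p ∈ Ω | ∃ e ∈ A, (p.1 * e + p.2) % m < θ ∧
      ∀ f ∈ A, f ≠ e → ¬ (p.1 * f + p.2) % m < θ} = I at *
  generalize ∑ e ∈ A, #(iso e) = J at *
  have e1 : #A * (m * θ) = m * (#A * θ) := by ring
  have e2 : #A * (#A * (3 * θ * θ)) = 3 * ((#A * θ) * (#A * θ)) := by ring
  rw [e1, e2] at htot
  generalize #A * θ = y at *
  -- With y = #A * θ the count is at least m * y - 3 * y², which is at least m * y / 2 as y ≤ m / 6,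
  -- and then at least m² / 26 as y ≥ m / 13.
  nlinarith

/-! ### Counting random words -/

section Resample

open Finset

/-- If resampling a part `get x` of a point `x` does not affect `Q`, and makes `P` hold for a
fraction at most `ε` of the samples, then `P` holds for a fraction at most `ε` of the points that
satisfy `Q`. -/
theorem card_resample_le {X Y : Type*} {Ω : Finset X}
    {Υ : Finset Y} (ov : X → Y → X) (get : X → Y) (hΥ : Υ.Nonempty)
    (hov : ∀ x ∈ Ω, ∀ y ∈ Υ, ov x y ∈ Ω) (hget : ∀ x ∈ Ω, get x ∈ Υ)
    (hgo : ∀ x ∈ Ω, ∀ y ∈ Υ, get (ov x y) = y)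
    (hoo : ∀ x ∈ Ω, ∀ y ∈ Υ, ov (ov x y) (get x) = x) {Q P : X → Prop} {_ : DecidablePred Q}
    [DecidablePred P] {_ : DecidablePred fun x => Q x ∧ P x}
    (hQ : ∀ x ∈ Ω, ∀ y ∈ Υ, Q x → Q (ov x y)) {ε : ℝ}
    (hP : ∀ x ∈ Ω, Q x → (#{y ∈ Υ | P (ov x y)} : ℝ) ≤ ε * #Υ) :
    (#{x ∈ Ω | Q x ∧ P x} : ℝ) ≤ ε * #{x ∈ Ω | Q x} := by
  -- Exchanging the part of x with y is injective, since a second exchange undoes it. It sends a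
  -- point satisfying P, with a free sample, to a point together with a sample that makes P hold.
  have h1 : #({x ∈ Ω | Q x ∧ P x} ×ˢ Υ) ≤ #({x ∈ Ω | Q x}.sigma fun x => {y ∈ Υ | P (ov x y)}) := by
    refine card_le_card_of_injOn (fun p => ⟨ov p.1 p.2, get p.1⟩) ?_ ?_
    · rintro ⟨x, y⟩ hxy
      simp only [coe_product, Set.mem_prod, mem_coe, mem_filter] at hxy
      obtain ⟨⟨hx, hq, hp⟩, hy⟩ := hxy
      simp only [coe_sigma, Set.mem_sigma_iff, mem_coe, mem_filter]
      refine ⟨⟨hov x hx y hy, hQ x hx y hy hq⟩, hget x hx, ?_⟩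
      rwa [hoo x hx y hy]
    · rintro ⟨x, y⟩ hxy ⟨x', y'⟩ hxy' h
      simp only [coe_product, Set.mem_prod, mem_coe, mem_filter] at hxy hxy'
      simp only [Sigma.mk.injEq, heq_eq_eq] at h
      have hy : y = y' := by
        rw [← hgo x hxy.1.1 y hxy.2, h.1, hgo x' hxy'.1.1 y' hxy'.2]
      have hx : x = x' := by
        rw [← hoo x hxy.1.1 y hxy.2, h.1, h.2, hoo x' hxy'.1.1 y' hxy'.2]
      rw [hx, hy]
  rw [card_product, card_sigma] at h1
  have h2 : (#{x ∈ Ω | Q x ∧ P x} : ℝ) * #Υ ≤ ∑ x ∈ Ω with Q x, (#{y ∈ Υ | P (ov x y)} : ℝ) := by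
    exact_mod_cast h1
  have h3 : ∑ x ∈ Ω with Q x, (#{y ∈ Υ | P (ov x y)} : ℝ) ≤ ∑ x ∈ Ω with Q x, ε * #Υ :=
    sum_le_sum fun x hx => hP x (mem_filter.1 hx).1 (mem_filter.1 hx).2
  rw [sum_const, nsmul_eq_mul] at h3
  have h4 : (0 : ℝ) < #Υ := by exact_mod_cast hΥ.card_pos
  nlinarith

open Classical in
/-- The sequences of `W` numbers below `m`, continued by zeros. -/
noncomputable def tapes (W m : ℕ) : Finset (ℕ → ℕ) :=
  univ.image fun (x : Fin W → Fin m) i => if h : i < W then (x ⟨i, h⟩ : ℕ) else 0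

theorem mem_tapes {W m : ℕ} {r : ℕ → ℕ} :
    r ∈ tapes W m ↔ (∀ i < W, r i < m) ∧ ∀ i, W ≤ i → r i = 0 := by
  simp only [tapes, mem_image, mem_univ, true_and]
  constructor
  · rintro ⟨x, rfl⟩
    exact ⟨fun i hi => by simp [hi], fun i hi => by simp [Nat.not_lt.2 hi]⟩
  · rintro ⟨h1, h2⟩
    refine ⟨fun i => ⟨r i, h1 i i.2⟩, ?_⟩
    ext i
    by_cases hi : i < W
    · simp [hi]
    · simp [hi, h2 i (Nat.not_lt.1 hi)]

open Classical in
theorem card_tapes (W m : ℕ) : #(tapes W m) = m ^ W := by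
  rw [tapes, card_image_of_injective]
  · simp
  · intro x y hxy
    ext i
    have := congrFun hxy i
    simpa using this

open Classical in
/-- The number of sequences in `tapes W m` that satisfy `P`. -/
noncomputable def cnt (W m : ℕ) (P : (ℕ → ℕ) → Prop) : ℝ := #{r ∈ tapes W m | P r}

variable {W m : ℕ} {P Q : (ℕ → ℕ) → Prop}

theorem cnt_nonneg : 0 ≤ cnt W m P := Nat.cast_nonneg _

theorem cnt_mono (h : ∀ r ∈ tapes W m, P r → Q r) : cnt W m P ≤ cnt W m Q := by
  classical
  unfold cnt
  refine Nat.cast_le.2 (card_le_card fun r hr => ?_)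
  rw [mem_filter] at hr ⊢
  exact ⟨hr.1, h r hr.1 hr.2⟩

theorem cnt_or_le : cnt W m (fun r => P r ∨ Q r) ≤ cnt W m P + cnt W m Q := by
  classical
  unfold cnt
  rw [← Nat.cast_add, Nat.cast_le]
  refine (card_le_card fun r hr => ?_).trans (card_union_le _ _)
  rw [mem_union, mem_filter, mem_filter]
  simp only [mem_filter] at hr
  obtain ⟨hr, h⟩ := hr
  exact h.imp (fun h => ⟨hr, h⟩) fun h => ⟨hr, h⟩

theorem cnt_exists_le {ι : Type*} (s : Finset ι) (P : ι → (ℕ → ℕ) → Prop) {δ : ℝ}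
    (h : ∀ i ∈ s, cnt W m (P i) ≤ δ) : cnt W m (fun r => ∃ i ∈ s, P i r) ≤ #s * δ := by
  classical
  have : cnt W m (fun r => ∃ i ∈ s, P i r) ≤ ∑ i ∈ s, cnt W m (P i) := by
    unfold cnt
    rw [← Nat.cast_sum]
    refine Nat.cast_le.2 (le_trans (card_le_card fun r hr => ?_) card_biUnion_le)
    simp only [mem_filter] at hr
    obtain ⟨hr, i, hi, hP⟩ := hr
    exact mem_biUnion.2 ⟨i, hi, mem_filter.2 ⟨hr, hP⟩⟩
  refine this.trans ((sum_le_sum h).trans ?_)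
  simp

/-- The chain rule for conditional probabilities: each trial fails for a fraction at most ε of the
tapes on which all earlier trials have failed. -/
theorem cnt_forall_le {D : ℕ} {ε : ℝ} (hε : 0 ≤ ε) (Q : (ℕ → ℕ) → Prop)
    (P : ℕ → (ℕ → ℕ) → Prop)
    (h : ∀ c < D, cnt W m (fun r => (Q r ∧ ∀ c' < c, P c' r) ∧ P c r) ≤
      ε * cnt W m fun r => Q r ∧ ∀ c' < c, P c' r) :
    cnt W m (fun r => Q r ∧ ∀ c < D, P c r) ≤ ε ^ D * cnt W m Q := by
  induction D with
  | zero => simp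
  | succ D ih =>
    calc _ ≤ cnt W m (fun r => (Q r ∧ ∀ c' < D, P c' r) ∧ P D r) :=
          cnt_mono fun r _ hr => ⟨⟨hr.1, fun c hc => hr.2 c (by omega)⟩, hr.2 D (by omega)⟩
      _ ≤ ε * cnt W m fun r => Q r ∧ ∀ c' < D, P c' r := h D (by omega)
      _ ≤ ε * (ε ^ D * cnt W m Q) :=
          mul_le_mul_of_nonneg_left (ih fun c hc => h c (by omega)) hε
      _ = _ := by ring

theorem update_mem_tapes {r : ℕ → ℕ} {i a : ℕ} (hr : r ∈ tapes W m) (hi : i < W) (ha : a < m) :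
    Function.update r i a ∈ tapes W m := by
  rw [mem_tapes] at hr ⊢
  refine ⟨fun j hj => ?_, fun j hj => ?_⟩
  · rw [Function.update_apply]; split_ifs; exacts [ha, hr.1 j hj]
  · rw [Function.update_apply, if_neg (by omega)]; exact hr.2 j hj

open Classical in
-- The resampled position may depend on the tape, as long as resampling does not move it. This is
-- needed for a table entry that is itself addressed by a hash value.
theorem cnt_update_le (hm : 0 < m) (idx : (ℕ → ℕ) → ℕ) (hlt : ∀ r, idx r < W)
    (hidx : ∀ r a, idx (Function.update r (idx r) a) = idx r)
    (hQ : ∀ r a, Q r → Q (Function.update r (idx r) a)) {ε : ℝ}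
    (hP : ∀ r ∈ tapes W m, Q r →
      (#{a ∈ range m | P (Function.update r (idx r) a)} : ℝ) ≤ ε * m) :
    cnt W m (fun r => Q r ∧ P r) ≤ ε * cnt W m Q := by
  unfold cnt
  refine card_resample_le (P := P) (Q := Q) (Υ := range m) (fun r a => Function.update r (idx r) a)
    (fun r => r (idx r)) ⟨0, mem_range.2 hm⟩ ?_ ?_ ?_ ?_ (fun r _ a _ => hQ r a) ?_
  · exact fun r hr a ha => update_mem_tapes hr (hlt r) (mem_range.1 ha)
  · exact fun r hr => mem_range.2 ((mem_tapes.1 hr).1 _ (hlt r))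
  · intro r _ a _; simp [hidx]
  · intro r _ a _; simp [hidx]
  · simpa using hP

open Classical in
theorem cnt_update₂_le (hm : 0 < m) {i j : ℕ} (hij : i ≠ j) (hi : i < W) (hj : j < W)
    (hQ : ∀ r a b, Q r → Q (Function.update (Function.update r i a) j b)) {ε : ℝ}
    (hP : ∀ r ∈ tapes W m, Q r → (#{p ∈ range m ×ˢ range m |
      P (Function.update (Function.update r i p.1) j p.2)} : ℝ) ≤ ε * (m * m)) :
    cnt W m (fun r => Q r ∧ P r) ≤ ε * cnt W m Q := by
  unfold cnt
  refine card_resample_le (P := P) (Q := Q) (Υ := range m ×ˢ range m)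
    (fun r p => Function.update (Function.update r i p.1) j p.2)
    (fun r => (r i, r j)) ⟨(0, 0), by simp [hm]⟩ ?_ ?_ ?_ ?_ (fun r _ p _ => hQ r p.1 p.2) ?_
  · intro r hr p hp
    rw [mem_product, mem_range, mem_range] at hp
    exact update_mem_tapes (update_mem_tapes hr hi hp.1) hj hp.2
  · intro r hr
    rw [mem_product, mem_range, mem_range]
    exact ⟨(mem_tapes.1 hr).1 _ hi, (mem_tapes.1 hr).1 _ hj⟩
  · intro r _ p _; simp [Function.update_of_ne hij]
  · intro r _ p _
    ext x
    by_cases h1 : x = j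
    · subst h1; simp
    · by_cases h2 : x = i
      · subst h2; simp [Function.update_of_ne h1]
      · simp [Function.update_of_ne h1, Function.update_of_ne h2]
  · simpa using hP

end Resample

/-! ### The hash functions into the blocks -/

section Tables

open Finset

variable {n k : ℕ}

theorem blk_congr (hk : 1 ≤ k) (hn : 2 * k ≤ n) {r r' : ℕ → ℕ} {q : ℕ}
    (h1 : r (3 * dd n + q) = r' (3 * dd n + q))
    (h2 : ∀ i < gRange k, r (4 * dd n + q * gRange k + i) = r' (4 * dd n + q * gRange k + i))
    (x : ℕ) : blk n k r q x = blk n k r' q x := by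
  unfold blk
  rw [h1, h2 _ (gIndex_lt hk hn _)]

/-- The hash function `q` maps at most `dd n` elements of `V` to the same block, and the index
into its table is injective on `V`. -/
def GoodTable (n k : ℕ) (V : Finset ℕ) (q : ℕ) (r : ℕ → ℕ) : Prop :=
  Set.InjOn (fun x => r (3 * dd n + q) * x % 2 ^ wd n / gWidth n k) V ∧
    ∀ β < blocks k, #{x ∈ V | blk n k r q x = β} ≤ dd n

theorem goodTable_congr (hk : 1 ≤ k) (hn : 2 * k ≤ n) {V : Finset ℕ} {r r' : ℕ → ℕ} {q : ℕ}
    (h1 : r (3 * dd n + q) = r' (3 * dd n + q))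
    (h2 : ∀ i < gRange k, r (4 * dd n + q * gRange k + i) = r' (4 * dd n + q * gRange k + i)) :
    GoodTable n k V q r ↔ GoodTable n k V q r' := by
  unfold GoodTable
  rw [h1]
  simp only [blk_congr hk hn h1 h2]

theorem table_index_lt {q i : ℕ} (hq : q < dd n) (hi : i < gRange k) :
    4 * dd n + q * gRange k + i < words n k := by
  have := mul_add_lt hq hi
  unfold words
  omega

theorem two_pow_wd_pos (n : ℕ) : 0 < 2 ^ wd n := by positivity

theorem blocks_le (hk : 1 ≤ k) (hn : 2 * k ≤ n) : blocks k ≤ 2 ^ wd n := by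
  have := sq_mul_le hk hn
  unfold blocks
  nlinarith

theorem update_table_ne {r : ℕ → ℕ} {a q i j : ℕ} (hj : j < 4 * dd n) :
    Function.update r (4 * dd n + q * gRange k + i) a j = r j := by
  rw [Function.update_of_ne]
  generalize q * gRange k = t
  omega

/-- Injectivity of the index makes distinct elements read distinct table entries, so these can be
resampled one at a time. Each hits a given block with probability at most 2 / (8k). -/
theorem cnt_blk_le (hk : 1 ≤ k) (hn : 2 * k ≤ n) {V : Finset ℕ} {q : ℕ} (hq : q < dd n)
    {Q : (ℕ → ℕ) → Prop}
    (hQ : ∀ r a, ∀ i < gRange k, Q r → Q (Function.update r (4 * dd n + q * gRange k + i) a))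
    (hinj : ∀ r, Q r → Set.InjOn (fun x => r (3 * dd n + q) * x % 2 ^ wd n / gWidth n k) V)
    (β : ℕ) (Z : Finset ℕ) (hZ : Z ⊆ V) :
    cnt (words n k) (2 ^ wd n) (fun r => Q r ∧ ∀ z ∈ Z, blk n k r q z = β) ≤
      (1 / (4 * k)) ^ #Z * cnt (words n k) (2 ^ wd n) Q := by
  classical
  induction Z using Finset.induction_on with
  | empty => simp
  | insert z Z hz ih =>
    have hZ' : Z ⊆ V := (subset_insert _ _).trans hZ
    have hzV : z ∈ V := hZ (mem_insert_self _ _)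
    have hk' : (0 : ℝ) < k := by exact_mod_cast hk
    calc _ ≤ cnt (words n k) (2 ^ wd n)
            (fun r => (Q r ∧ ∀ z ∈ Z, blk n k r q z = β) ∧ blk n k r q z = β) :=
          cnt_mono fun r _ hr => ⟨⟨hr.1, fun x hx => hr.2 x (mem_insert_of_mem hx)⟩,
            hr.2 z (mem_insert_self _ _)⟩
      _ ≤ 1 / (4 * k) * cnt (words n k) (2 ^ wd n) fun r => Q r ∧ ∀ z ∈ Z, blk n k r q z = β := by
          refine cnt_update_le (two_pow_wd_pos n) (fun r => 4 * dd n + q * gRange k +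
            r (3 * dd n + q) * z % 2 ^ wd n / gWidth n k) ?_ ?_ ?_ ?_
          · exact fun r => table_index_lt hq (gIndex_lt hk hn _)
          · intro r a
            rw [update_table_ne (j := 3 * dd n + q) (by omega)]
          · rintro r a ⟨hr, hb⟩
            refine ⟨hQ r a _ (gIndex_lt hk hn _) hr, fun x hx => ?_⟩
            rw [← hb x hx]
            unfold blk
            rw [update_table_ne (j := 3 * dd n + q) (by omega), Function.update_of_ne]
            have hne : x ≠ z := fun h => hz (h ▸ hx)
            exact fun h => hne (hinj r hr (hZ' hx) hzV (Nat.add_left_cancel h))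
          · rintro r - -
            have h := card_mod_eq_le (v := β) (blocks_le hk hn)
            have e : ∀ a, blk n k (Function.update r (4 * dd n + q * gRange k +
                r (3 * dd n + q) * z % 2 ^ wd n / gWidth n k) a) q z = a % blocks k := by
              intro a
              unfold blk
              rw [update_table_ne (j := 3 * dd n + q) (by omega), Function.update_self]
            simp only [e]
            have h' : (blocks k : ℝ) * #{a ∈ range (2 ^ wd n) | a % blocks k = β} ≤
                2 * (2 ^ wd n : ℕ) := by exact_mod_cast h
            have e3 : (blocks k : ℝ) = 8 * k := by unfold blocks; push_cast; ring
            rw [e3] at h'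
            rw [div_mul_eq_mul_div, le_div_iff₀ (by positivity)]
            linarith
      _ ≤ 1 / (4 * k) * ((1 / (4 * k)) ^ #Z * cnt (words n k) (2 ^ wd n) Q) :=
          mul_le_mul_of_nonneg_left (ih hZ') (by positivity)
      _ = _ := by rw [card_insert_of_notMem hz]; ring

theorem gWidth_ge (hk : 1 ≤ k) (hn : 2 * k ≤ n) : n ≤ gWidth n k := by
  have := sq_mul_le hk hn
  unfold gWidth wmax
  rw [Nat.le_div_iff_mul_le (by positivity)]
  generalize 2 ^ wd n = M at *
  have h1 : n * (80 * k * k) ≤ n * (80 * (n * n)) := by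
    rw [mul_assoc 80]; gcongr <;> omega
  have h2 : n * (80 * (n * n)) + 1 ≤ (n * n + n + 2) * (4096 * (n * n)) := by nlinarith
  omega

theorem mul_gWidth_le (n k : ℕ) : 80 * k * k * gWidth n k ≤ 2 ^ wd n := by
  have := Nat.mul_div_le (wmax n) (80 * k * k)
  unfold gWidth
  have h : wmax n ≤ 2 ^ wd n := Nat.sub_le _ _
  exact this.trans h

theorem mul_le_two_pow_dd (hn : 2 * k ≤ n) : 32 * k ≤ 2 ^ dd n := by
  have h1 : k ≤ 2 ^ lg n := by have := lt_two_pow_lg n; omega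
  have h2 : (2 ^ lg n) ^ 6 ≤ 2 ^ dd n := by
    rw [← pow_mul]
    exact Nat.pow_le_pow_right (by norm_num) (by unfold dd; omega)
  have h4 : 2 ≤ 2 ^ lg n := by
    calc 2 = 2 ^ 1 := by norm_num
      _ ≤ 2 ^ lg n := Nat.pow_le_pow_right (by norm_num) (by unfold lg; omega)
  refine le_trans ?_ h2
  generalize 2 ^ lg n = L at *
  calc 32 * k ≤ 2 ^ 5 * L := by gcongr; norm_num
    _ ≤ L ^ 5 * L := by gcongr
    _ = L ^ 6 := by ring

/-- Two failures of weight 1/4 each. The index collides for at most 4k² * 5 * `gWidth n k`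
multipliers, a quarter of all. Otherwise an overfull block contains `dd n` elements of `V` with the
same image, and 8k * (2k)^D * (1/(4k))^D = 8k / 2^D bounds the union over blocks and D-subsets. -/
theorem cnt_not_goodTable_le (hk : 1 ≤ k) (hn : 2 * k ≤ n) {V : Finset ℕ} (hV : ∀ x ∈ V, x < n)
    (hVc : #V ≤ 2 * k) {q : ℕ} (hq : q < dd n) {Q : (ℕ → ℕ) → Prop}
    (hQ1 : ∀ r a, Q r → Q (Function.update r (3 * dd n + q) a))
    (hQ : ∀ r a, ∀ i < gRange k, Q r → Q (Function.update r (4 * dd n + q * gRange k + i) a)) :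
    cnt (words n k) (2 ^ wd n) (fun r => Q r ∧ ¬ GoodTable n k V q r) ≤
      1 / 2 * cnt (words n k) (2 ^ wd n) Q := by
  classical
  have hk' : (0 : ℝ) < k := by exact_mod_cast hk
  set I : (ℕ → ℕ) → Prop := fun r =>
    Set.InjOn (fun x => r (3 * dd n + q) * x % 2 ^ wd n / gWidth n k) V with hI
  set c := cnt (words n k) (2 ^ wd n) Q with hc
  have hc0 : 0 ≤ c := cnt_nonneg
  have h1 : cnt (words n k) (2 ^ wd n) (fun r => Q r ∧ ¬ I r) ≤ 1 / 4 * c := by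
    refine cnt_update_le (two_pow_wd_pos n) (fun _ => 3 * dd n + q) (fun _ => ?_)
      (fun _ _ => rfl) hQ1 fun r _ _ => ?_
    · have : 0 ≤ dd n * gRange k := Nat.zero_le _
      unfold words; omega
    · simp only [hI, Function.update_self]
      have h := card_not_injOn_le (m := 2 ^ wd n) V hV (gWidth_ge hk hn)
      have h2 : #V * #V * (5 * gWidth n k) ≤ (2 * k) * (2 * k) * (5 * gWidth n k) := by gcongr
      have h3 := mul_gWidth_le n k
      have h4 : (2 * k) * (2 * k) * (5 * gWidth n k) * 4 = 80 * k * k * gWidth n k := by ring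
      have h5 : 4 * #{a ∈ range (2 ^ wd n) |
          ¬ Set.InjOn (fun x => a * x % 2 ^ wd n / gWidth n k) V} ≤ 2 ^ wd n := by omega
      have h6 : (4 : ℝ) * #{a ∈ range (2 ^ wd n) |
          ¬ Set.InjOn (fun x => a * x % 2 ^ wd n / gWidth n k) V} ≤ (2 ^ wd n : ℕ) := by
        exact_mod_cast h5
      linarith
  have hQI : cnt (words n k) (2 ^ wd n) (fun r => Q r ∧ I r) ≤ c := cnt_mono fun r _ h => h.1
  have h2 : cnt (words n k) (2 ^ wd n) (fun r => ∃ p ∈ range (blocks k) ×ˢ powersetCard (dd n) V,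
      (Q r ∧ I r) ∧ ∀ z ∈ p.2, blk n k r q z = p.1) ≤
      #(range (blocks k) ×ˢ powersetCard (dd n) V) * ((1 / (4 * k)) ^ dd n * c) := by
    refine cnt_exists_le _ _ fun p hp => ?_
    obtain ⟨hp1, hp2⟩ := mem_product.1 hp
    obtain ⟨hp2, hp3⟩ := mem_powersetCard.1 hp2
    refine (cnt_blk_le hk hn hq ?_ (fun r hr => hr.2) p.1 p.2 hp2).trans ?_
    · rintro r a i hi ⟨hr, hr'⟩
      refine ⟨hQ r a i hi hr, ?_⟩
      simp only [hI] at hr' ⊢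
      rwa [update_table_ne (by omega)]
    · rw [hp3]
      exact mul_le_mul_of_nonneg_left hQI (by positivity)
  have h3 : (#(range (blocks k) ×ˢ powersetCard (dd n) V) : ℝ) * ((1 / (4 * k)) ^ dd n * c) ≤
      1 / 4 * c := by
    rw [← mul_assoc]
    refine mul_le_mul_of_nonneg_right ?_ hc0
    have e1 : #(range (blocks k) ×ˢ powersetCard (dd n) V) ≤ 8 * k * (2 * k) ^ dd n := by
      rw [card_product, card_range, card_powersetCard]
      refine Nat.mul_le_mul_left _ ((Nat.choose_le_pow _ _).trans ?_)
      exact Nat.pow_le_pow_left hVc _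
    have e2 : (#(range (blocks k) ×ˢ powersetCard (dd n) V) : ℝ) ≤ 8 * k * (2 * k) ^ dd n := by
      exact_mod_cast e1
    have e3 : (32 * k : ℝ) ≤ 2 ^ dd n := by exact_mod_cast mul_le_two_pow_dd hn
    generalize dd n = D at *
    calc _ ≤ 8 * (k : ℝ) * (2 * k) ^ D * (1 / (4 * k)) ^ D := by gcongr
      _ = 8 * k * (1 / 2) ^ D := by
        rw [mul_assoc, ← mul_pow]
        congr 2
        field_simp
        norm_num
      _ = 8 * k / 2 ^ D := by rw [one_div, inv_pow]; rfl
      _ ≤ 1 / 4 := by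
        rw [div_le_iff₀ (by positivity)]
        linarith
  have h4 : cnt (words n k) (2 ^ wd n) (fun r => Q r ∧ ¬ GoodTable n k V q r) ≤
      cnt (words n k) (2 ^ wd n) (fun r => (Q r ∧ ¬ I r) ∨
        ∃ p ∈ range (blocks k) ×ˢ powersetCard (dd n) V,
          (Q r ∧ I r) ∧ ∀ z ∈ p.2, blk n k r q z = p.1) := by
    refine cnt_mono fun r _ hr => ?_
    by_cases hi : I r
    · right
      have := hr.2
      unfold GoodTable at this
      rw [not_and] at this
      have := this hi
      push Not at this
      obtain ⟨β, hβ, hlt⟩ := this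
      obtain ⟨Z, hZ, hZc⟩ := exists_subset_card_eq hlt.le
      refine ⟨(β, Z), mem_product.2 ⟨mem_range.2 hβ, mem_powersetCard.2
        ⟨hZ.trans (filter_subset _ _), hZc⟩⟩, ⟨hr.1, hi⟩, fun z hz => ?_⟩
      exact (mem_filter.1 (hZ hz)).2
    · exact .inl ⟨hr.1, hi⟩
  calc _ ≤ _ := h4
    _ ≤ _ := cnt_or_le
    _ ≤ 1 / 4 * c + 1 / 4 * c := add_le_add h1 (h2.trans h3)
    _ = _ := by ring

/-- Different tables read disjoint sets of words, so resampling one of them keeps the failures of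
the earlier ones. -/
theorem cnt_forall_not_goodTable_le (hk : 1 ≤ k) (hn : 2 * k ≤ n) {V : Finset ℕ}
    (hV : ∀ x ∈ V, x < n) (hVc : #V ≤ 2 * k) :
    cnt (words n k) (2 ^ wd n) (fun r => ∀ q < dd n, ¬ GoodTable n k V q r) ≤
      (1 / 2) ^ dd n * cnt (words n k) (2 ^ wd n) fun _ => True := by
  refine le_trans (cnt_mono fun r _ hr => ⟨trivial, hr⟩) (cnt_forall_le (by norm_num)
    (fun _ => True) (fun q r => ¬ GoodTable n k V q r) fun q hq => ?_)
  refine cnt_not_goodTable_le hk hn hV hVc hq (fun r a hr => ?_) (fun r a i hi hr => ?_)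
  · refine ⟨trivial, fun q' hq' => ?_⟩
    rw [goodTable_congr hk hn (r' := r)]
    · exact hr.2 q' hq'
    · rw [Function.update_of_ne (by omega)]
    · intro i _
      rw [Function.update_of_ne]
      generalize q' * gRange k = t
      omega
  · refine ⟨trivial, fun q' hq' => ?_⟩
    rw [goodTable_congr hk hn (r' := r)]
    · exact hr.2 q' hq'
    · rw [update_table_ne (by omega)]
    · intro j hj
      rw [Function.update_of_ne]
      have := mul_add_lt hq' hj
      omega

end Tables

/-! ### The hash functions inside the blocks -/

section Positions

open Finset

variable {n k : ℕ}

theorem le_words (n k : ℕ) : 4 * dd n ≤ words n k := Nat.le_add_right _ _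

theorem subWidth_ge (hn : 2 ≤ n) : n ≤ subWidth n := by
  have h4 := four_le_two_pow_lg hn
  have hD := dd_le hn
  have hL := (lt_two_pow_lg n).le
  have hd := dd_pos n
  unfold subWidth wmax
  rw [Nat.le_div_iff_mul_le (by positivity), two_pow_wd]
  generalize 2 ^ lg n = L at *
  have h1 : n * (10 * dd n * dd n) ≤ L ^ 15 := by
    calc n * (10 * dd n * dd n) ≤ L * (4 ^ 2 * L ^ 6 * L ^ 6) := by gcongr; norm_num
      _ ≤ L * (L ^ 2 * L ^ 6 * L ^ 6) := by gcongr
      _ = L ^ 15 := by ring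
  have h2 : L ^ 15 < L ^ 128 := Nat.pow_lt_pow_right (by omega) (by norm_num)
  omega

theorem mul_subWidth_le (n : ℕ) : 10 * dd n * dd n * subWidth n ≤ 2 ^ wd n := by
  unfold subWidth
  exact (Nat.mul_div_le _ _).trans (Nat.sub_le _ _)

/-- A block of a good table holds at most D elements of `V`, so at most D² * 5 * `subWidth n`
multipliers collide on it, half of all. The D multipliers are separate words that the blocks do not
read. -/
theorem cnt_forall_not_injOn_sub_le (hk : 1 ≤ k) (hn : 2 * k ≤ n) {V : Finset ℕ}
    (hV : ∀ x ∈ V, x < n) (q : ℕ) {β : ℕ} (hβ : β < blocks k) :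
    cnt (words n k) (2 ^ wd n) (fun r => GoodTable n k V q r ∧
      ∀ a < dd n, ¬ Set.InjOn (sub n r a) ({x ∈ V | blk n k r q x = β} : Finset ℕ)) ≤
      (1 / 2) ^ dd n * cnt (words n k) (2 ^ wd n) fun _ => True := by
  classical
  refine (cnt_forall_le (by norm_num) (GoodTable n k V q)
    (fun a r => ¬ Set.InjOn (sub n r a) ({x ∈ V | blk n k r q x = β} : Finset ℕ)) fun a ha => ?_).trans
    (mul_le_mul_of_nonneg_left (cnt_mono fun _ _ _ => trivial) (by positivity))
  have hlow : ∀ r b, blk n k (Function.update r (2 * dd n + a) b) q = blk n k r q := by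
    intro r b
    ext x
    refine blk_congr hk hn ?_ (fun i _ => ?_) x
    · rw [Function.update_of_ne (by omega)]
    · rw [Function.update_of_ne]
      generalize q * gRange k = t
      omega
  refine cnt_update_le (two_pow_wd_pos n) (fun _ => 2 * dd n + a) (fun _ => ?_) (fun _ _ => rfl)
    (fun r b hr => ⟨?good, fun a' ha' => ?before⟩) (fun r _ hr => ?count)
  · have := le_words n k
    omega
  case good =>
    have := hr.1
    unfold GoodTable at this ⊢
    rwa [hlow, Function.update_of_ne (by omega)]
  case before =>
    have := hr.2 a' ha'
    rw [hlow]
    have e : sub n (Function.update r (2 * dd n + a) b) a' = sub n r a' := by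
      ext x
      unfold sub
      rw [Function.update_of_ne (by omega)]
    rwa [e]
  case count =>
    have hc := hr.1.2 β hβ
    have h := card_not_injOn_le (m := 2 ^ wd n) {x ∈ V | blk n k r q x = β}
      (fun x hx => hV x (mem_filter.1 hx).1) (subWidth_ge (n := n) (by omega))
    have e : ∀ b, sub n (Function.update r (2 * dd n + a) b) a =
        fun x => b * x % 2 ^ wd n / subWidth n := by
      intro b
      ext x
      unfold sub
      rw [Function.update_self]
    simp only [hlow, e]
    have h2 := Nat.mul_le_mul_right (5 * subWidth n) (Nat.mul_le_mul hc hc)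
    have h3 := mul_subWidth_le n
    have h4 : 2 * (dd n * dd n * (5 * subWidth n)) = 10 * dd n * dd n * subWidth n := by ring
    have h5 : 2 * #{b ∈ range (2 ^ wd n) | ¬ Set.InjOn (fun x => b * x % 2 ^ wd n / subWidth n)
        ({x ∈ V | blk n k r q x = β} : Finset ℕ)} ≤ 2 ^ wd n := by omega
    have h6 : (2 : ℝ) * #{b ∈ range (2 ^ wd n) |
        ¬ Set.InjOn (fun x => b * x % 2 ^ wd n / subWidth n)
        ({x ∈ V | blk n k r q x = β} : Finset ℕ)} ≤ (2 ^ wd n : ℕ) := by exact_mod_cast h5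
    linarith

end Positions

/-! ### Sampling -/

section Sampling

open Finset

variable {n k : ℕ}

/-- The sampling rate for a set of `s` elements. -/
def level (s : ℕ) : ℕ := Nat.log 2 (6 * s) + 1

/-- The sampler `c` isolates an element of `A`. -/
def Isolates (n : ℕ) (A : Finset ℕ) (c : ℕ) (r : ℕ → ℕ) : Prop :=
  ∃ e ∈ A, smp n r c (level #A) e = 1 ∧ ∀ f ∈ A, f ≠ e → smp n r c (level #A) f = 0

theorem level_lt {s : ℕ} (hn : 2 ≤ n) (hs : 0 < s) (hsn : s ≤ n * n) : level s < dd n := by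
  have h4 := four_le_two_pow_lg hn
  have hL := (lt_two_pow_lg n).le
  have h1 : Nat.log 2 (6 * s) < 4 * lg n := by
    refine Nat.log_lt_of_lt_pow (by omega) ?_
    rw [mul_comm 4, pow_mul]
    generalize 2 ^ lg n = L at *
    calc 6 * s ≤ 6 * (L * L) := by gcongr; exact hsn.trans (Nat.mul_le_mul hL hL)
      _ < 4 * 4 * (L * L) := by
        have : 0 < L * L := by positivity
        omega
      _ ≤ L * L * (L * L) := by gcongr
      _ = L ^ 4 := by ring
  have : 0 < lg n := by
    have := dd_pos n
    unfold dd at this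
    omega
  unfold level dd
  omega

/-- The level is chosen so that 6s < 2^l ≤ 12s, which puts the expected number of sampled elements
between about 1/13 and 1/6. The loss from 12 to 13 pays for rounding the threshold down. -/
theorem threshold_bounds {s : ℕ} (hk : 1 ≤ k) (hn : 2 * k ≤ n) (hs : 0 < s) (hsn : s ≤ n * n) :
    n * n ≤ wmax n >>> level s ∧ 6 * (s * (wmax n >>> level s)) ≤ 2 ^ wd n ∧
      2 ^ wd n ≤ 13 * (s * (wmax n >>> level s)) := by
  have hsq := sq_mul_le hk hn
  have h1 : 6 * s < 2 ^ level s := Nat.lt_pow_succ_log_self (by norm_num) _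
  have h2 : 2 ^ level s ≤ 12 * s := by
    have := Nat.pow_log_le_self 2 (show 6 * s ≠ 0 by omega)
    unfold level
    rw [pow_succ]
    omega
  have hM := two_pow_wd_pos n
  rw [Nat.shiftRight_eq_div_pow]
  unfold wmax
  generalize 2 ^ wd n = M at *
  generalize 2 ^ level s = p at *
  have h3 := Nat.div_add_mod (M - 1) p
  have h4 := Nat.mod_lt (M - 1) (show 0 < p by omega)
  generalize (M - 1) / p = θ at *
  have h5 : M ≤ p * (θ + 1) := by rw [mul_add]; omega
  have h6 : p * θ ≤ M := by omega
  have h7 : n * n + 12 ≤ θ := by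
    by_contra hlt
    have : p * (θ + 1) ≤ 12 * s * (n * n + 12) := Nat.mul_le_mul h2 (by omega)
    have h8 : 12 * s * (n * n + 12) ≤ 12 * (n * n) * (n * n + 12) := by gcongr
    have h9 : 0 < n * n := by
      have : 0 < n := by omega
      positivity
    nlinarith
  refine ⟨by omega, ?_, ?_⟩
  · calc 6 * (s * θ) = 6 * s * θ := by ring
      _ ≤ p * θ := Nat.mul_le_mul_right _ h1.le
      _ ≤ M := h6
  · calc M ≤ p * (θ + 1) := h5
      _ ≤ 12 * s * (θ + 1) := Nat.mul_le_mul_right _ h2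
      _ = s * (12 * θ + 12) := by ring
      _ ≤ s * (13 * θ) := Nat.mul_le_mul_left _ (by omega)
      _ = 13 * (s * θ) := by ring

/-- The set may be random, but it depends only on words from `2 * dd n` on, whereas the samplers use
the words before that. Resampling a multiplier and a shift therefore leaves the set fixed. -/
theorem cnt_forall_not_isolates_le (hk : 1 ≤ k) (hn : 2 * k ≤ n) (A : (ℕ → ℕ) → Finset ℕ)
    (hlt : ∀ r, ∀ e ∈ A r, e < n * n) (hne : ∀ r, (A r).Nonempty)
    (hA : ∀ r r', (∀ i, 2 * dd n ≤ i → r i = r' i) → A r = A r') :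
    cnt (words n k) (2 ^ wd n) (fun r => ∀ c < dd n, ¬ Isolates n (A r) c r) ≤
      (31 / 32) ^ dd n * cnt (words n k) (2 ^ wd n) fun _ => True := by
  classical
  refine le_trans (cnt_mono fun r _ hr => ⟨trivial, hr⟩) (cnt_forall_le (by norm_num)
    (fun _ => True) (fun c r => ¬ Isolates n (A r) c r) fun c hc => ?_)
  have hup : ∀ r a b, A (Function.update (Function.update r c a) (dd n + c) b) = A r := by
    intro r a b
    refine hA _ _ fun i hi => ?_
    rw [Function.update_of_ne (by omega), Function.update_of_ne (by omega)]
  have hw := le_words n k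
  have hd := dd_pos n
  refine cnt_update₂_le (two_pow_wd_pos n) (i := c) (j := dd n + c) (by omega) (by omega)
    (by omega) (fun r a b hr => ⟨trivial, fun c' hc' => ?before⟩) (fun r _ _ => ?count)
  case before =>
    rw [hup]
    have := hr.2 c' hc'
    unfold Isolates smp at this ⊢
    rwa [Function.update_of_ne (by omega), Function.update_of_ne (by omega),
      Function.update_of_ne (by omega), Function.update_of_ne (by omega)]
  case count =>
    have hcard : #(A r) ≤ n * n := by
      rw [← card_range (n * n)]
      exact card_le_card fun e he => mem_range.2 (hlt r e he)
    obtain ⟨h1, h2, h3⟩ := threshold_bounds hk hn (hne r).card_pos hcard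
    have h := card_isolating (m := 2 ^ wd n) (A r) (fun e he => (hlt r e he).trans_le h1) h3 h2
      (hne r)
    simp only [hup]
    set Ω := range (2 ^ wd n) ×ˢ range (2 ^ wd n) with hΩ
    have hΩc : #Ω = 2 ^ wd n * 2 ^ wd n := by rw [hΩ, card_product, card_range]
    have hsub : #{p ∈ Ω | ∃ e ∈ A r, (p.1 * e + p.2) % 2 ^ wd n < wmax n >>> level #(A r) ∧
        ∀ f ∈ A r, f ≠ e → ¬ (p.1 * f + p.2) % 2 ^ wd n < wmax n >>> level #(A r)} ≤
        #{p ∈ Ω | ¬ ¬ Isolates n (A r) c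
          (Function.update (Function.update r c p.1) (dd n + c) p.2)} := by
      refine card_le_card fun p hp => ?_
      simp only [mem_filter] at hp ⊢
      refine ⟨hp.1, not_not.2 ?_⟩
      obtain ⟨e, he, h1, h2⟩ := hp.2
      refine ⟨e, he, ?_, fun f hf hfe => ?_⟩
      · unfold smp
        rw [Function.update_self, Function.update_of_ne (by omega), Function.update_self,
          if_pos h1]
      · unfold smp
        rw [Function.update_self, Function.update_of_ne (by omega), Function.update_self,
          if_neg (h2 f hf hfe)]
    have hsplit := card_filter_add_card_filter_not (s := Ω) (fun p => ¬ Isolates n (A r) c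
          (Function.update (Function.update r c p.1) (dd n + c) p.2))
    have hfin : 32 * #{p ∈ Ω | ¬ Isolates n (A r) c
          (Function.update (Function.update r c p.1) (dd n + c) p.2)} ≤
        31 * (2 ^ wd n * 2 ^ wd n) := by omega
    have hfin' : (32 : ℝ) * #{p ∈ Ω | ¬ Isolates n (A r) c
          (Function.update (Function.update r c p.1) (dd n + c) p.2)} ≤
        31 * ((2 ^ wd n : ℕ) * (2 ^ wd n : ℕ)) := by exact_mod_cast hfin
    linarith

end Sampling

/-! ### Isolated matchings -/

section Isolated

variable {n k : ℕ}

theorem mul_add_inj {a b a' b' B : ℕ} (hb : b < B) (hb' : b' < B) :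
    a * B + b = a' * B + b' ↔ a = a' ∧ b = b' := by
  constructor
  · intro h
    have h1 : (a * B + b) / B = a := by
      rw [mul_comm, Nat.mul_add_div (by omega), Nat.div_eq_of_lt hb, add_zero]
    have h2 : (a' * B + b') / B = a' := by
      rw [mul_comm, Nat.mul_add_div (by omega), Nat.div_eq_of_lt hb', add_zero]
    have h3 : a = a' := by rw [← h1, ← h2, h]
    subst h3
    exact ⟨rfl, by omega⟩
  · rintro ⟨rfl, rfl⟩; rfl

theorem add_mul_mod {a x D : ℕ} (ha : a < D) : (a + D * x) % D = a := by
  rw [Nat.add_mul_mod_self_left, Nat.mod_eq_of_lt ha]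

theorem add_mul_div {a x D : ℕ} (ha : a < D) : (a + D * x) / D = x := by
  rw [Nat.add_mul_div_left _ _ (by omega), Nat.div_eq_of_lt ha, zero_add]

/-- The sampler with the given hash functions and rate. -/
def sampler (n q a b c l : ℕ) : ℕ := q + dd n * (a + dd n * (b + dd n * (c + dd n * l)))

theorem sampler_lt {q a b c l : ℕ} (hq : q < dd n) (ha : a < dd n) (hb : b < dd n) (hc : c < dd n)
    (hl : l < dd n) : sampler n q a b c l < jj n := by
  have h1 := mul_add_lt (mul_add_lt (mul_add_lt (mul_add_lt hl hc) hb) ha) hq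
  unfold sampler jj
  calc _ = (((l * dd n + c) * dd n + b) * dd n + a) * dd n + q := by ring
    _ < _ := h1

theorem addr_sampler {r : ℕ → ℕ} {q a b c l : ℕ} (hq : q < dd n) (ha : a < dd n) (hb : b < dd n)
    (hc : c < dd n) (u v : ℕ) : addr n k r (sampler n q a b c l) u v =
      ((sampler n q a b c l * 2 + smp n r c l (u * n + v)) * cells n k + cell n k r q a u) *
        cells n k + cell n k r q b v := by
  unfold addr
  have h1 : sampler n q a b c l % dd n = q := add_mul_mod hq
  have h2 : sampler n q a b c l / dd n = a + dd n * (b + dd n * (c + dd n * l)) := add_mul_div hq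
  have h3 : (a + dd n * (b + dd n * (c + dd n * l))) / dd n = b + dd n * (c + dd n * l) :=
    add_mul_div ha
  have h4 : (b + dd n * (c + dd n * l)) / dd n = c + dd n * l := add_mul_div hb
  rw [h1, h2, h3, h4, add_mul_mod ha, add_mul_mod hb, add_mul_mod hc, add_mul_div hc]

theorem addr_eq_iff (hk : 1 ≤ k) (hn : 2 * k ≤ n) {r : ℕ → ℕ} {q a b c l : ℕ} (hq : q < dd n)
    (ha : a < dd n) (hb : b < dd n) (hc : c < dd n) (j u v x y : ℕ) :
    addr n k r j u v = ((sampler n q a b c l * 2 + 1) * cells n k + cell n k r q a x) *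
        cells n k + cell n k r q b y ↔
      j = sampler n q a b c l ∧ smp n r c l (u * n + v) = 1 ∧
        cell n k r q a u = cell n k r q a x ∧ cell n k r q b v = cell n k r q b y := by
  constructor
  · intro h
    have h' := h
    unfold addr at h'
    rw [mul_add_inj (cell_lt r hk hn _ _ _) (cell_lt r hk hn _ _ _),
      mul_add_inj (cell_lt r hk hn _ _ _) (cell_lt r hk hn _ _ _),
      mul_add_inj (smp_lt r _ _ _) (by norm_num)] at h'
    obtain rfl := h'.1.1.1
    rw [addr_sampler hq ha hb hc, mul_add_inj (cell_lt r hk hn _ _ _) (cell_lt r hk hn _ _ _),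
      mul_add_inj (cell_lt r hk hn _ _ _) (cell_lt r hk hn _ _ _),
      mul_add_inj (smp_lt r _ _ _) (by norm_num)] at h
    exact ⟨rfl, h.1.1.2, h.1.2, h.2⟩
  · rintro ⟨rfl, h1, h2, h3⟩
    rw [addr_sampler hq ha hb hc, h1, h2, h3]

/-- The numbers of the edges whose endpoints have the same classes as those of `e`. -/
def edgeClass (n k : ℕ) (E : Finset (Sym2 (Fin n))) (q a b : ℕ) (e : Sym2 (Fin n)) (r : ℕ → ℕ) :
    Finset ℕ :=
  (E.filter fun f => cell n k r q a f.inf = cell n k r q a e.inf ∧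
    cell n k r q b f.sup = cell n k r q b e.sup).image edgeNum

theorem edgeNum_injective : Function.Injective (edgeNum (n := n)) := by
  intro e f h
  have h1 : e.inf = f.inf := Fin.ext (by rw [← edgeNum_div e, h, edgeNum_div])
  have h2 : e.sup = f.sup := Fin.ext (by rw [← edgeNum_mod e, h, edgeNum_mod])
  rw [eq_mk_inf_sup e, eq_mk_inf_sup f, h1, h2]

theorem mem_edgeClass_lt {E : Finset (Sym2 (Fin n))} {q a b : ℕ} {e : Sym2 (Fin n)} {r : ℕ → ℕ} :
    ∀ x ∈ edgeClass n k E q a b e r, x < n * n := by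
  intro x hx
  obtain ⟨f, -, rfl⟩ := Finset.mem_image.1 hx
  exact edgeNum_lt f

theorem card_edgeClass_le {E : Finset (Sym2 (Fin n))} {q a b : ℕ} {e : Sym2 (Fin n)} {r : ℕ → ℕ} :
    (edgeClass n k E q a b e r).card ≤ n * n := by
  rw [← Finset.card_range (n * n)]
  exact Finset.card_le_card fun x hx => Finset.mem_range.2 (mem_edgeClass_lt x hx)

theorem mem_edgeClass {E : Finset (Sym2 (Fin n))} {q a b : ℕ} {e : Sym2 (Fin n)} {r : ℕ → ℕ}
    {f : Sym2 (Fin n)} : edgeNum f ∈ edgeClass n k E q a b e r ↔ f ∈ E ∧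
      cell n k r q a f.inf = cell n k r q a e.inf ∧
        cell n k r q b f.sup = cell n k r q b e.sup := by
  unfold edgeClass
  rw [Finset.mem_image]
  constructor
  · rintro ⟨g, hg, hgf⟩
    rw [← edgeNum_injective hgf]
    exact Finset.mem_filter.1 hg
  · intro h
    exact ⟨f, Finset.mem_filter.2 h, rfl⟩

theorem self_mem_edgeClass {E : Finset (Sym2 (Fin n))} {q a b : ℕ} {e : Sym2 (Fin n)} {r : ℕ → ℕ}
    (he : e ∈ E) : edgeNum e ∈ edgeClass n k E q a b e r := mem_edgeClass.2 ⟨he, rfl, rfl⟩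

/-- An isolated edge is the only edge in one of the classes. -/
theorem exists_class_of_isolates (hk : 1 ≤ k) (hn : 2 * k ≤ n) {E : Finset (Sym2 (Fin n))}
    {r : ℕ → ℕ} {q a b c : ℕ} {e : Sym2 (Fin n)} (he : e ∈ E) (hq : q < dd n) (ha : a < dd n)
    (hb : b < dd n) (hc : c < dd n) (h : Isolates n (edgeClass n k E q a b e r) c r) :
    ∃ d < total n k, ∃ f ∈ E, cell n k r q a f.inf = cell n k r q a e.inf ∧
      cell n k r q b f.sup = cell n k r q b e.sup ∧ hits n k r f d = 1 ∧
        ∑ g ∈ E, hits n k r g d = 1 := by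
  set A := edgeClass n k E q a b e r with hA
  obtain ⟨x, hx, h1, h0⟩ := h
  obtain ⟨f, -, rfl⟩ := Finset.mem_image.1 hx
  rw [mem_edgeClass] at hx
  set l := level A.card with hl
  have hlD : l < dd n := level_lt (by omega) (Finset.card_pos.2 ⟨_, self_mem_edgeClass he⟩)
    card_edgeClass_le
  -- The summand 1 selects the class of the sampled edges.
  set d := ((sampler n q a b c l * 2 + 1) * cells n k + cell n k r q a e.inf) *
        cells n k + cell n k r q b e.sup with hd
  have hj := sampler_lt hq ha hb hc hlD
  have hits_eq : ∀ g ∈ E, hits n k r g d = if g = f then 1 else 0 := by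
    intro g hg
    unfold hits
    simp only [hd, addr_eq_iff hk hn hq ha hb hc]
    split_ifs with hgf
    · subst hgf
      rw [Finset.card_eq_one]
      refine ⟨sampler n q a b c l, ?_⟩
      ext j
      simp only [Finset.mem_filter, Finset.mem_range, Finset.mem_singleton]
      constructor
      · exact fun h => h.2.1
      · rintro rfl
        exact ⟨hj, rfl, h1, hx.2⟩
    · rw [Finset.card_eq_zero, Finset.filter_eq_empty_iff]
      rintro j - ⟨-, hs, hcell⟩
      have := h0 (edgeNum g) (mem_edgeClass.2 ⟨hg, hcell⟩) fun h => hgf (edgeNum_injective h)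
      unfold edgeNum at this
      omega
  refine ⟨d, ?_, f, hx.1, hx.2.1, hx.2.2, ?_, ?_⟩
  · exact mul_add_lt (mul_add_lt (mul_add_lt hj (by norm_num)) (cell_lt r hk hn _ _ _))
      (cell_lt r hk hn _ _ _)
  · rw [hits_eq f hx.1, if_pos rfl]
  · rw [Finset.sum_congr rfl hits_eq, Finset.sum_ite_eq' E f, if_pos hx.1]

theorem cell_eq_iff (hk : 1 ≤ k) (hn : 2 * k ≤ n) {r : ℕ → ℕ} {q a x y : ℕ} :
    cell n k r q a x = cell n k r q a y ↔
      blk n k r q x = blk n k r q y ∧ sub n r a x = sub n r a y :=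
  mul_add_inj (sub_lt r hk hn _ _) (sub_lt r hk hn _ _)

/-- The endpoints of the edges `μ 0, …, μ (k - 1)`. -/
def ends (k : ℕ) (μ : ℕ → Sym2 (Fin n)) : Finset ℕ :=
  ((Finset.range k).image fun i => ((μ i).inf : ℕ)) ∪
    (Finset.range k).image fun i => ((μ i).sup : ℕ)

theorem card_ends_le (μ : ℕ → Sym2 (Fin n)) : (ends k μ).card ≤ 2 * k := by
  refine (Finset.card_union_le _ _).trans ?_
  have h1 := Finset.card_image_le (s := Finset.range k) (f := fun i => ((μ i).inf : ℕ))
  have h2 := Finset.card_image_le (s := Finset.range k) (f := fun i => ((μ i).sup : ℕ))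
  rw [Finset.card_range] at h1 h2
  omega

theorem ends_lt (μ : ℕ → Sym2 (Fin n)) : ∀ x ∈ ends k μ, x < n := by
  intro x hx
  rcases Finset.mem_union.1 hx with h | h <;> obtain ⟨i, -, rfl⟩ := Finset.mem_image.1 h
  exacts [(μ i).inf.isLt, (μ i).sup.isLt]

theorem mem_ends {μ : ℕ → Sym2 (Fin n)} {i : ℕ} (hi : i < k) {x : Fin n} (hx : x ∈ μ i) :
    (x : ℕ) ∈ ends k μ := by
  rw [mem_iff_inf_sup] at hx
  rcases hx with rfl | rfl
  · exact Finset.mem_union_left _ (Finset.mem_image.2 ⟨i, Finset.mem_range.2 hi, rfl⟩)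
  · exact Finset.mem_union_right _ (Finset.mem_image.2 ⟨i, Finset.mem_range.2 hi, rfl⟩)

/-- The isolated edges may differ from the edges of μ, and they may have ends outside `ends k μ`,
where nothing is injective. Disjointness holds because the position hash is chosen per block,
independently of the edge and of whether the vertex is its smaller or larger end. -/
theorem good_of_isolates (hk : 1 ≤ k) (hn : 2 * k ≤ n) {E : Finset (Sym2 (Fin n))} {r : ℕ → ℕ}
    {μ : ℕ → Sym2 (Fin n)} (hμ : ∀ i < k, μ i ∈ E)
    (hdis : ∀ i < k, ∀ j < k, i ≠ j → ∀ x, ¬ (x ∈ μ i ∧ x ∈ μ j)) {q : ℕ} (hq : q < dd n)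
    (hsub : ∀ β < blocks k, ∃ a < dd n, Set.InjOn (sub n r a)
      ((ends k μ).filter fun x => blk n k r q x = β : Finset ℕ))
    (hiso : ∀ a < dd n, ∀ b < dd n, ∀ i < k, ∃ c < dd n,
      Isolates n (edgeClass n k E q a b (μ i) r) c r) : Good n k r E := by
  have hsub' : ∀ β, ∃ a, β < blocks k → a < dd n ∧ Set.InjOn (sub n r a)
      ((ends k μ).filter fun x => blk n k r q x = β : Finset ℕ) := by
    intro β
    by_cases hβ : β < blocks k
    · obtain ⟨a, ha⟩ := hsub β hβ
      exact ⟨a, fun _ => ha⟩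
    · exact ⟨0, fun h => absurd h hβ⟩
  choose α hα using hsub'
  have hex : ∀ i, ∃ (d : ℕ) (f : Sym2 (Fin n)), i < k → d < total n k ∧ f ∈ E ∧
      hits n k r f d = 1 ∧ ∑ g ∈ E, hits n k r g d = 1 ∧ ∀ x ∈ f, ∃ y ∈ μ i,
        blk n k r q x = blk n k r q y ∧
          sub n r (α (blk n k r q x)) x = sub n r (α (blk n k r q x)) y := by
    intro i
    by_cases hi : i < k
    · obtain ⟨c, hc, h⟩ := hiso (α (blk n k r q (μ i).inf)) (hα _ (blk_lt r hk _ _)).1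
        (α (blk n k r q (μ i).sup)) (hα _ (blk_lt r hk _ _)).1 i hi
      obtain ⟨d, hd, f, hf, h1, h2, h3, h4⟩ := exists_class_of_isolates hk hn (hμ i hi) hq
        (hα _ (blk_lt r hk _ _)).1 (hα _ (blk_lt r hk _ _)).1 hc h
      rw [cell_eq_iff hk hn] at h1 h2
      refine ⟨d, f, fun _ => ⟨hd, hf, h3, h4, fun x hx => ?_⟩⟩
      rw [mem_iff_inf_sup] at hx
      rcases hx with rfl | rfl
      · exact ⟨_, (mem_iff_inf_sup _ _).2 (.inl rfl), h1.1, by rw [h1.1]; exact h1.2⟩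
      · exact ⟨_, (mem_iff_inf_sup _ _).2 (.inr rfl), h2.1, by rw [h2.1]; exact h2.2⟩
    · exact ⟨0, μ i, fun h => absurd h hi⟩
  choose d f hdf using hex
  refine ⟨d, f, fun i hi => ⟨(hdf i hi).1, (hdf i hi).2.1, (hdf i hi).2.2.1, (hdf i hi).2.2.2.1⟩,
    fun i hi j hj hij x ⟨hxi, hxj⟩ => ?_⟩
  obtain ⟨y, hy, hby, hsy⟩ := (hdf i hi).2.2.2.2 x hxi
  obtain ⟨z, hz, hbz, hsz⟩ := (hdf j hj).2.2.2.2 x hxj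
  -- Both ends of μ lie in the block of the common vertex x and share its position under the hash of
  -- that block, which is injective there.
  have hyz : (y : ℕ) = z := (hα _ (blk_lt r hk q x)).2
    (by simpa using ⟨mem_ends hi hy, hby.symm⟩) (by simpa using ⟨mem_ends hj hz, hbz.symm⟩)
    (hsy.symm.trans hsz)
  have hyz' : y = z := Fin.ext hyz
  subst hyz'
  exact hdis i hi j hj hij y ⟨hy, hz⟩

theorem cell_congr (hk : 1 ≤ k) (hn : 2 * k ≤ n) {r r' : ℕ → ℕ}
    (h : ∀ i, 2 * dd n ≤ i → r i = r' i) (q a x : ℕ) : cell n k r q a x = cell n k r' q a x := by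
  unfold cell
  rw [blk_congr hk hn (h _ (by omega)) fun i _ => h _ (by generalize q * gRange k = t; omega)]
  unfold sub
  rw [h _ (by omega)]

/-- The union bound runs over all q, and over all triples (q, a, b), because the good table and the
position hashes are themselves determined by the random words. -/
theorem cnt_not_good_le (hk : 1 ≤ k) (hn : 2 * k ≤ n) {E : Finset (Sym2 (Fin n))}
    {μ : ℕ → Sym2 (Fin n)} (hμ : ∀ i < k, μ i ∈ E)
    (hdis : ∀ i < k, ∀ j < k, i ≠ j → ∀ x, ¬ (x ∈ μ i ∧ x ∈ μ j)) :
    cnt (words n k) (2 ^ wd n) (fun r => ¬ Good n k r E) ≤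
      (1 + dd n * (8 * k) + dd n * (dd n * (dd n * k))) * (31 / 32) ^ dd n *
        cnt (words n k) (2 ^ wd n) fun _ => True := by
  classical
  set N := cnt (words n k) (2 ^ wd n) fun _ => True with hN
  have hN0 : 0 ≤ N := cnt_nonneg
  have hhalf : (1 / 2 : ℝ) ^ dd n ≤ (31 / 32) ^ dd n :=
    pow_le_pow_left₀ (by norm_num) (by norm_num) _
  have h1 := cnt_forall_not_goodTable_le hk hn (ends_lt (k := k) μ) (card_ends_le μ)
  have h2 := cnt_exists_le (W := words n k) (m := 2 ^ wd n)
    (Finset.range (dd n) ×ˢ Finset.range (blocks k))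
    (fun p r => GoodTable n k (ends k μ) p.1 r ∧ ∀ a < dd n, ¬ Set.InjOn (sub n r a)
      ((ends k μ).filter fun x => blk n k r p.1 x = p.2 : Finset ℕ))
    (fun p hp => cnt_forall_not_injOn_sub_le hk hn (ends_lt μ) p.1
      (Finset.mem_range.1 (Finset.mem_product.1 hp).2))
  have h3 := cnt_exists_le (W := words n k) (m := 2 ^ wd n)
    (Finset.range (dd n) ×ˢ Finset.range (dd n) ×ˢ Finset.range (dd n) ×ˢ Finset.range k)
    (fun p r => ∀ c < dd n, ¬ Isolates n (edgeClass n k E p.1 p.2.1 p.2.2.1 (μ p.2.2.2) r) c r)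
    (fun p hp => by
      simp only [Finset.mem_product, Finset.mem_range] at hp
      refine cnt_forall_not_isolates_le hk hn _ (fun r => mem_edgeClass_lt)
        (fun r => ⟨_, self_mem_edgeClass (hμ _ hp.2.2.2)⟩) fun r r' h => ?_
      unfold edgeClass
      simp only [cell_congr hk hn h])
  have h4 : cnt (words n k) (2 ^ wd n) (fun r => ¬ Good n k r E) ≤ _ :=
    (cnt_mono fun r _ hr => ?_).trans (cnt_or_le.trans (add_le_add (cnt_or_le.trans
      (add_le_add h1 h2)) h3))
  · refine h4.trans ?_
    rw [← hN]
    simp only [Finset.card_product, Finset.card_range]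
    have e : (blocks k : ℝ) = 8 * k := by unfold blocks; push_cast; ring
    push_cast
    rw [e]
    calc _ ≤ (31 / 32) ^ dd n * N + dd n * (8 * k) * ((31 / 32) ^ dd n * N) +
          dd n * (dd n * (dd n * k)) * ((31 / 32) ^ dd n * N) := by gcongr
      _ = _ := by ring
  · by_contra hcon
    rw [not_or, not_or] at hcon
    obtain ⟨⟨c1, c2⟩, c3⟩ := hcon
    push Not at c1 c2 c3
    obtain ⟨q, hq, hG⟩ := c1
    refine hr (good_of_isolates hk hn hμ hdis hq (fun β hβ => ?_) fun a ha b hb i hi => ?_)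
    · exact c2 (q, β) (by simp [hq, hβ]) hG
    · exact c3 (q, a, b, i) (by simp [hq, ha, hb, hi])

theorem failure_bound (hk : 1 ≤ k) (hn : 2 * k ≤ n) :
    (1 + (dd n : ℝ) * (8 * k) + dd n * (dd n * (dd n * k))) * (31 / 32) ^ dd n ≤
      11 / (20 * (k : ℝ) ^ 3 * Real.log (2 * k)) := by
  have h4 : (4 : ℝ) ≤ 2 ^ lg n := by exact_mod_cast four_le_two_pow_lg (show 2 ≤ n by omega)
  have hD : (dd n : ℝ) ≤ (2 ^ lg n) ^ 6 := by exact_mod_cast dd_le (show 2 ≤ n by omega)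
  have hL : (n : ℝ) ≤ 2 ^ lg n := by exact_mod_cast (lt_two_pow_lg n).le
  have hkL : (2 * k : ℝ) ≤ 2 ^ lg n := le_trans (by exact_mod_cast hn) hL
  have hk' : (1 : ℝ) ≤ k := by exact_mod_cast hk
  have hlog : 0 < Real.log (2 * k) := Real.log_pos (by linarith)
  have hlogL : Real.log (2 * k) ≤ 2 ^ lg n := by
    have := Real.log_le_sub_one_of_pos (show (0 : ℝ) < 2 * k by linarith)
    linarith
  -- Here 1024 = 22 * 46 + 12 and (31/32)^22 ≤ 1/2, so the failure of all D trials is at most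
  -- L^(-46) for L = 2 ^ `lg n`. The other factors need only L^27.
  have hp : (31 / 32 : ℝ) ^ dd n * (2 ^ lg n) ^ 46 ≤ 1 := by
    have e1 : (31 / 32 : ℝ) ^ dd n = (((31 / 32) ^ 22) ^ 46 * (31 / 32) ^ 12) ^ lg n := by
      rw [← pow_mul, ← pow_add, ← pow_mul, dd]
    have e2 : ((2 : ℝ) ^ lg n) ^ 46 = (2 ^ 46) ^ lg n := by rw [← pow_mul, ← pow_mul, mul_comm]
    rw [e1, e2, ← mul_pow]
    refine pow_le_one₀ (by positivity) ?_
    have : ((31 / 32 : ℝ) ^ 22) ≤ 1 / 2 := by norm_num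
    calc ((31 / 32 : ℝ) ^ 22) ^ 46 * (31 / 32) ^ 12 * 2 ^ 46 ≤ (1 / 2) ^ 46 * 1 * 2 ^ 46 := by
          gcongr
          exact pow_le_one₀ (by norm_num) (by norm_num)
      _ = 1 := by norm_num
  have hD0 : (0 : ℝ) ≤ dd n := Nat.cast_nonneg _
  rw [le_div_iff₀ (by positivity)]
  have hp0 : (0 : ℝ) ≤ (31 / 32) ^ dd n := by positivity
  generalize (31 / 32 : ℝ) ^ dd n = p at *
  generalize (dd n : ℝ) = D at *
  generalize (2 : ℝ) ^ lg n = L at *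
  have hL1 : 1 ≤ L := by linarith
  have hkl : (k : ℝ) ≤ L := by linarith
  have f1 : 1 + D * (8 * k) + D * (D * (D * k)) ≤ 10 * L ^ 19 := by
    have g1 : (1 : ℝ) ≤ L ^ 19 := one_le_pow₀ hL1
    have g2 : D * (8 * k) ≤ 8 * L ^ 19 := by
      calc D * (8 * k) ≤ L ^ 6 * (8 * L) := by gcongr
        _ = 8 * L ^ 7 := by ring
        _ ≤ 8 * L ^ 19 := by (gcongr; first | exact hL1 | norm_num)
    have g3 : D * (D * (D * k)) ≤ L ^ 19 := by
      calc D * (D * (D * k)) ≤ L ^ 6 * (L ^ 6 * (L ^ 6 * L)) := by gcongr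
        _ = _ := by ring
    linarith
  calc (1 + D * (8 * k) + D * (D * (D * k))) * p * (20 * (k : ℝ) ^ 3 * Real.log (2 * k))
      ≤ 10 * L ^ 19 * p * (20 * L ^ 3 * L) := by gcongr
    _ = 200 * L ^ 23 * p := by ring
    _ ≤ 4 ^ 4 * L ^ 23 * p := by gcongr; norm_num
    _ ≤ L ^ 4 * L ^ 23 * p := by gcongr
    _ = p * L ^ 27 := by ring
    _ ≤ p * L ^ 46 := by (gcongr; first | exact hL1 | norm_num)
    _ ≤ 1 := hp
    _ ≤ 11 := by norm_num

end Isolated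

/-! ### The probability of success -/

section Probability

variable {n k : ℕ}

theorem addr_congr (hk : 1 ≤ k) (hn : 2 * k ≤ n) {r r' : ℕ → ℕ}
    (h : ∀ i < words n k, r i = r' i) (j u v : ℕ) : addr n k r j u v = addr n k r' j u v := by
  have hw := le_words n k
  have hmod : ∀ x, x % dd n < dd n := fun x => Nat.mod_lt _ (dd_pos n)
  have hc : ∀ q < dd n, ∀ a < dd n, ∀ x, cell n k r q a x = cell n k r' q a x := by
    intro q hq a ha x
    unfold cell
    rw [blk_congr hk hn (h _ (by omega)) fun i hi => h _ (table_index_lt hq hi)]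
    unfold sub
    rw [h _ (by omega)]
  have hs : ∀ c < dd n, ∀ l e, smp n r c l e = smp n r' c l e := by
    intro c hc l e
    unfold smp
    rw [h _ (by omega), h _ (by omega)]
  unfold addr
  rw [hc _ (hmod _) _ (hmod _), hc _ (hmod _) _ (hmod _), hs _ (hmod _)]

theorem good_congr (hk : 1 ≤ k) (hn : 2 * k ≤ n) {E : Finset (Sym2 (Fin n))} {r r' : ℕ → ℕ}
    (h : ∀ i < words n k, r i = r' i) (hg : Good n k r E) : Good n k r' E := by
  have : hits n k r' = hits n k r := by
    ext e c
    unfold hits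
    simp only [addr_congr hk hn h]
  unfold Good
  rwa [this]

open MeasureTheory in
theorem randomWords_cylinder {w W : ℕ} {r : ℕ → ℕ} (hr : r ∈ tapes W (2 ^ w)) :
    (randomWords w).real {ω | ∀ i < W, (ω i : ℕ) = r i} = 1 / ((2 ^ w : ℕ) : ℝ) ^ W := by
  have e : {ω : ℕ → Fin (2 ^ w) | ∀ i < W, (ω i : ℕ) = r i} =
      Set.pi (Finset.range W) fun i => {x : Fin (2 ^ w) | (x : ℕ) = r i} := by
    ext ω
    simp
  rw [e, measureReal_def, randomWords, Measure.infinitePi_pi _ fun i _ => MeasurableSet.of_discrete]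
  have hs : ∀ i ∈ Finset.range W, (PMF.uniformOfFintype (Fin (2 ^ w))).toMeasure
      {x : Fin (2 ^ w) | (x : ℕ) = r i} = 1 / ((2 ^ w : ℕ) : ENNReal) := by
    intro i hi
    have : {x : Fin (2 ^ w) | (x : ℕ) = r i} =
        {⟨r i, (mem_tapes.1 hr).1 i (Finset.mem_range.1 hi)⟩} := by
      ext x
      simp [Fin.ext_iff]
    rw [this, PMF.toMeasure_apply_singleton _ _ (measurableSet_singleton _)]
    simp
  rw [Finset.prod_congr rfl hs]
  simp

open MeasureTheory in
-- The property depends on the first W words only, so its failure is covered by the cylinders of the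
-- bad tapes, all of the same measure.
theorem randomWords_real_ge {w W : ℕ} {P : (ℕ → ℕ) → Prop}
    (hP : ∀ r r', (∀ i < W, r i = r' i) → P r → P r') {δ : ℝ}
    (h : cnt W (2 ^ w) (fun r => ¬ P r) ≤ δ * cnt W (2 ^ w) fun _ => True) :
    1 - δ ≤ (randomWords w).real {ω | P (drawnWords ω)} := by
  classical
  have : IsProbabilityMeasure (randomWords w) := by unfold randomWords; infer_instance
  have hm : (0 : ℝ) < ((2 ^ w : ℕ) : ℝ) ^ W := by positivity
  have h1 : (randomWords w).real {ω | ¬ P (drawnWords ω)} ≤ δ := by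
    have hsub : {ω : ℕ → Fin (2 ^ w) | ¬ P (drawnWords ω)} ⊆
        ⋃ r ∈ (tapes W (2 ^ w)).filter fun r => ¬ P r, {ω | ∀ i < W, (ω i : ℕ) = r i} := by
      intro ω hω
      simp only [Set.mem_iUnion]
      have hag : ∀ i < W, (fun i => if i < W then (ω i : ℕ) else 0) i = drawnWords ω i := by
        intro i hi
        simp [hi, drawnWords]
      refine ⟨fun i => if i < W then (ω i : ℕ) else 0, Finset.mem_filter.2 ⟨mem_tapes.2
        ⟨fun i hi => ?_, fun i hi => ?_⟩, fun hp => hω (hP _ _ hag hp)⟩, fun i hi => ?_⟩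
      · simp [hi]
      · simp [Nat.not_lt.2 hi]
      · simp [hi]
    refine (measureReal_mono hsub (measure_ne_top _ _)).trans
      ((measureReal_biUnion_finset_le _ _).trans ?_)
    rw [Finset.sum_congr rfl fun r hr => randomWords_cylinder (Finset.mem_filter.1 hr).1,
      Finset.sum_const, nsmul_eq_mul, mul_one_div, div_le_iff₀ hm]
    refine le_trans (le_of_eq ?_) (h.trans (le_of_eq ?_))
    · unfold cnt
      congr!
    · unfold cnt
      rw [Finset.filter_true, card_tapes]
      push_cast
      rfl
  -- Subadditivity suffices to pass to the complement, so no measurability of the event is required.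
  have h2 := measureReal_union_le (μ := randomWords w) {ω | P (drawnWords ω)}
    {ω | ¬ P (drawnWords ω)}
  have h3 : {ω : ℕ → Fin (2 ^ w) | P (drawnWords ω)} ∪ {ω | ¬ P (drawnWords ω)} = Set.univ := by
    ext ω
    simp [em]
  rw [h3, probReal_univ] at h2
  linarith

theorem exists_edges {E : Finset (Sym2 (Fin n))} {S : List (EdgeUpdate n)}
    (hE : E = streamEdges S) (hk : 2 * k ≤ n) (hk1 : 1 ≤ k) {M : Finset (Sym2 (Fin n))}
    (hM : IsKMatching (streamGraph S) k M) : ∃ μ : ℕ → Sym2 (Fin n), (∀ i < k, μ i ∈ E) ∧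
      ∀ i < k, ∀ j < k, i ≠ j → ∀ x, ¬ (x ∈ μ i ∧ x ∈ μ j) := by
  obtain ⟨⟨hG, hd⟩, hc⟩ := hM
  let φ := M.equivFinOfCardEq hc
  refine ⟨fun i => if h : i < k then φ.symm ⟨i, h⟩ else s(⟨0, by omega⟩, ⟨0, by omega⟩),
    fun i hi => ?_, fun i hi j hj hij => ?_⟩
  · have h1 := hG _ (φ.symm ⟨i, hi⟩).2
    rw [streamGraph, SimpleGraph.edgeSet_fromEdgeSet] at h1
    simp only [hi, dif_pos, hE]
    exact Finset.mem_coe.1 h1.1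
  · simp only [hi, hj, dif_pos]
    refine hd _ (φ.symm ⟨i, hi⟩).2 _ (φ.symm ⟨j, hj⟩).2 fun h => hij ?_
    have := φ.symm.injective (Subtype.ext h)
    simpa using this

theorem probability_good_ge {w : ℕ} (hw : w = wd n) (hk : 1 ≤ k) (hn : 2 * k ≤ n)
    {S : List (EdgeUpdate n)} (hM : ∃ M, IsKMatching (streamGraph S) k M) :
    1 - 11 / (20 * (k : ℝ) ^ 3 * Real.log (2 * k)) ≤ (randomWords w).real
      {ω | Good n k (drawnWords ω) (streamEdges S)} := by
  obtain ⟨M, hM⟩ := hM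
  obtain ⟨μ, hμ, hdis⟩ := exists_edges rfl hn hk hM
  refine randomWords_real_ge (P := fun r => Good n k r (streamEdges S)) (W := words n k)
    (fun r r' h => good_congr hk hn h) ?_
  rw [hw]
  exact (cnt_not_good_le hk hn hμ hdis).trans
    (mul_le_mul_of_nonneg_right (failure_bound hk hn) cnt_nonneg)

end Probability

/-! ### The resources -/

section Resources

variable {n k : ℕ}

theorem lg_pos (n : ℕ) : 0 < lg n := by unfold lg; omega

theorem lg_le_log (hn : 2 ≤ n) : (lg n : ℝ) ≤ 3 * Real.log n := by
  have hn' : (2 : ℝ) ≤ n := by exact_mod_cast hn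
  have h1 : (Nat.log 2 n : ℝ) * Real.log 2 ≤ Real.log n := by
    rw [← Real.log_pow]
    refine Real.log_le_log (by positivity) ?_
    exact_mod_cast Nat.pow_log_le_self 2 (show n ≠ 0 by omega)
  have h2 : Real.log 2 ≤ Real.log n := Real.log_le_log (by norm_num) hn'
  have h3 := Real.log_two_gt_d9
  have h4 : (0 : ℝ) ≤ Nat.log 2 n := Nat.cast_nonneg _
  have e : (lg n : ℝ) = Nat.log 2 n + 1 := by unfold lg; push_cast; rfl
  rw [e]
  nlinarith

/-- The constant is 4 + 160 for the random words, 102400 for the two numbers kept per class, and 1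
for the digits of the search. -/
theorem space_le (hk : 1 ≤ k) : space n k ≤ 102565 * (k * k * dd n ^ 9) := by
  have hD := dd_pos n
  unfold space words total cells blocks subRange gRange jj
  generalize dd n = D at *
  have h1 : D ≤ k * k * D ^ 9 := by
    calc D = 1 * 1 * D ^ 1 := by ring
      _ ≤ k * k * D ^ 9 := by
        gcongr
        norm_num
  have h2 : D * (160 * k * k) ≤ 160 * (k * k * D ^ 9) := by
    calc D * (160 * k * k) = 160 * (k * k * D ^ 1) := by ring
      _ ≤ 160 * (k * k * D ^ 9) := by
        gcongr
        norm_num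
  have h3 : k ≤ k * k * D ^ 9 := by
    calc k = k * 1 * 1 := by ring
      _ ≤ k * k * D ^ 9 := by
        gcongr
        exact Nat.one_le_pow _ _ hD
  have h4 : 2 * (D * D * D * D * D * 2 * (8 * k * (20 * D * D)) * (8 * k * (20 * D * D))) =
      102400 * (k * k * D ^ 9) := by ring
  omega

theorem space_bits_le (hk : 1 ≤ k) (g : ℕ) : (g + space n k) * wd n ≤
    (g + 102565) * 1024 ^ 9 * 128 * (k * k * lg n ^ 10) := by
  have h := space_le (n := n) hk
  have h1 : 1 ≤ k * k * dd n ^ 9 := by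
    have := dd_pos n
    have : 0 < k * k * dd n ^ 9 := by positivity
    omega
  calc (g + space n k) * wd n ≤ (g * (k * k * dd n ^ 9) + 102565 * (k * k * dd n ^ 9)) * wd n := by
        gcongr
        exact Nat.le_mul_of_pos_right _ h1
    _ = (g + 102565) * 1024 ^ 9 * 128 * (k * k * lg n ^ 10) := by
        unfold dd wd; ring

theorem updateTime_le_lg (n : ℕ) :
    updateTime n ≤ (120 + updateBody.len) * 1024 ^ 5 * lg n ^ 10 := by
  have h := lg_pos n
  calc updateTime n ≤ (120 + updateBody.len) * jj n := updateTime_le n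
    _ = (120 + updateBody.len) * 1024 ^ 5 * lg n ^ 5 := by unfold jj dd; ring
    _ ≤ (120 + updateBody.len) * 1024 ^ 5 * lg n ^ 10 := by
        gcongr
        norm_num

end Resources

end MatchingSketch

/-! ### The main theorem -/

open MatchingSketch

theorem mainTheorem5 :
    ∃ (A : StreamingAlgorithm) (C : ℝ) (a : ℕ),
      ∀ (n k : ℕ), 1 ≤ k → 2 * k ≤ n →
      ∀ S : List (EdgeUpdate n), IsGraphStream S →
      ∃ M' : (ℕ → Fin (2 ^ A.wordLength n)) → Finset (Sym2 (Fin n)),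
        (∀ ω, ∃ T B : ℕ, A.Outputs k S ω T B (M' ω) ∧
          (B : ℝ) ≤ C * ((k : ℝ) ^ 2 * Real.log n ^ a) ∧
          (T : ℝ) ≤ C * Real.log n ^ a) ∧
        (∀ ω, IsEdgeMatching (streamGraph S) (M' ω)) ∧
        ((∃ M, IsKMatching (streamGraph S) k M) →
          1 - 11 / (20 * (k : ℝ) ^ 3 * Real.log (2 * k)) ≤
            (WordRAM.randomWords (A.wordLength n)).real
              {ω | IsKMatching (streamGraph S) k (M' ω)}) ∧
        ((¬ ∃ M, IsKMatching (streamGraph S) k M) → ∀ ω, M' ω = ∅) := by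
  set c₁ : ℕ := (alg.numRegs + 102565) * 1024 ^ 9 * 128 with hc₁
  set c₂ : ℕ := (120 + updateBody.len) * 1024 ^ 5 with hc₂
  -- The exponent 10 counts nine factors `dd n` in the number of cells and one for the word length.
  -- The factor 3 ^ 10 converts `lg n` to the natural logarithm.
  refine ⟨alg, (c₁ + c₂ : ℝ) * 3 ^ 10, 10, fun n k hk hn S hS => ?_⟩
  choose T B M hO hB hT hM using fun ω => run hk hn ω S hS
  have hlg : (lg n : ℝ) ^ 10 ≤ 3 ^ 10 * Real.log n ^ 10 := by
    rw [← mul_pow]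
    exact pow_le_pow_left₀ (Nat.cast_nonneg _) (lg_le_log (by omega)) _
  have hlog : 0 ≤ Real.log n ^ 10 := by
    have : (0 : ℝ) ≤ (lg n : ℝ) ^ 10 := by positivity
    linarith
  refine ⟨M, fun ω => ⟨T ω, B ω, hO ω, ?_, ?_⟩, fun ω => ?_, fun hex => ?_, fun hno ω => ?_⟩
  · have h1 : (B ω : ℝ) ≤ c₁ * ((k : ℝ) * k * (lg n : ℝ) ^ 10) := by
      exact_mod_cast (hB ω).trans (space_bits_le hk _)
    calc (B ω : ℝ) ≤ c₁ * ((k : ℝ) * k * (lg n : ℝ) ^ 10) := h1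
      _ ≤ (c₁ + c₂) * ((k : ℝ) * k * (3 ^ 10 * Real.log n ^ 10)) := by
          gcongr
          exact le_add_of_nonneg_right (Nat.cast_nonneg _)
      _ = _ := by ring
  · have h1 : (T ω : ℝ) ≤ c₂ * (lg n : ℝ) ^ 10 := by
      exact_mod_cast (hT ω).trans (updateTime_le_lg n)
    calc (T ω : ℝ) ≤ c₂ * (lg n : ℝ) ^ 10 := h1
      _ ≤ (c₁ + c₂) * (3 ^ 10 * Real.log n ^ 10) := by
          gcongr
          exact le_add_of_nonneg_left (Nat.cast_nonneg _)
      _ = _ := by ring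
  · rcases hM ω with h | ⟨h, -⟩
    · exact h.1
    · rw [h]
      exact ⟨fun e he => absurd he (Finset.notMem_empty e),
        fun e he => absurd he (Finset.notMem_empty e)⟩
  · refine (probability_good_ge (alg_wordLength n) hk hn hex).trans ?_
    have : MeasureTheory.IsProbabilityMeasure (randomWords (alg.wordLength n)) := by
      unfold randomWords; infer_instance
    refine MeasureTheory.measureReal_mono (fun ω hω => ?_) (MeasureTheory.measure_ne_top _ _)
    exact (hM ω).resolve_right fun h => h.2 hω
  · rcases hM ω with h | ⟨h, -⟩
    · exact absurd ⟨_, h⟩ hno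
    · exact h
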